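/- Let $k\ge 1$ be a fixed integer. An instance consists of $n\ge 1$ points $p_1,\dots,p_n$ in the Euclidean plane, a finite set $C$ of colors, a color in $C$ for each point, and, for each color $q\in C$, integers $\ell(q)\ge 0$ and $u(q)\ge 0$. A $k$-clustering consists of $k$ centers $c_1,\dots,c_k$ in the plane and a partition $P_1,\dots,P_k$ of the points into $k$ (possibly empty) clusters. The radius of $P_j$ is the maximum distance from $c_j$ to a point of $P_j$ (and $0$ if $P_j$ is empty). The clustering is fair if, for every $j$ and every $q\in C$, the cluster $P_j$ contains at least $\ell(q)$ and at most $u(q)$ points of color $q$. A fair $k$-clustering is optimal if its maximum cluster radius $\max_j \mathrm{radius}(P_j)$ is minimum among all fair $k$-clusterings (over all choices of centers and partition). Then there is an algorithm that, given any such instance, computes an optimal fair $k$-clustering (its centers, its partition and its maximum radius), or reports that no fair $k$-clustering exists, in $O(|C|\,n^{2k+4})$ time, where the constant in the $O$ depends only on $k$. The model of computation is the real RAM: arithmetic operations, square roots and comparisons of real numbers, additions, subtractions and comparisons of natural numbers, and (indirect) memory accesses take one step each. -/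

import Mathlib

/-! ## Real RAM programs with a step count

The memory consists of named unbounded arrays, some of natural numbers and some of exact real
numbers. A program is a fixed finite text, so it uses finitely many array names; addresses inside
an array are computed at run time. Every arithmetic operation, memory access, comparison and
assignment is one step. There is no conversion from reals to naturals (no rounding), no
multiplication of naturals in one step, and the only real constants are `0` and `1`. -/

namespace RealRAM

/-- The memory: `nat a i` and `real a i` are the cells with address `i` of the arrays named `a`. -/
structure State where
  nat : ℕ → ℕ → ℕ
  real : ℕ → ℕ → ℝ

/-- Write the number `v` to the cell `i` of the array `a` of naturals. -/
def State.writeNat (s : State) (a i v : ℕ) : State :=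
  { s with nat := Function.update s.nat a (Function.update (s.nat a) i v) }

/-- Write the number `x` to the cell `i` of the array `a` of reals. -/
noncomputable def State.writeReal (s : State) (a i : ℕ) (x : ℝ) : State :=
  { s with real := Function.update s.real a (Function.update (s.real a) i x) }

/-- Expressions for natural numbers; `read a i` is the cell with the computed address `i`. -/
inductive NatExpr where
  | const (c : ℕ)
  | read (a : ℕ) (i : NatExpr)
  | add (e f : NatExpr)
  | sub (e f : NatExpr)

/-- The value of an expression (subtraction is truncated at `0`). -/
def NatExpr.eval (s : State) : NatExpr → ℕ
  | .const c => c
  | .read a i => s.nat a (i.eval s)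
  | .add e f => e.eval s + f.eval s
  | .sub e f => e.eval s - f.eval s

/-- The number of steps for evaluating an expression. -/
def NatExpr.cost : NatExpr → ℕ
  | .const _ => 1
  | .read _ i => i.cost + 1
  | .add e f => e.cost + f.cost + 1
  | .sub e f => e.cost + f.cost + 1

/-- Expressions for real numbers. -/
inductive RealExpr where
  | zero
  | one
  | read (a : ℕ) (i : NatExpr)
  | add (e f : RealExpr)
  | sub (e f : RealExpr)
  | mul (e f : RealExpr)
  | div (e f : RealExpr)
  | sqrt (e : RealExpr)

/-- The value of an expression. Division by `0` and the square root of a negative number return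
`0`; a program can test for these cases beforehand. -/
noncomputable def RealExpr.eval (s : State) : RealExpr → ℝ
  | .zero => 0
  | .one => 1
  | .read a i => s.real a (i.eval s)
  | .add e f => e.eval s + f.eval s
  | .sub e f => e.eval s - f.eval s
  | .mul e f => e.eval s * f.eval s
  | .div e f => e.eval s / f.eval s
  | .sqrt e => Real.sqrt (e.eval s)

/-- The number of steps for evaluating an expression. -/
def RealExpr.cost : RealExpr → ℕ
  | .zero => 1
  | .one => 1
  | .read _ i => i.cost + 1
  | .add e f => e.cost + f.cost + 1
  | .sub e f => e.cost + f.cost + 1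
  | .mul e f => e.cost + f.cost + 1
  | .div e f => e.cost + f.cost + 1
  | .sqrt e => e.cost + 1

/-- Tests: comparisons of naturals, comparisons of reals, and their Boolean combinations. -/
inductive Test where
  | natLe (e f : NatExpr)
  | realLe (e f : RealExpr)
  | not (b : Test)
  | and (b c : Test)

/-- The test `b` succeeds in the state `s`. -/
def Test.Holds (s : State) : Test → Prop
  | .natLe e f => e.eval s ≤ f.eval s
  | .realLe e f => e.eval s ≤ f.eval s
  | .not b => ¬ b.Holds s
  | .and b c => b.Holds s ∧ c.Holds s

/-- The number of steps for evaluating a test. -/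
def Test.cost : Test → ℕ
  | .natLe e f => e.cost + f.cost + 1
  | .realLe e f => e.cost + f.cost + 1
  | .not b => b.cost + 1
  | .and b c => b.cost + c.cost + 1

/-- Programs. -/
inductive Prog where
  | skip
  | setNat (a : ℕ) (i e : NatExpr)
  | setReal (a : ℕ) (i : NatExpr) (e : RealExpr)
  | seq (p q : Prog)
  | ite (b : Test) (p q : Prog)
  | loop (b : Test) (p : Prog)

/-- `Exec p s t s'`: started in the state `s`, the program `p` halts after exactly `t` steps, in
the state `s'`. (`loop b p` is the while loop with guard `b` and body `p`.) -/
inductive Exec : Prog → State → ℕ → State → Prop where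
  | skip (s : State) : Exec .skip s 1 s
  | setNat (a : ℕ) (i e : NatExpr) (s : State) :
      Exec (.setNat a i e) s (i.cost + e.cost + 1) (s.writeNat a (i.eval s) (e.eval s))
  | setReal (a : ℕ) (i : NatExpr) (e : RealExpr) (s : State) :
      Exec (.setReal a i e) s (i.cost + e.cost + 1) (s.writeReal a (i.eval s) (e.eval s))
  | seq {p q : Prog} {s s₁ s₂ : State} {t₁ t₂ : ℕ} :
      Exec p s t₁ s₁ → Exec q s₁ t₂ s₂ → Exec (.seq p q) s (t₁ + t₂) s₂
  | iteTrue {b : Test} {p q : Prog} {s s₁ : State} {t : ℕ} :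
      b.Holds s → Exec p s t s₁ → Exec (.ite b p q) s (b.cost + 1 + t) s₁
  | iteFalse {b : Test} {p q : Prog} {s s₁ : State} {t : ℕ} :
      ¬ b.Holds s → Exec q s t s₁ → Exec (.ite b p q) s (b.cost + 1 + t) s₁
  | loopTrue {b : Test} {p : Prog} {s s₁ s₂ : State} {t₁ t₂ : ℕ} :
      b.Holds s → Exec p s t₁ s₁ → Exec (.loop b p) s₁ t₂ s₂ →
      Exec (.loop b p) s (b.cost + 1 + t₁ + t₂) s₂
  | loopFalse {b : Test} {p : Prog} {s : State} :
      ¬ b.Holds s → Exec (.loop b p) s (b.cost + 1) s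

/-- Execution is deterministic: the running time and the final state are unique. -/
theorem Exec.unique {p : Prog} {s s₁ : State} {t₁ : ℕ} (h₁ : Exec p s t₁ s₁) :
    ∀ {t₂ : ℕ} {s₂ : State}, Exec p s t₂ s₂ → t₁ = t₂ ∧ s₁ = s₂ := by
  induction h₁ with
  | skip s => intro _ _ h; cases h; exact ⟨rfl, rfl⟩
  | setNat a i e s => intro _ _ h; cases h; exact ⟨rfl, rfl⟩
  | setReal a i e s => intro _ _ h; cases h; exact ⟨rfl, rfl⟩
  | seq _ _ ih₁ ih₂ =>
    intro _ _ h
    cases h with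
    | seq g₁ g₂ =>
      obtain ⟨rfl, rfl⟩ := ih₁ g₁
      obtain ⟨rfl, rfl⟩ := ih₂ g₂
      exact ⟨rfl, rfl⟩
  | iteTrue hb _ ih =>
    intro _ _ h
    cases h with
    | iteTrue _ g => obtain ⟨rfl, rfl⟩ := ih g; exact ⟨rfl, rfl⟩
    | iteFalse hb' _ => exact absurd hb hb'
  | iteFalse hb _ ih =>
    intro _ _ h
    cases h with
    | iteTrue hb' _ => exact absurd hb' hb
    | iteFalse _ g => obtain ⟨rfl, rfl⟩ := ih g; exact ⟨rfl, rfl⟩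
  | loopTrue hb _ _ ih₁ ih₂ =>
    intro _ _ h
    cases h with
    | loopTrue _ g₁ g₂ =>
      obtain ⟨rfl, rfl⟩ := ih₁ g₁
      obtain ⟨rfl, rfl⟩ := ih₂ g₂
      exact ⟨rfl, rfl⟩
    | loopFalse hb' => exact absurd hb hb'
  | loopFalse hb =>
    intro _ _ h
    cases h with
    | loopTrue hb' _ _ => exact absurd hb' hb
    | loopFalse _ => exact ⟨rfl, rfl⟩

end RealRAM

/-! ## The fair clustering problem -/

namespace FairClustering

/-- An instance with `n` points in the Euclidean plane and `m` colors: the points, the color of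
each point, and the lower and upper bounds of each color. -/
structure Instance (n m : ℕ) where
  point : Fin n → EuclideanSpace ℝ (Fin 2)
  color : Fin n → Fin m
  lower : Fin m → ℕ
  upper : Fin m → ℕ

/-- A `k`-clustering of `n` points: `k` centers, and a partition of the points into `k` (possibly
empty) clusters, given by the index of the cluster of each point. -/
structure Clustering (n k : ℕ) where
  center : Fin k → EuclideanSpace ℝ (Fin 2)
  assign : Fin n → Fin k

variable {n m k : ℕ}

/-- The (indices of the) points in the `j`-th cluster. -/
def Clustering.cluster (c : Clustering n k) (j : Fin k) : Finset (Fin n) :=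
  {i | c.assign i = j}

/-- Every cluster has at least `lower q` and at most `upper q` points of each color `q`. -/
def Instance.IsFair (I : Instance n m) (c : Clustering n k) : Prop :=
  ∀ (j : Fin k) (q : Fin m),
    I.lower q ≤ ((c.cluster j).filter (fun i => I.color i = q)).card ∧
    ((c.cluster j).filter (fun i => I.color i = q)).card ≤ I.upper q

/-- The radius of a cluster: the maximum distance from its center to a point of it (`0` if the
cluster is empty). -/
noncomputable def Instance.radius (I : Instance n m) (c : Clustering n k) (j : Fin k) : NNReal :=
  (c.cluster j).sup (fun i => nndist (I.point i) (c.center j))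

/-- The cost of a clustering: the maximum radius of its clusters. -/
noncomputable def Instance.maxRadius (I : Instance n m) (c : Clustering n k) : NNReal :=
  Finset.univ.sup (fun j => I.radius c j)

/-- A fair clustering of minimum cost. -/
def Instance.IsOptimal (I : Instance n m) (c : Clustering n k) : Prop :=
  I.IsFair c ∧ ∀ d : Clustering n k, I.IsFair d → I.maxRadius c ≤ I.maxRadius d

/-- The initial memory for an instance. Naturals: array `0` starts with `n` and `m`, array `1`
holds the colors of the points, the arrays `2` and `3` the lower and the upper bounds. Reals: the
arrays `0` and `1` hold the coordinates of the points. All other cells are `0`. -/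
noncomputable def Instance.input (I : Instance n m) : RealRAM.State where
  nat a i :=
    match a with
    | 0 => if i = 0 then n else if i = 1 then m else 0
    | 1 => if h : i < n then (I.color ⟨i, h⟩ : ℕ) else 0
    | 2 => if h : i < m then I.lower ⟨i, h⟩ else 0
    | 3 => if h : i < m then I.upper ⟨i, h⟩ else 0
    | _ => 0
  real a i :=
    match a with
    | 0 => if h : i < n then I.point ⟨i, h⟩ 0 else 0
    | 1 => if h : i < n then I.point ⟨i, h⟩ 1 else 0
    | _ => 0

/-- The clustering `c` is written in the memory: array `5` of naturals holds the clusters of the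
points, the arrays `2` and `3` of reals hold the coordinates of the centers. -/
def Clustering.IsWritten (c : Clustering n k) (s : RealRAM.State) : Prop :=
  (∀ i : Fin n, s.nat 5 i = c.assign i) ∧
    ∀ j : Fin k, s.real 2 j = c.center j 0 ∧ s.real 3 j = c.center j 1

/-- The final memory `s` solves the fair `k`-clustering problem: either the flag (cell `0` of array
`4` of naturals) is `1`, and an optimal fair `k`-clustering is written together with its maximum
radius (cell `0` of array `4` of reals); or the flag is `0`, and there is no fair `k`-clustering. -/
def Instance.IsSolvedBy (I : Instance n m) (k : ℕ) (s : RealRAM.State) : Prop :=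
  (s.nat 4 0 = 1 ∧ ∃ c : Clustering n k,
    I.IsOptimal c ∧ c.IsWritten s ∧ s.real 4 0 = (I.maxRadius c : ℝ)) ∨
  (s.nat 4 0 = 0 ∧ ¬ ∃ c : Clustering n k, I.IsFair c)

end FairClustering

/-! Polynomially many configurations of centers and radius suffice, and each is tested by shifting
points along augmenting paths, one color at a time.

Geometry. In a fair clustering each nonempty cluster may be given its smallest enclosing circle,
whose center is the midpoint of two of its points or the circumcenter of three
(`exists_smallest_circle`). Let r be the largest of these radii; it does not exceed the original
maximum radius. Every other nonempty cluster fits into a disk of radius r, so the disks of radius r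
around its points have a common point, and a leftmost common point is the leftmost point of one of
these disks or a crossing of two of their boundary circles (`exists_corner`). Thus three points
determine r and the center of a largest cluster, and two points determine each of the other k - 1
centers: O(n^(2k+1)) configurations. Since all clusters obey the same bounds, the largest one may be
relabelled as the last (`exists_candidate`).

Test. With centers and r fixed, a point may go to any cluster whose disk contains it. The bounds for
different colors concern disjoint sets of points, so the colors are balanced independently. From any
admissible assignment, measure the total excess and deficiency of one color. If the bounds can be
met at all, a cut argument yields a path of clusters along which shifting one point per edge
decreases this violation (`exists_improving_path`, `violation_lt`). It is at most 2n at the start,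
so 2n rounds suffice. A round scans the points once and tries all simple paths on k clusters, whose
number depends only on k. A test takes O(|C| n^2) steps, and the whole search O(|C| n^(2k+3)), which
is within the claimed bound.

Correctness. Degenerate formulas (collinear or coincident points) only produce superfluous
candidates, because whatever is stored is a verified fair clustering (`Data.Sound`), while every
feasible enumerated radius is reached (`run_search`). So the stored number bounds the stored
clustering from above and every fair clustering from below (`isSolvedBy_search`).

Cost. The algorithm is written with counting loops (`CountProg`). Their cost is read off from the
nesting depth (`cost_le`), and they compile to while programs (`exec_compile`). -/

namespace RealRAM

/-! ### Programs with counting loops: semantics, unchanged memory, compilation and cost. -/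

@[simp] theorem State.writeNat_nat (s : State) (a i v b j : ℕ) :
    (s.writeNat a i v).nat b j = if b = a ∧ j = i then v else s.nat b j := by
  unfold State.writeNat
  by_cases hb : b = a
  · subst hb
    by_cases hj : j = i <;> simp [hj]
  · simp [hb]

@[simp] theorem State.writeNat_real (s : State) (a i v : ℕ) :
    (s.writeNat a i v).real = s.real := rfl

@[simp] theorem State.writeReal_nat (s : State) (a i : ℕ) (x : ℝ) :
    (s.writeReal a i x).nat = s.nat := rfl

@[simp] theorem State.writeReal_real (s : State) (a i : ℕ) (x : ℝ) (b j : ℕ) :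
    (s.writeReal a i x).real b j = if b = a ∧ j = i then x else s.real b j := by
  unfold State.writeReal
  by_cases hb : b = a
  · subst hb
    by_cases hj : j = i <;> simp [hj]
  · simp [hb]

/-- Programs whose loops are counting loops: `count v b p` runs `p` with cell `0` of the array `v`
equal to `0, 1, …, N - 1`, where `N` is the content of cell `b` of array `0`. -/
inductive CountProg where
  | skip
  | setNat (a : ℕ) (i e : NatExpr)
  | setReal (a : ℕ) (i : NatExpr) (e : RealExpr)
  | seq (p q : CountProg)
  | ite (b : Test) (p q : CountProg)
  | count (v b : ℕ) (p : CountProg)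

namespace CountProg

/-- The state in which the body of a counting loop is entered for the `i`-th time, up to the
counter. -/
def iter (f : State → State) (v : ℕ) (s : State) : ℕ → State
  | 0 => s
  | i + 1 => f ((iter f v s i).writeNat v 0 i)

open Classical in
/-- The final state of a program. -/
noncomputable def run : CountProg → State → State
  | skip, s => s
  | setNat a i e, s => s.writeNat a (i.eval s) (e.eval s)
  | setReal a i e, s => s.writeReal a (i.eval s) (e.eval s)
  | seq p q, s => q.run (p.run s)
  | ite b p q, s => if b.Holds s then p.run s else q.run s
  | count v b p, s => (iter p.run v s (s.nat 0 b)).writeNat v 0 (s.nat 0 b)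

/-- The program may write to the array `a` of naturals. -/
def WritesNat : CountProg → ℕ → Prop
  | skip, _ => False
  | setNat a _ _, c => c = a
  | setReal _ _ _, _ => False
  | seq p q, c => p.WritesNat c ∨ q.WritesNat c
  | ite _ p q, c => p.WritesNat c ∨ q.WritesNat c
  | count v _ p, c => c = v ∨ p.WritesNat c

/-- The program may write to the array `a` of reals. -/
def WritesReal : CountProg → ℕ → Prop
  | skip, _ => False
  | setNat _ _ _, _ => False
  | setReal a _ _, c => c = a
  | seq p q, c => p.WritesReal c ∨ q.WritesReal c
  | ite _ p q, c => p.WritesReal c ∨ q.WritesReal c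
  | count _ _ p, c => p.WritesReal c

/-- Loop bodies change neither the counter nor the bounds. -/
def WellFormed : CountProg → Prop
  | skip => True
  | setNat _ _ _ => True
  | setReal _ _ _ => True
  | seq p q => p.WellFormed ∧ q.WellFormed
  | ite _ p q => p.WellFormed ∧ q.WellFormed
  | count v _ p => v ≠ 0 ∧ ¬ p.WritesNat v ∧ ¬ p.WritesNat 0 ∧ p.WellFormed

/-- The translation to programs with while loops. -/
def compile : CountProg → Prog
  | skip => .skip
  | setNat a i e => .setNat a i e
  | setReal a i e => .setReal a i e
  | seq p q => .seq p.compile q.compile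
  | ite b p q => .ite b p.compile q.compile
  | count v b p => .seq (.setNat v (.const 0) (.const 0))
      (.loop (.not (.natLe (.read 0 (.const b)) (.read v (.const 0))))
        (.seq p.compile (.setNat v (.const 0) (.add (.read v (.const 0)) (.const 1)))))

/-- An upper bound for the number of steps, where `N b` is the content of cell `b` of array `0`. -/
def cost (N : ℕ → ℕ) : CountProg → ℕ
  | skip => 1
  | setNat _ i e => i.cost + e.cost + 1
  | setReal _ i e => i.cost + e.cost + 1
  | seq p q => p.cost N + q.cost N
  | ite b p q => b.cost + 1 + (p.cost N + q.cost N)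
  -- Initializing the counter takes 3 steps and the last guard at most 8, hence 11; each round
  -- spends 7 steps on the guard and 6 on the increment, hence 13.
  | count _ b p => 11 + N b * (p.cost N + 13)

/-- The states agree on all arrays to which the program does not write. -/
structure Frame (p : CountProg) (s s' : State) : Prop where
  nat : ∀ a, ¬ p.WritesNat a → s'.nat a = s.nat a
  real : ∀ a, ¬ p.WritesReal a → s'.real a = s.real a

/-- The hypothesis on `p` is the induction hypothesis available in the loop case of `frame_run`;
`frame_iter` is the version without it. -/
theorem frame_iter_of {p : CountProg} (hp : ∀ s, Frame p s (p.run s)) (v b : ℕ) (s : State)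
    (i : ℕ) : Frame (count v b p) s (iter p.run v s i) := by
  induction i with
  | zero => exact ⟨fun _ _ => rfl, fun _ _ => rfl⟩
  | succ i ih =>
    refine ⟨fun c hc => ?_, fun c hc => ?_⟩
    · have hc' := hc
      simp only [WritesNat, not_or] at hc'
      rw [iter, (hp _).nat c hc'.2]
      funext j
      simp [hc'.1, ih.nat c hc]
    · rw [iter, (hp _).real c hc]
      simp [ih.real c hc]

theorem frame_run (p : CountProg) : ∀ s, Frame p s (p.run s) := by
  induction p with
  | skip => exact fun s => ⟨fun _ _ => rfl, fun _ _ => rfl⟩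
  | setNat a i e =>
    refine fun s => ⟨fun c hc => ?_, fun _ _ => rfl⟩
    funext j
    have hc : c ≠ a := hc
    simp [run, hc]
  | setReal a i e =>
    refine fun s => ⟨fun _ _ => rfl, fun c hc => ?_⟩
    funext j
    have hc : c ≠ a := hc
    simp [run, hc]
  | seq p q hp hq =>
    refine fun s => ⟨fun c hc => ?_, fun c hc => ?_⟩
    · simp only [WritesNat, not_or] at hc
      rw [run, (hq _).nat c hc.2, (hp _).nat c hc.1]
    · simp only [WritesReal, not_or] at hc
      rw [run, (hq _).real c hc.2, (hp _).real c hc.1]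
  | ite b p q hp hq =>
    refine fun s => ⟨fun c hc => ?_, fun c hc => ?_⟩
    · simp only [WritesNat, not_or] at hc
      rw [run]
      split
      · exact (hp _).nat c hc.1
      · exact (hq _).nat c hc.2
    · simp only [WritesReal, not_or] at hc
      rw [run]
      split
      · exact (hp _).real c hc.1
      · exact (hq _).real c hc.2
  | count v b p hp =>
    intro s
    refine ⟨fun c hc => ?_, fun c hc => ?_⟩
    · have hc' := hc
      simp only [WritesNat, not_or] at hc'
      funext j
      simp [run, hc'.1, (frame_iter_of hp v b s _).nat c hc]
    · simp [run, (frame_iter_of hp v b s _).real c hc]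

theorem frame_iter (p : CountProg) (v b : ℕ) (s : State) (i : ℕ) :
    Frame (count v b p) s (iter p.run v s i) :=
  frame_iter_of (frame_run p) v b s i

/-- The invariant rule for counting loops. -/
theorem count_rule {v b : ℕ} {p : CountProg} {s : State} (Inv : ℕ → State → Prop) (h0 : Inv 0 s)
    (hstep : ∀ i < s.nat 0 b, ∀ s', Frame (count v b p) s s' → Inv i s' →
      Inv (i + 1) (p.run (s'.writeNat v 0 i))) :
    ∃ s', Frame (count v b p) s s' ∧ Inv (s.nat 0 b) s' ∧
      (count v b p).run s = s'.writeNat v 0 (s.nat 0 b) := by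
  refine ⟨iter p.run v s (s.nat 0 b), frame_iter _ _ _ _ _, ?_, rfl⟩
  have : ∀ i ≤ s.nat 0 b, Inv i (iter p.run v s i) := by
    intro i
    induction i with
    | zero => exact fun _ => h0
    | succ i ih => exact fun hi => hstep i hi _ (frame_iter _ _ _ _ _) (ih (by omega))
  exact this _ le_rfl

/-- The while loop agrees with `iter` because well-formed bodies leave both the counter and the
bound alone: the incremented counter is the value that `iter` writes before the next round. Since
array `0` never changes, the same `N` bounds all nested loops. -/
theorem exec_compile {N : ℕ → ℕ} (p : CountProg) : ∀ s : State, p.WellFormed →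
    ¬ p.WritesNat 0 → s.nat 0 = N → ∃ t ≤ p.cost N, Exec p.compile s t (p.run s) := by
  induction p with
  | skip => exact fun s _ _ _ => ⟨1, le_rfl, .skip s⟩
  | setNat a i e => exact fun s _ _ _ => ⟨_, le_rfl, .setNat a i e s⟩
  | setReal a i e => exact fun s _ _ _ => ⟨_, le_rfl, .setReal a i e s⟩
  | seq p q hp hq =>
    intro s hw h0 hN
    simp only [WritesNat, not_or] at h0
    obtain ⟨t₁, ht₁, e₁⟩ := hp s hw.1 h0.1 hN
    obtain ⟨t₂, ht₂, e₂⟩ := hq (p.run s) hw.2 h0.2 (by rw [(frame_run p s).nat 0 h0.1, hN])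
    exact ⟨t₁ + t₂, by rw [cost]; omega, .seq e₁ e₂⟩
  | ite b p q hp hq =>
    intro s hw h0 hN
    simp only [WritesNat, not_or] at h0
    by_cases hb : b.Holds s
    · obtain ⟨t, ht, e⟩ := hp s hw.1 h0.1 hN
      refine ⟨b.cost + 1 + t, by rw [cost]; omega, ?_⟩
      rw [run, if_pos hb]
      exact .iteTrue hb e
    · obtain ⟨t, ht, e⟩ := hq s hw.2 h0.2 hN
      refine ⟨b.cost + 1 + t, by rw [cost]; omega, ?_⟩
      rw [run, if_neg hb]
      exact .iteFalse hb e
  | count v b p hp =>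
    intro s hw h0 hN
    obtain ⟨hv, hpv, hp0, hpw⟩ := hw
    have hb : s.nat 0 b = N b := by rw [hN]
    have hbound : ∀ i, ((iter p.run v s i).writeNat v 0 i).nat 0 = N := by
      intro i
      funext j
      simp [hv.symm, (frame_iter p v b s i).nat 0 h0, hN]
    -- The loop is followed from round `i` on, by induction on the number `d` of rounds left.
    have key : ∀ d i, i + d = N b → ∃ t ≤ 8 + d * (p.cost N + 13),
        Exec (.loop (.not (.natLe (.read 0 (.const b)) (.read v (.const 0))))
          (.seq p.compile (.setNat v (.const 0) (.add (.read v (.const 0)) (.const 1)))))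
          ((iter p.run v s i).writeNat v 0 i) t
          ((iter p.run v s (N b)).writeNat v 0 (N b)) := by
      intro d
      induction d with
      | zero =>
        intro i hi
        obtain rfl : i = N b := by omega
        refine ⟨_, ?_, .loopFalse ?_⟩
        · simp [Test.cost, NatExpr.cost]
        · simp [Test.Holds, NatExpr.eval]
          simp [hv.symm, (frame_iter p v b s _).nat 0 h0, hN]
      | succ d ih =>
        intro i hi
        obtain ⟨t₂, ht₂, e₂⟩ := ih (i + 1) (by omega)
        obtain ⟨t₁, ht₁, e₁⟩ := hp ((iter p.run v s i).writeNat v 0 i) hpw hp0 (hbound i)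
        have hcount : (p.run ((iter p.run v s i).writeNat v 0 i)).nat v 0 = i := by
          rw [(frame_run p _).nat v hpv]
          simp
        have e₃ := Exec.setNat v (.const 0) (.add (.read v (.const 0)) (.const 1))
          (p.run ((iter p.run v s i).writeNat v 0 i))
        simp only [NatExpr.eval, hcount] at e₃
        refine ⟨_, ?_, .loopTrue ?_ (.seq e₁ e₃) e₂⟩
        · simp only [Test.cost, NatExpr.cost]
          rw [Nat.add_mul, Nat.one_mul]
          omega
        · simp [Test.Holds, NatExpr.eval]
          simp [hv.symm, (frame_iter p v b s _).nat 0 h0, hN]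
          omega
    obtain ⟨t, ht, e⟩ := key (N b) 0 (by omega)
    refine ⟨3 + t, ?_, .seq (t₁ := 3) (.setNat v (.const 0) (.const 0) s) ?_⟩
    · rw [cost]
      omega
    · rw [run, hb]
      exact e

/-- The nesting depth of the loops with bound `b`. -/
def depth (b : ℕ) : CountProg → ℕ
  | skip => 0
  | setNat _ _ _ => 0
  | setReal _ _ _ => 0
  | seq p q => max (p.depth b) (q.depth b)
  | ite _ p q => max (p.depth b) (q.depth b)
  | count _ c p => p.depth b + if c = b then 1 else 0

/-- Only the cells `0` and `1` are used as loop bounds. -/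
def TwoBounds : CountProg → Prop
  | skip => True
  | setNat _ _ _ => True
  | setReal _ _ _ => True
  | seq p q => p.TwoBounds ∧ q.TwoBounds
  | ite _ p q => p.TwoBounds ∧ q.TwoBounds
  | count _ c p => (c = 0 ∨ c = 1) ∧ p.TwoBounds

/-- Each loop multiplies the cost by its bound, while sequences and branches take the larger
exponent and add the constants. Positivity of both bounds lets constants and smaller powers be
absorbed. -/
theorem cost_le (p : CountProg) : p.TwoBounds → ∃ K, ∀ N : ℕ → ℕ, 1 ≤ N 0 → 1 ≤ N 1 →
    p.cost N ≤ K * (N 1 ^ p.depth 1 * N 0 ^ p.depth 0) := by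
  have mono : ∀ {x y a b c d : ℕ}, 1 ≤ x → 1 ≤ y → a ≤ b → c ≤ d →
      y ^ a * x ^ c ≤ y ^ b * x ^ d := fun hx hy hab hcd =>
    Nat.mul_le_mul (Nat.pow_le_pow_right hy hab) (Nat.pow_le_pow_right hx hcd)
  have hmax : ∀ (K₁ K₂ a b c d x y C₁ C₂ B : ℕ), 1 ≤ x → 1 ≤ y →
      C₁ ≤ K₁ * (y ^ a * x ^ c) → C₂ ≤ K₂ * (y ^ b * x ^ d) →
      B + (C₁ + C₂) ≤ (B + (K₁ + K₂)) * (y ^ max a b * x ^ max c d) := by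
    intro K₁ K₂ a b c d x y C₁ C₂ B hx hy h₁ h₂
    have h₃ := mono hx hy (le_max_left a b) (le_max_left c d)
    have h₄ := mono hx hy (le_max_right a b) (le_max_right c d)
    have h₅ : 1 ≤ y ^ max a b * x ^ max c d :=
      Nat.mul_pos (Nat.pow_pos hy) (Nat.pow_pos hx)
    calc B + (C₁ + C₂) ≤ B * (y ^ max a b * x ^ max c d) +
          (K₁ * (y ^ max a b * x ^ max c d) + K₂ * (y ^ max a b * x ^ max c d)) :=
          Nat.add_le_add (Nat.le_mul_of_pos_right _ h₅) (Nat.add_le_add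
            (h₁.trans (Nat.mul_le_mul_left _ h₃)) (h₂.trans (Nat.mul_le_mul_left _ h₄)))
      _ = _ := by ring
  induction p with
  | skip => exact fun _ => ⟨1, fun N _ _ => by simp [cost, depth]⟩
  | setNat a i e => exact fun _ => ⟨i.cost + e.cost + 1, fun N _ _ => by simp [cost, depth]⟩
  | setReal a i e => exact fun _ => ⟨i.cost + e.cost + 1, fun N _ _ => by simp [cost, depth]⟩
  | seq p q hp hq =>
    intro h
    obtain ⟨K₁, h₁⟩ := hp h.1
    obtain ⟨K₂, h₂⟩ := hq h.2
    refine ⟨0 + (K₁ + K₂), fun N hn hm => ?_⟩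
    have := hmax _ _ _ _ _ _ _ _ _ _ 0 hn hm (h₁ N hn hm) (h₂ N hn hm)
    simpa only [cost, depth, Nat.zero_add] using this
  | ite b p q hp hq =>
    intro h
    obtain ⟨K₁, h₁⟩ := hp h.1
    obtain ⟨K₂, h₂⟩ := hq h.2
    refine ⟨b.cost + 1 + (K₁ + K₂), fun N hn hm => ?_⟩
    exact hmax _ _ _ _ _ _ _ _ _ _ (b.cost + 1) hn hm (h₁ N hn hm) (h₂ N hn hm)
  | count v c p hp =>
    intro h
    obtain ⟨K, hK⟩ := hp h.2
    -- The two overheads 11 and 13 of a counting loop add up to 24.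
    refine ⟨K + 24, fun N hn hm => ?_⟩
    have hc : N 1 ^ (count v c p).depth 1 * N 0 ^ (count v c p).depth 0 =
        N c * (N 1 ^ p.depth 1 * N 0 ^ p.depth 0) := by
      rcases h.1 with rfl | rfl <;> simp [depth, pow_succ] <;> ring
    have hcpos : 1 ≤ N c := by rcases h.1 with rfl | rfl <;> assumption
    rw [hc, cost]
    have h₁ := hK N hn hm
    set X := N 1 ^ p.depth 1 * N 0 ^ p.depth 0 with hX
    have hXpos : 1 ≤ X := Nat.mul_pos (Nat.pow_pos hm) (Nat.pow_pos hn)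
    have h₂ : 1 ≤ N c * X := Nat.mul_pos hcpos hXpos
    calc 11 + N c * (p.cost N + 13) ≤ 11 * (N c * X) + N c * (K * X + 13 * X) :=
          Nat.add_le_add (Nat.le_mul_of_pos_right _ h₂)
            (Nat.mul_le_mul_left _ (Nat.add_le_add h₁ (Nat.le_mul_of_pos_right _ hXpos)))
      _ = _ := by ring

/-- The sequence `p 0, …, p (k - 1)`. -/
def unroll (p : ℕ → CountProg) : ℕ → CountProg
  | 0 => skip
  | k + 1 => seq (unroll p k) (p k)

theorem writesNat_unroll {p : ℕ → CountProg} {k a : ℕ} :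
    (unroll p k).WritesNat a ↔ ∃ j < k, (p j).WritesNat a := by
  induction k with
  | zero => simp [unroll, WritesNat]
  | succ k ih => simp only [unroll, WritesNat, ih, Nat.exists_lt_succ_right]

theorem writesReal_unroll {p : ℕ → CountProg} {k a : ℕ} :
    (unroll p k).WritesReal a ↔ ∃ j < k, (p j).WritesReal a := by
  induction k with
  | zero => simp [unroll, WritesReal]
  | succ k ih => simp only [unroll, WritesReal, ih, Nat.exists_lt_succ_right]

theorem wellFormed_unroll {p : ℕ → CountProg} {k : ℕ} (h : ∀ j < k, (p j).WellFormed) :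
    (unroll p k).WellFormed := by
  induction k with
  | zero => trivial
  | succ k ih => exact ⟨ih fun j hj => h j (by omega), h k (by omega)⟩

theorem twoBounds_unroll {p : ℕ → CountProg} {k : ℕ} (h : ∀ j < k, (p j).TwoBounds) :
    (unroll p k).TwoBounds := by
  induction k with
  | zero => trivial
  | succ k ih => exact ⟨ih fun j hj => h j (by omega), h k (by omega)⟩

theorem depth_unroll_le {p : ℕ → CountProg} {k b d : ℕ} (h : ∀ j < k, (p j).depth b ≤ d) :
    (unroll p k).depth b ≤ d := by
  induction k with
  | zero => exact Nat.zero_le _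
  | succ k ih => exact max_le (ih fun j hj => h j (by omega)) (h k (by omega))

/-- The invariant rule for unrolled loops. -/
theorem unroll_rule {p : ℕ → CountProg} {k : ℕ} {s : State} (Inv : ℕ → State → Prop)
    (h0 : Inv 0 s) (hstep : ∀ j < k, ∀ s', Frame (unroll p k) s s' → Inv j s' →
      Inv (j + 1) ((p j).run s')) :
    Inv k ((unroll p k).run s) := by
  induction k with
  | zero => exact h0
  | succ k ih =>
    refine hstep k (by omega) _ ?_ (ih fun j hj s' hs' => hstep j (by omega) s' ?_)
    · have hf := frame_run (unroll p k) s
      exact ⟨fun a ha => hf.nat a fun h => ha (Or.inl h),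
        fun a ha => hf.real a fun h => ha (Or.inl h)⟩
    · exact ⟨fun a ha => hs'.nat a fun h => ha (Or.inl h),
        fun a ha => hs'.real a fun h => ha (Or.inl h)⟩

end CountProg

end RealRAM

/-! ### Augmenting paths for a single color. -/

namespace FairClustering

/-- The number of points `i < n` of color `q` that `f` assigns to the cluster `j`. -/
def count (n : ℕ) (col : ℕ → ℕ) (f : ℕ → ℕ) (q j : ℕ) : ℕ :=
  ((Finset.range n).filter fun i => col i = q ∧ f i = j).card

/-- Every point is assigned to an admissible cluster. -/
def Admissible (n k : ℕ) (A : ℕ → ℕ → Prop) (f : ℕ → ℕ) : Prop :=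
  ∀ i < n, f i < k ∧ A i (f i)

/-- A point of color `q` can be moved from the cluster `j` to the cluster `j'`. -/
def Movable (n : ℕ) (col : ℕ → ℕ) (A : ℕ → ℕ → Prop) (f : ℕ → ℕ) (q j j' : ℕ) : Prop :=
  ∃ i < n, col i = q ∧ f i = j ∧ A i j'

/-- The bounds `l` and `u` are met for the color `q`. -/
def Balanced (n k : ℕ) (col : ℕ → ℕ) (f : ℕ → ℕ) (l u q : ℕ) : Prop :=
  ∀ j < k, l ≤ count n col f q j ∧ count n col f q j ≤ u

/-- The total violation of the bounds. -/
def violation (n k : ℕ) (col : ℕ → ℕ) (f : ℕ → ℕ) (l u q : ℕ) : ℕ :=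
  ∑ j ∈ Finset.range k, ((count n col f q j - u) + (l - count n col f q j))

/-- Moving one point from a cluster with `a` points to one with `b` points decreases the
violation. -/
def Improving (l u a b : ℕ) : Prop := (u < a ∧ b < u) ∨ (l < a ∧ b < l)

variable {n k : ℕ} {col f g : ℕ → ℕ} {A : ℕ → ℕ → Prop} {l u q : ℕ}

theorem count_congr (h : ∀ i < n, col i = q → f i = g i) (j : ℕ) :
    count n col f q j = count n col g q j := by
  unfold count
  congr 1
  ext i
  simp only [Finset.mem_filter, Finset.mem_range]
  constructor
  · rintro ⟨hi, hq, hj⟩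
    exact ⟨hi, hq, (h i hi hq) ▸ hj⟩
  · rintro ⟨hi, hq, hj⟩
    exact ⟨hi, hq, (h i hi hq).symm ▸ hj⟩

theorem violation_eq_zero : violation n k col f l u q = 0 ↔ Balanced n k col f l u q := by
  simp only [violation, Balanced, Finset.sum_eq_zero_iff, Finset.mem_range]
  refine forall₂_congr fun j _ => ?_
  omega

/-- Clusters are disjoint, so sizes summed over a set of clusters count points. In this form the cut
argument reduces to an inclusion between sets of points. -/
theorem sum_count_eq (R : Finset ℕ) : ∑ j ∈ R, count n col f q j =
    ((Finset.range n).filter fun i => col i = q ∧ f i ∈ R).card := by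
  classical
  rw [Finset.card_eq_sum_card_fiberwise (f := f) (t := R)]
  · refine Finset.sum_congr rfl fun j hj => ?_
    unfold count
    congr 1
    ext i
    simp only [Finset.mem_filter, Finset.mem_range]
    constructor
    · rintro ⟨hi, hq, rfl⟩
      exact ⟨⟨hi, hq, hj⟩, rfl⟩
    · rintro ⟨⟨hi, hq, _⟩, h⟩
      exact ⟨hi, hq, h⟩
  · intro i hi
    simp only [Finset.coe_filter, Set.mem_ofPred_eq] at hi
    exact hi.2.2

theorem sum_count_le (R : Finset ℕ) : ∑ j ∈ R, count n col f q j ≤ n := by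
  rw [sum_count_eq]
  exact (Finset.card_filter_le _ _).trans (Finset.card_range n).le

/-- In each cluster the excess and the deficiency are together at most the size under `f` plus the
size under `g`, because `g` attains the lower bound. Each kind of size sums to at most `n`. -/
theorem violation_le (hg : Balanced n k col g l u q) : violation n k col f l u q ≤ 2 * n := by
  have h₁ := sum_count_le (n := n) (col := col) (f := f) (q := q) (Finset.range k)
  have h₂ := sum_count_le (n := n) (col := col) (f := g) (q := q) (Finset.range k)
  have h₃ : violation n k col f l u q ≤ ∑ j ∈ Finset.range k,
      (count n col f q j + count n col g q j) := by
    refine Finset.sum_le_sum fun j hj => ?_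
    have := (hg j (Finset.mem_range.1 hj)).1
    omega
  rw [Finset.sum_add_distrib] at h₃
  omega

/-- Reassigning one point. -/
theorem count_update {i a b : ℕ} (hi : i < n) (hq : col i = q) (ha : f i = a) (hab : a ≠ b)
    (j : ℕ) : count n col (Function.update f i b) q j + (if j = a then 1 else 0) =
      count n col f q j + (if j = b then 1 else 0) := by
  subst ha
  -- Splitting off the contribution of `i` leaves a remainder on which `f` and its update agree.
  have h : ∀ h : ℕ → ℕ, count n col h q j = (((Finset.range n).erase i).filter
      fun i => col i = q ∧ h i = j).card + if h i = j then 1 else 0 := by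
    intro h
    unfold count
    rw [← Finset.insert_erase (Finset.mem_range.2 hi), Finset.filter_insert]
    by_cases hj : h i = j <;> simp [hq, hj]
  have h' : (((Finset.range n).erase i).filter
        fun i' => col i' = q ∧ Function.update f i b i' = j) =
      (((Finset.range n).erase i).filter fun i' => col i' = q ∧ f i' = j) := by
    refine Finset.filter_congr fun i' hi' => ?_
    rw [Function.update_of_ne (Finset.ne_of_mem_erase hi')]
  rw [h f, h, h', Function.update_self]
  have e₁ : (b = j) = (j = b) := propext eq_comm
  have e₂ : (f i = j) = (j = f i) := propext eq_comm
  simp only [e₁, e₂]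
  omega

/-- The assignment after moving the points `w j j'` along the path. -/
def movePath (w : ℕ → ℕ → ℕ) (f : ℕ → ℕ) : ℕ → List ℕ → ℕ → ℕ
  | _, [] => f
  | a, b :: p => movePath w (Function.update f (w a b) b) b p

/-- `w j j'` is a point that can be moved from `j` to `j'`. -/
def IsWitness (n : ℕ) (col : ℕ → ℕ) (A : ℕ → ℕ → Prop) (f : ℕ → ℕ) (q : ℕ) (w : ℕ → ℕ → ℕ)
    (j j' : ℕ) : Prop :=
  w j j' < n ∧ col (w j j') = q ∧ f (w j j') = j ∧ A (w j j') j'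

/-- Every inner cluster of the path gains one point and loses one, so only the two ends change size.
The balance is stated additively to avoid truncated subtraction, and also covers a path without
edges. -/
theorem movePath_spec {w : ℕ → ℕ → ℕ} (p : List ℕ) : ∀ (a : ℕ) (f : ℕ → ℕ),
    (a :: p).Nodup → (∀ c ∈ p, c < k) → (a :: p).IsChain (IsWitness n col A f q w) →
    Admissible n k A f →
    Admissible n k A (movePath w f a p) ∧ (∀ i, col i ≠ q → movePath w f a p i = f i) ∧
    ∀ j, count n col (movePath w f a p) q j + (if j = a then 1 else 0) =
      count n col f q j + (if j = (a :: p).getLast (by simp) then 1 else 0) := by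
  induction p with
  | nil => exact fun a f _ _ _ hf => ⟨hf, fun _ _ => rfl, fun _ => rfl⟩
  | cons b p ih =>
    intro a f hnd hlt hch hf
    rw [List.isChain_cons_cons] at hch
    obtain ⟨⟨hwn, hwq, hwf, hwA⟩, hch⟩ := hch
    have hnd' := List.nodup_cons.1 hnd
    have hab : a ≠ b := fun h => hnd'.1 (h ▸ List.mem_cons_self ..)
    have hf' : Admissible n k A (Function.update f (w a b) b) := by
      intro i hi
      by_cases h : i = w a b
      · subst h
        rw [Function.update_self]
        exact ⟨hlt b (List.mem_cons_self ..), hwA⟩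
      · rw [Function.update_of_ne h]
        exact hf i hi
    -- The witnesses chosen for the original assignment stay valid: the moved point came from `a`,
    -- and a simple path never uses `a` as a source again.
    have hch' : (b :: p).IsChain (IsWitness n col A (Function.update f (w a b) b) q w) := by
      refine hch.imp_of_mem_imp ?_
      rintro c d hc - ⟨h₁, h₂, h₃, h₄⟩
      refine ⟨h₁, h₂, ?_, h₄⟩
      rw [Function.update_of_ne, h₃]
      intro h
      rw [h, hwf] at h₃
      exact hnd'.1 (h₃ ▸ hc)
    obtain ⟨h₁, h₂, h₃⟩ := ih b _ hnd'.2 (fun c hc => hlt c (List.mem_cons_of_mem _ hc)) hch' hf'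
    refine ⟨h₁, fun i hi => ?_, fun j => ?_⟩
    · rw [movePath, h₂ i hi, Function.update_of_ne]
      rintro rfl
      exact hi hwq
    · have h₄ := h₃ j
      have h₅ := count_update hwn hwq hwf hab j
      rw [movePath, List.getLast_cons (List.cons_ne_nil b p)]
      omega

/-- Because `l ≤ u`, removing a point from `a` creates no deficiency and adding one to `b` creates
no excess. The excess of `a` drops in the first case of `Improving`, the deficiency of `b` in the
second. -/
theorem violation_lt {a b : ℕ} (hlu : l ≤ u) (ha : a < k) (hb : b < k) (hab : a ≠ b)
    (himp : Improving l u (count n col f q a) (count n col f q b))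
    (h : ∀ j, count n col g q j + (if j = a then 1 else 0) =
      count n col f q j + (if j = b then 1 else 0)) :
    violation n k col g l u q < violation n k col f l u q := by
  have ha' := h a
  have hb' := h b
  simp only [if_true, if_neg hab, if_neg hab.symm] at ha' hb'
  have himp' := himp
  unfold Improving at himp'
  refine Finset.sum_lt_sum (fun j _ => ?_) ?_
  · by_cases hja : j = a
    · subst hja; omega
    · by_cases hjb : j = b
      · subst hjb; omega
      · have := h j
        simp only [if_neg hja, if_neg hjb] at this
        omega
  · rcases himp' with h | h
    · exact ⟨a, Finset.mem_range.2 ha, by omega⟩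
    · exact ⟨b, Finset.mem_range.2 hb, by omega⟩

/-- `b` is reachable from `a` on a simple path of movable points. -/
def SimplyReachable (r : ℕ → ℕ → Prop) (k a b : ℕ) : Prop :=
  ∃ p : List ℕ, (a :: p).Nodup ∧ (∀ c ∈ a :: p, c < k) ∧ (a :: p).IsChain r ∧
    (a :: p).getLast (by simp) = b

theorem simplyReachable_of_reflTransGen {r : ℕ → ℕ → Prop} {a b : ℕ} (ha : a < k)
    (h : Relation.ReflTransGen (fun x y => r x y ∧ y < k) a b) : SimplyReachable r k a b := by
  induction h with
  | refl => exact ⟨[], by simp, by simpa using ha, by simp, rfl⟩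
  | @tail b c _ hbc ih =>
    obtain ⟨p, hnd, hlt, hch, rfl⟩ := ih
    -- If the walk returns to a vertex of the path, the path is cut off at that vertex; otherwise it
    -- is prolonged.
    by_cases hc : c ∈ a :: p
    · obtain ⟨s, t, hst⟩ := List.append_of_mem hc
      have hpre : s ++ [c] <+: a :: p := ⟨t, by rw [hst]; simp⟩
      obtain ⟨p', hp'⟩ : ∃ p', s ++ [c] = a :: p' := by
        cases s with
        | nil => exact ⟨[], by simp at hst; simp [hst.1]⟩
        | cons x s => exact ⟨s ++ [c], by simp at hst; simp [hst.1]⟩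
      rw [hp'] at hpre
      refine ⟨p', hnd.sublist hpre.sublist, fun x hx => hlt x (hpre.subset hx), hch.prefix hpre,
        ?_⟩
      simp only [← hp', List.getLast_append_singleton]
    · refine ⟨p ++ [c], ?_, ?_, ?_, ?_⟩
      · rw [← List.cons_append, List.nodup_append]
        refine ⟨hnd, List.nodup_singleton _, ?_⟩
        intro x hx y hy
        rw [List.mem_singleton] at hy
        rintro rfl
        exact hc (hy ▸ hx)
      · intro x hx
        rw [← List.cons_append, List.mem_append, List.mem_singleton] at hx
        rcases hx with hx | rfl
        · exact hlt x hx
        · exact hbc.2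
      · rw [← List.cons_append, List.isChain_append]
        refine ⟨hch, by simp, ?_⟩
        intro x hx y hy
        rw [List.getLast?_eq_getLast_of_ne_nil (List.cons_ne_nil a p)] at hx
        simp at hx hy
        subst hx hy
        exact hbc.1
      · simp

/-- If the bounds can be met, then the assignment meets them or admits an improving path. -/
theorem exists_improving_path (hf : Admissible n k A f) (hg : Admissible n k A g)
    (hbal : Balanced n k col g l u q) (hviol : ¬ Balanced n k col f l u q) :
    ∃ a b, a ≠ b ∧ Improving l u (count n col f q a) (count n col f q b) ∧ a < k ∧
      SimplyReachable (Movable n col A f q) k a b := by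
  classical
  set r := Movable n col A f q with hr
  set r' : ℕ → ℕ → Prop := fun x y => r x y ∧ y < k with hr'
  unfold Balanced at hviol
  push Not at hviol
  obtain ⟨j, hj, hviol⟩ := hviol
  have hlu : l ≤ u := (hbal j hj).1.trans (hbal j hj).2
  suffices h : ∃ a b, Improving l u (count n col f q a) (count n col f q b) ∧ a < k ∧
      Relation.ReflTransGen r' a b by
    obtain ⟨a, b, h₁, h₂, h₃⟩ := h
    refine ⟨a, b, ?_, h₁, h₂, simplyReachable_of_reflTransGen h₂ h₃⟩
    rintro rfl
    unfold Improving at h₁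
    omega
  by_contra hno
  push Not at hno
  -- Each point of the color gives an edge from its cluster under `f` to its cluster under `g`;
  -- these edges alone suffice for the cut argument.
  have hmove : ∀ i < n, col i = q → r' (f i) (g i) := fun i hi hq =>
    ⟨⟨i, hi, hq, rfl, (hg i hi).2⟩, (hg i hi).1⟩
  by_cases hlow : count n col f q j < l
  · set R := (Finset.range k).filter fun a => Relation.ReflTransGen r' a j with hR
    have hjR : j ∈ R := by simp [hR, hj, Relation.ReflTransGen.refl]
    have h₁ : ∑ a ∈ R, count n col g q a ≤ ∑ a ∈ R, count n col f q a := by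
      rw [sum_count_eq, sum_count_eq]
      refine Finset.card_le_card fun i hi => ?_
      simp only [Finset.mem_filter, Finset.mem_range, hR] at hi ⊢
      exact ⟨hi.1, hi.2.1, (hf i hi.1).1, .head (hmove i hi.1 hi.2.1) hi.2.2.2⟩
    have h₂ : ∑ a ∈ R, count n col f q a < ∑ a ∈ R, l := by
      refine Finset.sum_lt_sum (fun a ha => ?_) ⟨j, hjR, hlow⟩
      simp only [Finset.mem_filter, Finset.mem_range, hR] at ha
      by_contra hlt
      exact hno a j (Or.inr ⟨by omega, hlow⟩) ha.1 ha.2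
    have h₃ : ∑ a ∈ R, l ≤ ∑ a ∈ R, count n col g q a := by
      refine Finset.sum_le_sum fun a ha => (hbal a ?_).1
      exact Finset.mem_range.1 (Finset.mem_filter.1 ha).1
    omega
  · have hup := hviol (by omega)
    -- The dual cut: the clusters reachable from the overfull cluster `j`. Points that `f` places in
    -- `R` stay in `R` under `g`, but `R` is too full for the upper bounds.
    set R := (Finset.range k).filter fun b => Relation.ReflTransGen r' j b with hR
    have hjR : j ∈ R := by simp [hR, hj, Relation.ReflTransGen.refl]
    have h₁ : ∑ a ∈ R, count n col f q a ≤ ∑ a ∈ R, count n col g q a := by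
      rw [sum_count_eq, sum_count_eq]
      refine Finset.card_le_card fun i hi => ?_
      simp only [Finset.mem_filter, Finset.mem_range, hR] at hi ⊢
      exact ⟨hi.1, hi.2.1, (hg i hi.1).1, .tail hi.2.2.2 (hmove i hi.1 hi.2.1)⟩
    have h₂ : ∑ a ∈ R, u < ∑ a ∈ R, count n col f q a := by
      refine Finset.sum_lt_sum (fun b hb => ?_) ⟨j, hjR, hup⟩
      simp only [Finset.mem_filter, Finset.mem_range, hR] at hb
      by_contra hlt
      exact hno j b (Or.inl ⟨hup, by omega⟩) hj hb.2
    have h₃ : ∑ a ∈ R, count n col g q a ≤ ∑ a ∈ R, u := by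
      refine Finset.sum_le_sum fun a ha => (hbal a ?_).2
      exact Finset.mem_range.1 (Finset.mem_filter.1 ha).1
    omega

end FairClustering

/-! ### Candidate centers in the plane. -/

namespace FairClustering

/-- The squared distance in the plane. -/
def sqDist (p c : ℝ × ℝ) : ℝ := (p.1 - c.1) * (p.1 - c.1) + (p.2 - c.2) * (p.2 - c.2)

/-- The midpoint of `a` and `b`. -/
noncomputable def middle (a b : ℝ × ℝ) : ℝ × ℝ := ((a.1 + b.1) / 2, (a.2 + b.2) / 2)

/-- The center of the circle through `a`, `b` and `e`. -/
noncomputable def circumcenter (a b e : ℝ × ℝ) : ℝ × ℝ :=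
  (a.1 + ((e.2 - a.2) * sqDist a b - (b.2 - a.2) * sqDist a e) /
    (2 * ((b.1 - a.1) * (e.2 - a.2) - (b.2 - a.2) * (e.1 - a.1))),
   a.2 + ((b.1 - a.1) * sqDist a e - (e.1 - a.1) * sqDist a b) /
    (2 * ((b.1 - a.1) * (e.2 - a.2) - (b.2 - a.2) * (e.1 - a.1))))

/-- The leftmost point of the disk with center `a` and radius `r`. -/
def leftmost (r : ℝ) (a : ℝ × ℝ) : ℝ × ℝ := (a.1 - r, a.2)

/-- An intersection point of the circles with centers `a` and `b` and radius `r`; the other one is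
obtained by exchanging `a` and `b`. -/
noncomputable def crossing (r : ℝ) (a b : ℝ × ℝ) : ℝ × ℝ :=
  ((a.1 + b.1) / 2 - Real.sqrt ((r * r - sqDist a b / 4) / sqDist a b) * (b.2 - a.2),
   (a.2 + b.2) / 2 + Real.sqrt ((r * r - sqDist a b / 4) / sqDist a b) * (b.1 - a.1))

theorem sqDist_nonneg (p c : ℝ × ℝ) : 0 ≤ sqDist p c :=
  add_nonneg (mul_self_nonneg _) (mul_self_nonneg _)

theorem sqDist_pos {p c : ℝ × ℝ} (h : p ≠ c) : 0 < sqDist p c := by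
  refine lt_of_le_of_ne (sqDist_nonneg p c) fun h0 => h ?_
  unfold sqDist at h0
  have h₃ := mul_self_nonneg (p.1 - c.1)
  have h₄ := mul_self_nonneg (p.2 - c.2)
  have h₁ : (p.1 - c.1) * (p.1 - c.1) = 0 := by linarith
  have h₂ : (p.2 - c.2) * (p.2 - c.2) = 0 := by linarith
  exact Prod.ext (sub_eq_zero.1 (mul_self_eq_zero.1 h₁)) (sub_eq_zero.1 (mul_self_eq_zero.1 h₂))

theorem continuous_sqDist (p : ℝ × ℝ) : Continuous (sqDist p) := by
  unfold sqDist
  fun_prop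

/-- On the perpendicular bisector of `a` and `b`, moving towards the midpoint brings both points
closer. This is what rules out other centers when only two positions lie on the smallest circle. -/
theorem sqDist_middle_of_eq {a b c : ℝ × ℝ} (h : sqDist a c = sqDist b c) (t : ℝ) :
    sqDist a (c + t • (middle a b - c)) = sqDist a c - t * (2 - t) * sqDist (middle a b) c := by
  simp only [sqDist, middle, Prod.fst_add, Prod.snd_add, Prod.smul_fst, Prod.smul_snd,
    Prod.fst_sub, Prod.snd_sub, smul_eq_mul] at h ⊢
  linear_combination (-t / 2) * h

/-- A line meets a circle in at most two points, so three distinct points equidistant from `c` are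
not collinear. The two linear equations for `c` then have a nonzero determinant and are solved by
Cramer's rule. -/
theorem eq_circumcenter {a b e c : ℝ × ℝ} (hb : sqDist b c = sqDist a c)
    (he : sqDist e c = sqDist a c) (hab : b ≠ a) (hae : e ≠ a) (hbe : e ≠ b) :
    c = circumcenter a b e := by
  obtain ⟨a₁, a₂⟩ := a
  obtain ⟨b₁, b₂⟩ := b
  obtain ⟨e₁, e₂⟩ := e
  obtain ⟨c₁, c₂⟩ := c
  have hpos := sqDist_pos hab
  have hD : (b₁ - a₁) * (e₂ - a₂) - (b₂ - a₂) * (e₁ - a₁) ≠ 0 := by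
    intro hD
    simp only [sqDist] at hb he hpos
    set x := b₁ - a₁ with hx
    set y := b₂ - a₂ with hy
    set z := e₁ - a₁ with hz
    set w := e₂ - a₂ with hw
    -- Were the points collinear, `e - a` would be `s` times `b - a`; equidistance then forces `s =
    -- 0` or `s = 1`, that is `e = a` or `e = b`.
    obtain ⟨s, hs₁, hs₂⟩ : ∃ s, z = s * x ∧ w = s * y := by
      refine ⟨(x * z + y * w) / (x * x + y * y), ?_, ?_⟩
      · rw [div_mul_eq_mul_div, eq_div_iff hpos.ne']
        linear_combination (-y) * hD
      · rw [div_mul_eq_mul_div, eq_div_iff hpos.ne']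
        linear_combination x * hD
    have h₁ : x * x + y * y = 2 * (x * (c₁ - a₁) + y * (c₂ - a₂)) := by
      rw [hx, hy]; linear_combination hb
    have h₂ : z * z + w * w = 2 * (z * (c₁ - a₁) + w * (c₂ - a₂)) := by
      rw [hz, hw]; linear_combination he
    rw [hs₁, hs₂] at h₂
    have h₃ : s * (s - 1) * (x * x + y * y) = 0 := by linear_combination h₂ - s * h₁
    rcases mul_eq_zero.1 h₃ with h | h
    · rcases mul_eq_zero.1 h with rfl | h
      · exact hae (Prod.ext (by simp only; linarith) (by simp only; linarith))
      · obtain rfl : s = 1 := by linarith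
        exact hbe (Prod.ext (by simp only; linarith) (by simp only; linarith))
    · exact hpos.ne' h
  simp only [sqDist] at hb he
  refine Prod.ext ?_ ?_
  · simp only [circumcenter, sqDist]
    rw [← sub_eq_iff_eq_add', eq_div_iff (mul_ne_zero two_ne_zero hD)]
    linear_combination (-(e₂ - a₂)) * hb + (b₂ - a₂) * he
  · simp only [circumcenter, sqDist]
    rw [← sub_eq_iff_eq_add', eq_div_iff (mul_ne_zero two_ne_zero hD)]
    linear_combination (-(b₁ - a₁)) * he + (e₁ - a₁) * hb

/-- Being equidistant from `a` and `b`, the point `c` is the midpoint plus a multiple `t` of the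
normal to `b - a`. The radius determines `t ^ 2`, and the sign of `t` decides between the two orders
of `a` and `b`. -/
theorem eq_crossing {r : ℝ} {a b c : ℝ × ℝ} (ha : sqDist a c = r * r) (hb : sqDist b c = r * r)
    (hab : a ≠ b) : c = crossing r a b ∨ c = crossing r b a := by
  have hpos := sqDist_pos hab
  have hcomm : sqDist b a = sqDist a b := by unfold sqDist; ring
  obtain ⟨a₁, a₂⟩ := a
  obtain ⟨b₁, b₂⟩ := b
  obtain ⟨c₁, c₂⟩ := c
  unfold crossing
  rw [hcomm]
  simp only [sqDist] at ha hb hpos ⊢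
  set d := (a₁ - b₁) * (a₁ - b₁) + (a₂ - b₂) * (a₂ - b₂) with hd
  set t := (-(c₁ - (a₁ + b₁) / 2) * (b₂ - a₂) + (c₂ - (a₂ + b₂) / 2) * (b₁ - a₁)) / d with ht
  have horth : (c₁ - (a₁ + b₁) / 2) * (b₁ - a₁) + (c₂ - (a₂ + b₂) / 2) * (b₂ - a₂) = 0 := by
    linear_combination (ha - hb) / 2
  have h₁ : c₁ = (a₁ + b₁) / 2 - t * (b₂ - a₂) := by
    rw [ht]
    field_simp
    rw [hd]
    linear_combination 2 * (b₁ - a₁) * horth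
  have h₂ : c₂ = (a₂ + b₂) / 2 + t * (b₁ - a₁) := by
    rw [ht]
    field_simp
    rw [hd]
    linear_combination 2 * (b₂ - a₂) * horth
  have h₃ : (r * r - d / 4) / d = t ^ 2 := by
    rw [div_eq_iff hpos.ne', ← ha, h₁, h₂, hd]
    ring
  rw [h₃, Real.sqrt_sq_eq_abs]
  rcases abs_choice t with h | h
  · left
    rw [h]
    exact Prod.ext h₁ h₂
  · right
    rw [h]
    refine Prod.ext ?_ ?_
    · simp only; linarith
    · simp only; linarith

variable {ι : Type*}

theorem isCompact_sqDist_le {P : Finset ι} (hP : P.Nonempty) (p : ι → ℝ × ℝ) (ρ : ℝ) :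
    IsCompact {c | ∀ i ∈ P, sqDist (p i) c ≤ ρ} := by
  obtain ⟨i, hi⟩ := hP
  have hclosed : IsClosed {c | ∀ i ∈ P, sqDist (p i) c ≤ ρ} := by
    simp only [Set.ofPred_forall]
    exact isClosed_iInter fun i => isClosed_iInter fun _ =>
      isClosed_le (continuous_sqDist _) continuous_const
  -- The half-width `1 + ρ` avoids a square root: `x * x ≤ ρ` gives `|x| ≤ 1 + ρ`.
  refine IsCompact.of_isClosed_subset
    (isCompact_Icc (a := p i - (1 + ρ, 1 + ρ)) (b := p i + (1 + ρ, 1 + ρ))) hclosed ?_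
  intro c hc
  have h := hc i hi
  unfold sqDist at h
  have h₁ := mul_self_nonneg ((p i).1 - c.1)
  have h₂ := mul_self_nonneg ((p i).2 - c.2)
  refine ⟨⟨?_, ?_⟩, ⟨?_, ?_⟩⟩ <;>
    simp only [Prod.fst_sub, Prod.snd_sub, Prod.fst_add, Prod.snd_add] <;>
    nlinarith

/-- Moving from `c` in the direction of `d`, all strict distance bounds remain valid at first. -/
theorem eventually_sqDist_lt (P : Finset ι) (p : ι → ℝ × ℝ) {ρ : ℝ} (c d : ℝ × ℝ) :
    ∀ᶠ t : ℝ in nhdsWithin 0 (Set.Ioi 0), (0 < t ∧ t < 1) ∧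
      ∀ i ∈ P, sqDist (p i) c < ρ → sqDist (p i) (c + t • (d - c)) < ρ := by
  refine Filter.Eventually.and (Ioo_mem_nhdsGT one_pos) ?_
  rw [Filter.eventually_all_finset]
  intro i _
  by_cases h : sqDist (p i) c < ρ
  · have hcont : Continuous fun t : ℝ => sqDist (p i) (c + t • (d - c)) :=
      (continuous_sqDist _).comp (by fun_prop)
    have h0 : sqDist (p i) (c + (0 : ℝ) • (d - c)) < ρ := by simpa using h
    exact ((hcont.continuousAt.eventually_lt continuousAt_const h0).filter_mono
      nhdsWithin_le_nhds).mono fun _ ht _ => ht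
  · exact Filter.Eventually.of_forall fun _ ht => absurd ht h

/-- The smallest enclosing circle of a finite set of points is determined by two or three of the
points. -/
theorem exists_smallest_circle {P : Finset ι} (hP : P.Nonempty) (p : ι → ℝ × ℝ) :
    ∃ c, ∃ a ∈ P, (∀ i ∈ P, sqDist (p i) c ≤ sqDist (p a) c) ∧
      (∀ c', ∃ i ∈ P, sqDist (p a) c ≤ sqDist (p i) c') ∧
      ∃ b ∈ P, ∃ e ∈ P, c = middle (p a) (p b) ∨ c = circumcenter (p a) (p b) (p e) := by
  set F : ℝ × ℝ → ℝ := fun c => P.sup' hP fun i => sqDist (p i) c with hF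
  have hFcont : Continuous F := Continuous.finset_sup'_apply hP fun i _ => continuous_sqDist (p i)
  -- Minimizing over the compact sublevel set of the value at the origin gives a global minimum.
  obtain ⟨c, -, hc⟩ := (isCompact_sqDist_le hP p (F 0)).exists_isMinOn
    ⟨0, fun i hi => Finset.le_sup' (fun i => sqDist (p i) 0) hi⟩ hFcont.continuousOn
  have hmin : ∀ c', F c ≤ F c' := by
    intro c'
    by_cases h : F c' ≤ F 0
    · exact hc fun i hi => (Finset.le_sup' (fun i => sqDist (p i) c') hi).trans h
    · exact (hc fun i hi => Finset.le_sup' (fun i => sqDist (p i) 0) hi : F c ≤ F 0).trans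
        (not_le.1 h).le
  obtain ⟨a, ha, haF⟩ := P.exists_mem_eq_sup' hP fun i => sqDist (p i) c
  have haF : F c = sqDist (p a) c := haF
  have hle : ∀ i ∈ P, sqDist (p i) c ≤ sqDist (p a) c := fun i hi =>
    haF ▸ Finset.le_sup' (fun i => sqDist (p i) c) hi
  have hge : ∀ c', ∃ i ∈ P, sqDist (p a) c ≤ sqDist (p i) c' := by
    intro c'
    obtain ⟨i, hi, hi'⟩ := P.exists_mem_eq_sup' hP fun i => sqDist (p i) c'
    exact ⟨i, hi, by rw [← haF, ← hi']; exact hmin c'⟩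
  refine ⟨c, a, ha, hle, hge, ?_⟩
  -- `b` is a point on the circle at another position than `a` if there is one, and `a` itself
  -- otherwise; in the latter case the midpoint degenerates to `p a`.
  obtain ⟨b, hb, hbt, hab⟩ : ∃ b ∈ P, sqDist (p b) c = sqDist (p a) c ∧
      (p b = p a → ∀ i ∈ P, sqDist (p i) c = sqDist (p a) c → p i = p a) := by
    by_cases h : ∃ b ∈ P, sqDist (p b) c = sqDist (p a) c ∧ p b ≠ p a
    · obtain ⟨b, hb, hbt, hab⟩ := h
      exact ⟨b, hb, hbt, fun h => absurd h hab⟩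
    · push Not at h
      exact ⟨a, ha, rfl, fun _ => h⟩
  by_cases h : ∃ e ∈ P, sqDist (p e) c = sqDist (p a) c ∧ p e ≠ p a ∧ p e ≠ p b
  · obtain ⟨e, he, het, hea, heb⟩ := h
    exact ⟨b, hb, e, he, Or.inr (eq_circumcenter hbt het (fun h => hea (hab h e he het)) hea heb)⟩
  · push Not at h
    refine ⟨b, hb, b, hb, Or.inl ?_⟩
    by_contra hne
    have hpos := sqDist_pos (Ne.symm hne)
    -- All points on the circle sit at `p a` or `p b`. A small step towards the midpoint strictly
    -- decreases these distances and keeps the others below the maximum, contradicting minimality.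
    obtain ⟨t, ⟨ht0, ht1⟩, ht⟩ :=
      (eventually_sqDist_lt P p (ρ := sqDist (p a) c) c (middle (p a) (p b))).exists
    obtain ⟨i, hi, hi'⟩ := hge (c + t • (middle (p a) (p b) - c))
    refine absurd hi' (not_le.2 ?_)
    rcases (hle i hi).lt_or_eq with hlt | heq
    · exact ht i hi hlt
    · have hdec : 0 < t * (2 - t) * sqDist (middle (p a) (p b)) c :=
        mul_pos (mul_pos ht0 (by linarith)) hpos
      by_cases hia : p i = p a
      · rw [hia, sqDist_middle_of_eq hbt.symm]
        linarith
      · have hcomm : middle (p a) (p b) = middle (p b) (p a) := by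
          unfold middle
          rw [add_comm, add_comm (p a).2]
        rw [h i hi heq hia, hcomm, sqDist_middle_of_eq hbt, ← hcomm, hbt]
        linarith

/-- If the disks of radius `r` around some points have a common point, then one of the common
points is the leftmost point of a disk or an intersection point of two circles. -/
theorem exists_corner {P : Finset ι} (hP : P.Nonempty) (p : ι → ℝ × ℝ) {r : ℝ} (hr : 0 ≤ r)
    (h : ∃ c, ∀ i ∈ P, sqDist (p i) c ≤ r * r) :
    ∃ c, (∀ i ∈ P, sqDist (p i) c ≤ r * r) ∧
      ∃ a ∈ P, ∃ b ∈ P, c = leftmost r (p a) ∨ c = crossing r (p a) (p b) := by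
  -- The corner is a common point with smallest first coordinate.
  obtain ⟨c, hc, hmin⟩ := (isCompact_sqDist_le hP p (r * r)).exists_isMinOn h
    continuous_fst.continuousOn
  refine ⟨c, hc, ?_⟩
  -- No direction to the left can preserve all the tight constraints, since the slack ones survive a
  -- short step.
  have key : ∀ d : ℝ × ℝ, d.1 < c.1 → (∀ t : ℝ, 0 < t → t < 1 → ∀ i ∈ P,
      sqDist (p i) c = r * r → sqDist (p i) (c + t • (d - c)) ≤ r * r) → False := by
    intro d hd htight
    obtain ⟨t, ⟨ht0, ht1⟩, ht⟩ := (eventually_sqDist_lt P p (ρ := r * r) c d).exists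
    have hmem : c + t • (d - c) ∈ {c | ∀ i ∈ P, sqDist (p i) c ≤ r * r} := by
      intro i hi
      rcases (hc i hi).lt_or_eq with hlt | heq
      · exact (ht i hi hlt).le
      · exact htight t ht0 ht1 i hi heq
    have h₁ : c.1 ≤ (c + t • (d - c)).1 := hmin hmem
    simp only [Prod.fst_add, Prod.smul_fst, Prod.fst_sub, smul_eq_mul] at h₁
    nlinarith
  by_cases htight : ∃ a ∈ P, sqDist (p a) c = r * r
  · obtain ⟨a, ha, hat⟩ := htight
    by_cases hb : ∃ b ∈ P, sqDist (p b) c = r * r ∧ p a ≠ p b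
    · obtain ⟨b, hb, hbt, hab⟩ := hb
      rcases eq_crossing hat hbt hab with h | h
      · exact ⟨a, ha, b, hb, Or.inr h⟩
      · exact ⟨b, hb, a, ha, Or.inr h⟩
    · push Not at hb
      refine ⟨a, ha, a, ha, Or.inl ?_⟩
      by_contra hne
      -- On the circle around `p a`, only its leftmost point has first coordinate at most `(p a).1 -
      -- r`.
      have hlt : (leftmost r (p a)).1 < c.1 := by
        by_contra hle
        rw [not_lt] at hle
        simp only [leftmost] at hle
        unfold sqDist at hat
        have h₁ : r * r ≤ ((p a).1 - c.1) * ((p a).1 - c.1) := by nlinarith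
        have h₂ : ((p a).2 - c.2) * ((p a).2 - c.2) = 0 := by
          nlinarith [mul_self_nonneg ((p a).2 - c.2)]
        have h₃ : (p a).2 - c.2 = 0 := mul_self_eq_zero.1 h₂
        have h₄ : ((p a).1 - c.1 - r) * ((p a).1 - c.1 + r) = 0 := by linarith
        refine hne (Prod.ext ?_ ?_)
        · rcases mul_eq_zero.1 h₄ with h | h <;> simp only [leftmost] <;> linarith
        · simp only [leftmost]; linarith
      refine key _ hlt fun t ht0 ht1 i hi hit => ?_
      rw [← hb i hi hit]
      have hleft : sqDist (p a) (leftmost r (p a)) = r * r := by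
        simp only [sqDist, leftmost]; ring
      -- The squared distance is strictly convex along the segment, so the disk contains the whole
      -- segment from `c` to its leftmost point.
      have hconv : sqDist (p a) (c + t • (leftmost r (p a) - c)) =
          (1 - t) * sqDist (p a) c + t * sqDist (p a) (leftmost r (p a)) -
            t * (1 - t) * sqDist c (leftmost r (p a)) := by
        simp only [sqDist, Prod.fst_add, Prod.snd_add, Prod.smul_fst, Prod.smul_snd,
          Prod.fst_sub, Prod.snd_sub, smul_eq_mul]
        ring
      rw [hconv, hat, hleft]
      have := mul_nonneg (mul_nonneg ht0.le (by linarith : (0 : ℝ) ≤ 1 - t))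
        (sqDist_nonneg c (leftmost r (p a)))
      linarith
  · exfalso
    push Not at htight
    exact key (c.1 - 1, c.2) (by simp) fun t _ _ i hi hit => absurd hit (htight i hi)

end FairClustering

/-! ### The feasibility test of one configuration as a program. -/

namespace FairClustering

open RealRAM CountProg

/-! ### Memory layout

Naturals: `6` holds the working assignment, `7` the success flag, `8`, `9`, `10` are the counters
for colors, rounds and points, `14` holds the cluster sizes, `20 + 3 * j'` the movable points with
target `j'`. Reals: `5` is the radius, `10 + 2 * j` and `11 + 2 * j` hold the center `j`. -/

/-- The cell `0` of an array. -/
abbrev cell (a : ℕ) : NatExpr := .read a (.const 0)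

/-- Equality of naturals. -/
def eqTest (e f : NatExpr) : Test := .and (.natLe e f) (.natLe f e)

/-- Strict comparison of naturals. -/
def ltTest (e f : NatExpr) : Test := .not (.natLe f e)

/-- Disjunction of tests. -/
def orTest (b c : Test) : Test := .not (.and (.not b) (.not c))

/-- The square of the radius is at least the squared distance from the point `i` to the
center `j`. -/
def nearTest (i : NatExpr) (j : ℕ) : Test :=
  .realLe
    (.add
      (.mul (.sub (.read 0 i) (.read (10 + 2 * j) (.const 0)))
        (.sub (.read 0 i) (.read (10 + 2 * j) (.const 0))))
      (.mul (.sub (.read 1 i) (.read (11 + 2 * j) (.const 0)))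
        (.sub (.read 1 i) (.read (11 + 2 * j) (.const 0)))))
    (.mul (.read 5 (.const 0)) (.read 5 (.const 0)))

/-- The point `i`. -/
def pointAt (R : ℕ → ℕ → ℝ) (i : ℕ) : ℝ × ℝ := (R 0 i, R 1 i)

/-- The current center `j`. -/
def centerAt (R : ℕ → ℕ → ℝ) (j : ℕ) : ℝ × ℝ := (R (10 + 2 * j) 0, R (11 + 2 * j) 0)

/-- The point `i` is in the current disk `j`. -/
def Near (R : ℕ → ℕ → ℝ) (i j : ℕ) : Prop :=
  sqDist (pointAt R i) (centerAt R j) ≤ R 5 0 * R 5 0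

@[simp] theorem holds_eqTest {s : State} {e f : NatExpr} :
    (eqTest e f).Holds s ↔ e.eval s = f.eval s := by
  simp only [eqTest, Test.Holds]
  omega

@[simp] theorem holds_ltTest {s : State} {e f : NatExpr} :
    (ltTest e f).Holds s ↔ e.eval s < f.eval s := by
  simp only [ltTest, Test.Holds]
  omega

@[simp] theorem holds_orTest {s : State} {b c : Test} :
    (orTest b c).Holds s ↔ b.Holds s ∨ c.Holds s := by
  simp only [orTest, Test.Holds]
  tauto

@[simp] theorem holds_nearTest {s : State} {i : NatExpr} {j : ℕ} :
    (nearTest i j).Holds s ↔ Near s.real (i.eval s) j := Iff.rfl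

/-- The part of the memory that is not changed during the test of a configuration. -/
structure HasData (N col L U : ℕ → ℕ) (R : ℕ → ℕ → ℝ) (s : State) : Prop where
  size : s.nat 0 = N
  color : s.nat 1 = col
  lower : s.nat 2 = L
  upper : s.nat 3 = U
  real : s.real = R

variable {N col L U : ℕ → ℕ} {R : ℕ → ℕ → ℝ} {s s' : State} {k : ℕ}

theorem HasData.frame {p : CountProg} (h : HasData N col L U R s) (hf : Frame p s s')
    (hn : ∀ a < 4, ¬ p.WritesNat a) (hr : ∀ a, ¬ p.WritesReal a) : HasData N col L U R s' where
  size := by rw [hf.nat 0 (hn 0 (by omega)), h.size]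
  color := by rw [hf.nat 1 (hn 1 (by omega)), h.color]
  lower := by rw [hf.nat 2 (hn 2 (by omega)), h.lower]
  upper := by rw [hf.nat 3 (hn 3 (by omega)), h.upper]
  real := by
    funext a
    rw [hf.real a (hr a), h.real]

theorem HasData.writeNat (h : HasData N col L U R s) {a : ℕ} (ha : 4 ≤ a) (i v : ℕ) :
    HasData N col L U R (s.writeNat a i v) :=
  h.frame (frame_run (.setNat a (.const i) (.const v)) s)
    (fun c hc => by simp only [WritesNat]; omega) (fun _ => id)

/-! ### The initial assignment -/

/-- Assign the current point to a cluster with a nearby center. -/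
def assignPoint (k : ℕ) : CountProg :=
  .seq (.setNat 6 (cell 10) (.const k))
    (.seq (unroll (fun j => .ite (nearTest (cell 10) j) (.setNat 6 (cell 10) (.const j)) .skip) k)
      (.ite (.natLe (.const k) (.read 6 (cell 10))) (.setNat 7 (.const 0) (.const 0)) .skip))

/-- Assign every point to a cluster with a nearby center. -/
def firstAssignment (k : ℕ) : CountProg :=
  .seq (.setNat 7 (.const 0) (.const 1)) (.count 10 0 (assignPoint k))

theorem writesNat_assignPoint {a : ℕ} (h : (assignPoint k).WritesNat a) : a = 6 ∨ a = 7 := by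
  simp only [assignPoint, WritesNat, writesNat_unroll, or_false] at h
  rcases h with h | ⟨_, _, h⟩ | h <;> omega

theorem writesReal_assignPoint {a : ℕ} : ¬ (assignPoint k).WritesReal a := by
  simp [assignPoint, WritesReal, writesReal_unroll]

/-- The value `k` is a sentinel: it survives the tests exactly when no current disk contains the
point, and then the flag is cleared. -/
theorem run_assignPoint (hs : HasData N col L U R s) :
    (∀ x ≠ s.nat 10 0, ((assignPoint k).run s).nat 6 x = s.nat 6 x) ∧
    ((((assignPoint k).run s).nat 7 0 = 0 ∧ ∀ j < k, ¬ Near R (s.nat 10 0) j) ∨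
    (((assignPoint k).run s).nat 7 0 = s.nat 7 0 ∧
      ((assignPoint k).run s).nat 6 (s.nat 10 0) < k ∧
      Near R (s.nat 10 0) (((assignPoint k).run s).nat 6 (s.nat 10 0)))) := by
  set i := s.nat 10 0 with hi
  set s₁ := s.writeNat 6 i k with hs₁
  have h₁ := unroll_rule (s := s₁)
    (p := fun j => .ite (nearTest (cell 10) j) (.setNat 6 (cell 10) (.const j)) .skip) (k := k)
    (fun j s' => (∀ x ≠ i, s'.nat 6 x = s.nat 6 x) ∧
      ((s'.nat 6 i = k ∧ ∀ j' < j, ¬ Near R i j') ∨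
        (s'.nat 6 i < k ∧ Near R i (s'.nat 6 i))))
    ⟨fun x hx => by simp [hs₁, hx], Or.inl ⟨by simp [hs₁], fun _ h => absurd h (by omega)⟩⟩
    (by
      rintro j hj s' hf ⟨h₁, h₂⟩
      have hi' : s'.nat 10 0 = i := by
        rw [hf.nat 10 (by simp [writesNat_unroll, WritesNat])]
        simp [hs₁, hi]
      have hR : s'.real = R := by
        funext a
        rw [hf.real a (by simp [writesReal_unroll, WritesReal]), hs₁, State.writeNat_real, hs.real]
      by_cases hnear : Near R i j
      · refine ⟨fun x hx => ?_, Or.inr ?_⟩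
        · simp [run, NatExpr.eval, hi', hR, hnear, hx, h₁ x hx]
        · simp [run, NatExpr.eval, hi', hR, hnear, hj]
      · simp only [run, holds_nearTest, NatExpr.eval, hi', hR, hnear, if_false]
        refine ⟨h₁, h₂.imp_left fun h₂ => ⟨h₂.1, fun j' hj' => ?_⟩⟩
        rcases Nat.lt_succ_iff_lt_or_eq.1 hj' with h | rfl
        · exact h₂.2 j' h
        · exact hnear)
  have hf := frame_run
    (unroll (fun j => .ite (nearTest (cell 10) j) (.setNat 6 (cell 10) (.const j)) .skip) k) s₁
  have hi' := congrFun (hf.nat 10 (by simp [writesNat_unroll, WritesNat])) 0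
  have h7 := congrFun (hf.nat 7 (by simp [writesNat_unroll, WritesNat])) 0
  simp only [assignPoint, run, NatExpr.eval, ← hi, ← hs₁, Test.Holds]
  generalize (unroll (fun j => .ite (nearTest (cell 10) j) (.setNat 6 (cell 10) (.const j)) .skip)
    k).run s₁ = s₂ at h₁ hf hi' h7 ⊢
  replace hi' : s₂.nat 10 0 = i := by rw [hi']; simp [hs₁, hi]
  replace h7 : s₂.nat 7 0 = s.nat 7 0 := by rw [h7]; simp [hs₁]
  rw [hi']
  obtain ⟨h₁, ⟨h₂, h₃⟩ | ⟨h₂, h₃⟩⟩ := h₁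
  · rw [if_pos h₂.ge]
    exact ⟨fun x hx => by simp [h₁ x hx], Or.inl ⟨by simp, h₃⟩⟩
  · rw [if_neg (by omega)]
    exact ⟨h₁, Or.inr ⟨h7, h₂, h₃⟩⟩

theorem writesNat_firstAssignment {a : ℕ} (h : (firstAssignment k).WritesNat a) :
    a = 6 ∨ a = 7 ∨ a = 10 := by
  simp only [firstAssignment, WritesNat] at h
  rcases h with h | h | h
  · omega
  · omega
  · have := writesNat_assignPoint h
    omega

theorem writesReal_firstAssignment {a : ℕ} : ¬ (firstAssignment k).WritesReal a := by
  simp [firstAssignment, WritesReal, writesReal_assignPoint]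

theorem run_firstAssignment (hs : HasData N col L U R s) :
    (((firstAssignment k).run s).nat 7 0 = 0 ∧ ¬ ∃ g, Admissible (N 0) k (Near R) g) ∨
    (((firstAssignment k).run s).nat 7 0 = 1 ∧
      Admissible (N 0) k (Near R) (((firstAssignment k).run s).nat 6)) := by
  set s₁ := s.writeNat 7 0 1 with hs₁
  have hd₁ : HasData N col L U R s₁ := hs.writeNat (by omega) _ _
  obtain ⟨s₂, -, hinv, hrun⟩ := count_rule (v := 10) (b := 0) (p := assignPoint k) (s := s₁)
    (fun i s' => (s'.nat 7 0 = 0 ∧ ∃ x < N 0, ∀ j < k, ¬ Near R x j) ∨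
      (s'.nat 7 0 = 1 ∧ ∀ x < i, s'.nat 6 x < k ∧ Near R x (s'.nat 6 x)))
    (Or.inr ⟨by simp [hs₁], fun _ h => absurd h (by omega)⟩)
    (by
      intro i hi s' hf hinv
      have hd : HasData N col L U R (s'.writeNat 10 0 i) := by
        refine (hd₁.frame hf (fun a ha h => ?_) fun a => writesReal_assignPoint).writeNat
          (by omega) _ _
        rcases h with h | h
        · omega
        · have := writesNat_assignPoint h
          omega
      have h := run_assignPoint (k := k) hd
      simp only [State.writeNat_nat, and_self, if_true] at h
      simp only [Nat.reduceEqDiff, false_and, if_false] at h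
      obtain ⟨h₁, ⟨h₂, h₃⟩ | ⟨h₂, h₃⟩⟩ := h
      · rw [hd₁.size] at hi
        exact Or.inl ⟨h₂, i, hi, h₃⟩
      · rw [h₂]
        refine hinv.imp_right fun h => ⟨h.1, fun x hx => ?_⟩
        rcases Nat.lt_succ_iff_lt_or_eq.1 hx with hx | rfl
        · rw [h₁ x (by omega)]
          exact h.2 x hx
        · exact h₃)
  rw [firstAssignment, run, run, NatExpr.eval, NatExpr.eval, ← hs₁, hrun]
  rw [hd₁.size] at hinv ⊢
  simp only [State.writeNat_nat, Nat.reduceEqDiff, false_and, if_false]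
  rcases hinv with ⟨h₁, x, hx, h₂⟩ | h
  · exact Or.inl ⟨h₁, fun ⟨g, hg⟩ => h₂ _ (hg x hx).1 (hg x hx).2⟩
  · exact Or.inr h

/-! ### Cluster sizes and movable points -/

/-- The point `w - 1` can be moved, or `w = 0` and no point can be moved. -/
def IsMovableEntry (n : ℕ) (col : ℕ → ℕ) (A : ℕ → ℕ → Prop) (f : ℕ → ℕ) (q j j' w : ℕ) : Prop :=
  (w = 0 ∧ ¬ Movable n col A f q j j') ∨
    ∃ i < n, w = i + 1 ∧ col i = q ∧ f i = j ∧ A i j'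

/-- Clear the cluster sizes and the movable points. -/
def clear (k : ℕ) : CountProg :=
  unroll (fun j => .seq (.setNat 14 (.const j) (.const 0))
    (unroll (fun j' => .setNat (20 + 3 * j') (.const j) (.const 0)) k)) k

/-- Record where the current point can be moved. -/
def recordMoves (k : ℕ) : CountProg :=
  unroll (fun j' => .ite (nearTest (cell 10) j')
    (.setNat (20 + 3 * j') (.read 6 (cell 10)) (.add (cell 10) (.const 1))) .skip) k

/-- Take the current point into account if it has the current color. -/
def gatherPoint (k : ℕ) : CountProg :=
  .ite (eqTest (.read 1 (cell 10)) (cell 8))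
    (.seq (.setNat 14 (.read 6 (cell 10)) (.add (.read 14 (.read 6 (cell 10))) (.const 1)))
      (recordMoves k)) .skip

/-- Compute the cluster sizes and the movable points of the current color. -/
def gather (k : ℕ) : CountProg := .seq (clear k) (.count 10 0 (gatherPoint k))

/-- The tables of movable points occupy array names congruent to 2 modulo 3, while the counters of
the center enumeration use the residues 0 and 1; the residue is recorded in order to separate them.
-/
theorem writesNat_clear {a : ℕ} (h : (clear k).WritesNat a) : a = 14 ∨ 20 ≤ a ∧ a % 3 = 2 := by
  simp only [clear, WritesNat, writesNat_unroll] at h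
  rcases h with ⟨_, _, h | h⟩
  · exact Or.inl h
  · obtain ⟨_, _, h⟩ := h
    omega

theorem writesReal_clear {a : ℕ} : ¬ (clear k).WritesReal a := by
  simp [clear, WritesReal, writesReal_unroll]

theorem writesNat_recordMoves {a : ℕ} (h : (recordMoves k).WritesNat a) :
    20 ≤ a ∧ a % 3 = 2 := by
  simp only [recordMoves, WritesNat, writesNat_unroll, or_false] at h
  obtain ⟨_, _, h⟩ := h
  omega

theorem writesReal_recordMoves {a : ℕ} : ¬ (recordMoves k).WritesReal a := by
  simp [recordMoves, WritesReal, writesReal_unroll]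

theorem writesNat_gatherPoint {a : ℕ} (h : (gatherPoint k).WritesNat a) :
    a = 14 ∨ 20 ≤ a ∧ a % 3 = 2 := by
  simp only [gatherPoint, WritesNat, or_false] at h
  exact h.imp_right writesNat_recordMoves

theorem writesReal_gatherPoint {a : ℕ} : ¬ (gatherPoint k).WritesReal a := by
  simp [gatherPoint, WritesReal, writesReal_recordMoves]

theorem writesNat_gather {a : ℕ} (h : (gather k).WritesNat a) :
    a = 10 ∨ a = 14 ∨ 20 ≤ a ∧ a % 3 = 2 := by
  simp only [gather, WritesNat] at h
  rcases h with h | h | h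
  · exact Or.inr (writesNat_clear h)
  · exact Or.inl h
  · exact Or.inr (writesNat_gatherPoint h)

theorem writesReal_gather {a : ℕ} : ¬ (gather k).WritesReal a := by
  simp [gather, WritesReal, writesReal_gatherPoint, writesReal_clear]

theorem run_clear : ∀ j < k, ((clear k).run s).nat 14 j = 0 ∧
    ∀ j' < k, ((clear k).run s).nat (20 + 3 * j') j = 0 := by
  refine unroll_rule (fun J s' => ∀ j < J, s'.nat 14 j = 0 ∧
    ∀ j' < k, s'.nat (20 + 3 * j') j = 0) (fun _ h => absurd h (by omega)) ?_
  intro J hJ s' _ hinv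
  have h := unroll_rule (s := s'.writeNat 14 J 0)
    (p := fun j' => .setNat (20 + 3 * j') (.const J) (.const 0)) (k := k)
    (fun J' s'' => (∀ j < J + 1, s''.nat 14 j = 0) ∧
      ∀ j < J + 1, ∀ j' < k, (j < J ∨ j' < J') → s''.nat (20 + 3 * j') j = 0)
    (by
      refine ⟨fun j hj => ?_, fun j hj j' hj' h => ?_⟩
      · by_cases h : j = J
        · simp [h]
        · simp [h, (hinv j (by omega)).1]
      · simp only [State.writeNat_nat]
        rw [if_neg (by omega)]
        exact (hinv j (by omega)).2 j' hj')
    (by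
      rintro J' hJ' s'' - ⟨h₁, h₂⟩
      simp only [run, NatExpr.eval, State.writeNat_nat]
      refine ⟨fun j hj => ?_, fun j hj j' hj' h => ?_⟩
      · rw [if_neg (by omega)]
        exact h₁ j hj
      · split
        · rfl
        · exact h₂ j hj j' hj' (by omega))
  intro j hj
  exact ⟨h.1 j hj, fun j' hj' => h.2 j hj j' hj' (Or.inr hj')⟩

theorem run_recordMoves {j j' : ℕ} (hj' : j' < k) :
    ((recordMoves k).run s).nat (20 + 3 * j') j =
      open Classical in
      if j = s.nat 6 (s.nat 10 0) ∧ Near s.real (s.nat 10 0) j' then s.nat 10 0 + 1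
      else s.nat (20 + 3 * j') j := by
  classical
  have h := unroll_rule (s := s)
    (p := fun j' => .ite (nearTest (cell 10) j')
      (.setNat (20 + 3 * j') (.read 6 (cell 10)) (.add (cell 10) (.const 1))) .skip) (k := k)
    (fun J s' => ∀ j' < k, s'.nat (20 + 3 * j') j =
      if j' < J ∧ j = s.nat 6 (s.nat 10 0) ∧ Near s.real (s.nat 10 0) j' then s.nat 10 0 + 1
      else s.nat (20 + 3 * j') j)
    (fun j' _ => by simp)
    (by
      intro J hJ s' hf hinv j' hj'
      have hi' : s'.nat 10 = s.nat 10 :=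
        hf.nat 10 (by simp only [writesNat_unroll, WritesNat, or_false]; rintro ⟨_, _, h⟩; omega)
      have h6 : s'.nat 6 = s.nat 6 :=
        hf.nat 6 (by simp only [writesNat_unroll, WritesNat, or_false]; rintro ⟨_, _, h⟩; omega)
      have hR : s'.real = s.real := by
        funext a
        exact hf.real a (by simp [writesReal_unroll, WritesReal])
      by_cases hnear : Near s.real (s.nat 10 0) J
      · simp only [run, holds_nearTest, NatExpr.eval, hi', h6, hR, hnear, if_true,
          State.writeNat_nat]
        by_cases hJj : j' = J
        · subst hJj
          by_cases hj : j = s.nat 6 (s.nat 10 0)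
          · simp [hj, hnear]
          · simp [hj, hinv j' hj']
        · rw [if_neg (by omega), hinv j' hj']
          congr 1
          rw [show j' < J + 1 ↔ j' < J by omega]
      · simp only [run, holds_nearTest, NatExpr.eval, hi', hR, hnear, if_false]
        rw [hinv j' hj']
        by_cases hJj : j' = J
        · subst hJj
          simp [hnear]
        · congr 1
          rw [show j' < J + 1 ↔ j' < J by omega])
  rw [recordMoves, h j' hj']
  simp [hj']

theorem count_succ (n : ℕ) (col f : ℕ → ℕ) (q j : ℕ) : count (n + 1) col f q j =
    count n col f q j + if col n = q ∧ f n = j then 1 else 0 := by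
  unfold count
  rw [Finset.range_add_one, Finset.filter_insert]
  split
  · rw [Finset.card_insert_of_notMem (by simp)]
  · rw [Nat.add_zero]

/-- The loop invariant is the conclusion restricted to the points already scanned. A later movable
point may overwrite an earlier one, since any witness will do. -/
theorem run_gather (hs : HasData N col L U R s) :
    ∀ j < k, ((gather k).run s).nat 14 j = count (N 0) col (s.nat 6) (s.nat 8 0) j ∧
      ∀ j' < k, IsMovableEntry (N 0) col (Near R) (s.nat 6) (s.nat 8 0) j j'
        (((gather k).run s).nat (20 + 3 * j') j) := by
  have hclear := run_clear (s := s) (k := k)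
  have hf₁ := frame_run (clear k) s
  rw [gather, run]
  have hd₁ : HasData N col L U R ((clear k).run s) := by
    refine hs.frame hf₁ (fun a ha h => ?_) fun a => writesReal_clear
    have := writesNat_clear h
    omega
  have h6 : ((clear k).run s).nat 6 = s.nat 6 := hf₁.nat 6 fun h => by
    have := writesNat_clear h
    omega
  have h8 : ((clear k).run s).nat 8 = s.nat 8 := hf₁.nat 8 fun h => by
    have := writesNat_clear h
    omega
  generalize (clear k).run s = s₁ at *
  obtain ⟨s₂, -, hinv, hrun⟩ := count_rule (v := 10) (b := 0) (p := gatherPoint k) (s := s₁)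
    (fun i s' => ∀ j < k, s'.nat 14 j = count i col (s.nat 6) (s.nat 8 0) j ∧
      ∀ j' < k, IsMovableEntry i col (Near R) (s.nat 6) (s.nat 8 0) j j'
        (s'.nat (20 + 3 * j') j))
    (fun j hj => ⟨by simp [hclear j hj, count], fun j' hj' => Or.inl ⟨(hclear j hj).2 j' hj',
      fun ⟨i, hi, _⟩ => absurd hi (by omega)⟩⟩)
    (by
      intro i hi s' hf hinv
      have hw : ∀ a, (CountProg.count 10 0 (gatherPoint k)).WritesNat a →
          a = 10 ∨ a = 14 ∨ 20 ≤ a ∧ a % 3 = 2 := fun a h => h.imp_right writesNat_gatherPoint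
      have hd : HasData N col L U R s' := by
        refine hd₁.frame hf (fun a ha h => ?_) fun a => writesReal_gatherPoint
        have := hw a h
        omega
      have h6' : s'.nat 6 = s.nat 6 := by
        rw [hf.nat 6 fun h => ?_, h6]
        have := hw 6 h
        omega
      have h8' : s'.nat 8 = s.nat 8 := by
        rw [hf.nat 8 fun h => ?_, h8]
        have := hw 8 h
        omega
      -- An entry remains correct when the new point does not give this particular move.
      have hstep : ∀ j j' w, ¬ (col i = s.nat 8 0 ∧ s.nat 6 i = j ∧ Near R i j') →
          IsMovableEntry i col (Near R) (s.nat 6) (s.nat 8 0) j j' w →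
          IsMovableEntry (i + 1) col (Near R) (s.nat 6) (s.nat 8 0) j j' w := by
        rintro j j' w hno (⟨h₁, h₂⟩ | ⟨x, hx, h⟩)
        · refine Or.inl ⟨h₁, fun ⟨x, hx, h₃⟩ => ?_⟩
          rcases Nat.lt_succ_iff_lt_or_eq.1 hx with hx | rfl
          · exact h₂ ⟨x, hx, h₃⟩
          · exact hno h₃
        · exact Or.inr ⟨x, by omega, h⟩
      intro j hj
      rw [count_succ]
      by_cases hcol : col i = s.nat 8 0
      · have hc : (eqTest (.read 1 (cell 10)) (cell 8)).Holds (s'.writeNat 10 0 i) := by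
          simp [NatExpr.eval, hd.color, h8', hcol]
        rw [gatherPoint, run, if_pos hc, run]
        constructor
        · rw [(frame_run (recordMoves k) _).nat 14 fun h => by
            have := writesNat_recordMoves h
            omega]
          simp only [run, NatExpr.eval, State.writeNat_nat, h6', (hinv j hj).1, hcol]
          by_cases hj' : s.nat 6 i = j
          · subst hj'
            simp [(hinv _ hj).1]
          · simp [hj', Ne.symm hj']
        · intro j' hj'
          rw [run_recordMoves hj']
          set t := (CountProg.setNat 14 (.read 6 (cell 10))
            (.add (.read 14 (.read 6 (cell 10))) (.const 1))).run (s'.writeNat 10 0 i) with ht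
          have ht6 : t.nat 6 = s.nat 6 := by
            funext x
            simp [ht, run, h6']
          have ht10 : t.nat 10 0 = i := by simp [ht, run]
          have htR : t.real = R := by simp [ht, run, hd.real]
          have htw : t.nat (20 + 3 * j') j = s'.nat (20 + 3 * j') j := by
            simp only [ht, run, State.writeNat_nat]
            rw [if_neg (by omega), if_neg (by omega)]
          rw [ht6, ht10, htR, htw]
          split_ifs with h
          · exact Or.inr ⟨i, by omega, rfl, hcol, h.1.symm, h.2⟩
          · exact hstep j j' _ (fun h' => h ⟨h'.2.1.symm, h'.2.2⟩) ((hinv j hj).2 j' hj')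
      · have hc : ¬ (eqTest (.read 1 (cell 10)) (cell 8)).Holds (s'.writeNat 10 0 i) := by
          simp [NatExpr.eval, hd.color, h8', hcol]
        rw [gatherPoint, run, if_neg hc, run]
        simp only [State.writeNat_nat, hcol, false_and, if_false, Nat.add_zero, Nat.reduceEqDiff]
        refine ⟨(hinv j hj).1, fun j' hj' => ?_⟩
        rw [if_neg (by omega)]
        exact hstep j j' _ (fun h' => hcol h'.1) ((hinv j hj).2 j' hj'))
  rw [hrun]
  rw [hd₁.size] at hinv ⊢
  intro j hj
  simp only [State.writeNat_nat, Nat.reduceEqDiff, false_and, if_false]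
  refine ⟨(hinv j hj).1, fun j' hj' => ?_⟩
  rw [if_neg (by omega)]
  exact (hinv j hj).2 j' hj'

/-! ### Improving paths -/

/-- Every step of the path can be made. -/
def edgesTest : ℕ → List ℕ → Test
  | _, [] => .natLe (.const 0) (.const 0)
  | a, b :: p => .and (.natLe (.const 1) (.read (20 + 3 * b) (.const a))) (edgesTest b p)

/-- Moving a point from `a` to `b` decreases the violation for the current color. -/
def improvingTest (a b : ℕ) : Test :=
  orTest
    (.and (ltTest (.read 3 (cell 8)) (.read 14 (.const a)))
      (ltTest (.read 14 (.const b)) (.read 3 (cell 8))))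
    (.and (ltTest (.read 2 (cell 8)) (.read 14 (.const a)))
      (ltTest (.read 14 (.const b)) (.read 2 (cell 8))))

/-- The last vertex of a path. -/
def target (a : ℕ) (p : List ℕ) : ℕ := (a :: p).getLast (by simp)

/-- Moving points along the path is possible and decreases the violation. -/
def pathTest (a : ℕ) (p : List ℕ) : Test := .and (edgesTest a p) (improvingTest a (target a p))

/-- Move points along a path. -/
def moveAlong : ℕ → List ℕ → CountProg
  | _, [] => .skip
  | a, b :: p => .seq
      (.setNat 6 (.sub (.read (20 + 3 * b) (.const a)) (.const 1)) (.const b)) (moveAlong b p)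

/-- Move points along the first improving path in the list. -/
def improve : List (List ℕ) → CountProg
  | [] => .skip
  | [] :: Q => improve Q
  | (a :: p) :: Q => .ite (pathTest a p) (moveAlong a p) (improve Q)

/-- A list of all simple paths in the complete graph with vertices `0, …, k - 1`. -/
def simplePaths (k : ℕ) : List (List ℕ) := (List.range k).sublists.flatMap List.permutations

/-- A duplicate-free list of numbers below `k` is a permutation of a sublist of `List.range k`. The
enumeration is part of the program text, so its length affects only the constant. -/
theorem mem_simplePaths {p : List ℕ} : p ∈ simplePaths k ↔ p.Nodup ∧ ∀ c ∈ p, c < k := by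
  simp only [simplePaths, List.mem_flatMap, List.mem_sublists, List.mem_permutations]
  constructor
  · rintro ⟨r, hr, hp⟩
    exact ⟨hp.nodup_iff.2 (List.nodup_range.sublist hr),
      fun c hc => List.mem_range.1 (hr.subset (hp.subset hc))⟩
  · rintro ⟨hnd, hlt⟩
    obtain ⟨r, hr, hsub⟩ := hnd.subperm fun c hc => List.mem_range.2 (hlt c hc)
    exact ⟨r, hsub, hr.symm⟩

theorem writesNat_moveAlong {a b : ℕ} {p : List ℕ} (h : (moveAlong a p).WritesNat b) : b = 6 := by
  induction p generalizing a with
  | nil => exact h.elim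
  | cons c p ih => exact h.elim id ih

theorem writesReal_moveAlong {a b : ℕ} {p : List ℕ} : ¬ (moveAlong a p).WritesReal b := by
  induction p generalizing a with
  | nil => exact id
  | cons c p ih => exact not_or.2 ⟨id, ih⟩

theorem writesNat_improve {b : ℕ} {Q : List (List ℕ)} (h : (improve Q).WritesNat b) : b = 6 := by
  induction Q with
  | nil => exact h.elim
  | cons p Q ih =>
    cases p with
    | nil => exact ih h
    | cons a p => exact h.elim writesNat_moveAlong ih

theorem writesReal_improve {b : ℕ} {Q : List (List ℕ)} : ¬ (improve Q).WritesReal b := by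
  induction Q with
  | nil => exact id
  | cons p Q ih =>
    cases p with
    | nil => exact ih
    | cons a p => exact not_or.2 ⟨writesReal_moveAlong, ih⟩

/-- The point to be moved from `j` to `j'`. -/
def witness (s : State) (j j' : ℕ) : ℕ := s.nat (20 + 3 * j') j - 1

/-- Only the assignment is written, so the table of movable points stays as gathered; this matches
the fixed witnesses in `movePath`. -/
theorem run_moveAlong (p : List ℕ) : ∀ (a : ℕ) (s : State),
    ((moveAlong a p).run s).nat 6 = movePath (witness s) (s.nat 6) a p := by
  induction p with
  | nil => exact fun _ _ => rfl
  | cons b p ih =>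
    intro a s
    rw [moveAlong, run, ih, movePath, run]
    congr 1
    funext j j'
    simp only [witness, State.writeNat_nat]
    rw [if_neg (by omega)]

theorem run_improve : ∀ Q : List (List ℕ),
    ((improve Q).run s = s ∧ ∀ a p, a :: p ∈ Q → ¬ (pathTest a p).Holds s) ∨
    ∃ a p, a :: p ∈ Q ∧ (pathTest a p).Holds s ∧ (improve Q).run s = (moveAlong a p).run s
  | [] => Or.inl ⟨rfl, fun _ _ h => absurd h List.not_mem_nil⟩
  | [] :: Q => by
    rcases run_improve Q with ⟨h₁, h₂⟩ | ⟨a, p, h₁, h₂⟩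
    · exact Or.inl ⟨h₁, fun a p h => h₂ a p (by simpa using h)⟩
    · exact Or.inr ⟨a, p, List.mem_cons_of_mem _ h₁, h₂⟩
  | (a :: p) :: Q => by
    by_cases h : (pathTest a p).Holds s
    · exact Or.inr ⟨a, p, List.mem_cons_self .., h, by rw [improve, run, if_pos h]⟩
    · rw [improve, run, if_neg h]
      rcases run_improve Q with ⟨h₁, h₂⟩ | ⟨a', p', h₁, h₂⟩
      · refine Or.inl ⟨h₁, fun a' p' h' => ?_⟩
        rcases List.mem_cons.1 h' with h' | h'
        · simp only [List.cons.injEq] at h'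
          rw [h'.1, h'.2]
          exact h
        · exact h₂ a' p' h'
      · exact Or.inr ⟨a', p', List.mem_cons_of_mem _ h₁, h₂⟩

theorem holds_improvingTest {a b : ℕ} : (improvingTest a b).Holds s ↔
    Improving (s.nat 2 (s.nat 8 0)) (s.nat 3 (s.nat 8 0)) (s.nat 14 a) (s.nat 14 b) := by
  simp [improvingTest, Test.Holds, Improving, NatExpr.eval]

/-- The memory contains the cluster sizes and the movable points of the current color. -/
def Gathered (k n : ℕ) (col : ℕ → ℕ) (R : ℕ → ℕ → ℝ) (s : State) : Prop :=
  ∀ j < k, s.nat 14 j = count n col (s.nat 6) (s.nat 8 0) j ∧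
    ∀ j' < k, IsMovableEntry n col (Near R) (s.nat 6) (s.nat 8 0) j j' (s.nat (20 + 3 * j') j)

theorem holds_edgesTest {n : ℕ} (hs : Gathered k n col R s) (p : List ℕ) :
    ∀ a, (∀ c ∈ a :: p, c < k) → ((edgesTest a p).Holds s ↔
      (a :: p).IsChain (Movable n col (Near R) (s.nat 6) (s.nat 8 0))) := by
  induction p with
  | nil => exact fun a _ => by simp [edgesTest, Test.Holds]
  | cons b p ih =>
    intro a hlt
    rw [edgesTest, Test.Holds, ih b fun c hc => hlt c (List.mem_cons_of_mem _ hc),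
      List.isChain_cons_cons]
    refine and_congr_left fun _ => ?_
    rw [Test.Holds, NatExpr.eval, NatExpr.eval, NatExpr.eval]
    rcases (hs a (hlt a (by simp))).2 b (hlt b (by simp)) with ⟨h₁, h₂⟩ | ⟨i, hi, h₁, h₂⟩
    · simp [h₁, h₂]
    · simp only [h₁, Nat.le_add_left, true_iff]
      exact ⟨i, hi, h₂⟩

theorem Gathered.isWitness {n : ℕ} (hs : Gathered k n col R s) {a b : ℕ} (ha : a < k) (hb : b < k)
    (h : Movable n col (Near R) (s.nat 6) (s.nat 8 0) a b) :
    IsWitness n col (Near R) (s.nat 6) (s.nat 8 0) (witness s) a b := by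
  rcases (hs a ha).2 b hb with ⟨_, h₂⟩ | ⟨i, hi, h₁, h₂⟩
  · exact absurd h h₂
  · rw [IsWitness, witness, h₁, Nat.add_sub_cancel]
    exact ⟨hi, h₂⟩

/-- One step of the improvement leads to an admissible assignment with a smaller violation, if
the bounds can be met at all. -/
theorem run_improve_simplePaths (hs : HasData N col L U R s) (hG : Gathered k (N 0) col R s)
    (hA : Admissible (N 0) k (Near R) (s.nat 6)) :
    Admissible (N 0) k (Near R) (((improve (simplePaths k)).run s).nat 6) ∧
    (∀ i, col i ≠ s.nat 8 0 → ((improve (simplePaths k)).run s).nat 6 i = s.nat 6 i) ∧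
    ((∃ g, Admissible (N 0) k (Near R) g ∧
        Balanced (N 0) k col g (L (s.nat 8 0)) (U (s.nat 8 0)) (s.nat 8 0)) →
      violation (N 0) k col (((improve (simplePaths k)).run s).nat 6) (L (s.nat 8 0))
          (U (s.nat 8 0)) (s.nat 8 0) ≤
        violation (N 0) k col (s.nat 6) (L (s.nat 8 0)) (U (s.nat 8 0)) (s.nat 8 0) - 1) := by
  rcases run_improve (s := s) (simplePaths k) with ⟨h₁, h₂⟩ | ⟨a, p, h₁, h₂, h₃⟩
  · rw [h₁]
    refine ⟨hA, fun _ _ => rfl, fun ⟨g, hg, hbal⟩ => ?_⟩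
    by_contra hlt
    have hviol : ¬ Balanced (N 0) k col (s.nat 6) (L (s.nat 8 0)) (U (s.nat 8 0)) (s.nat 8 0) := by
      intro h
      rw [← violation_eq_zero] at h
      omega
    obtain ⟨a, b, -, himp, ha, p, hnd, hlt', hch, hlast⟩ :=
      exists_improving_path hA hg hbal hviol
    refine h₂ a p (mem_simplePaths.2 ⟨hnd, hlt'⟩) ⟨(holds_edgesTest hG p a hlt').2 hch, ?_⟩
    have hb : b < k := hlast ▸ hlt' _ (List.getLast_mem _)
    rw [target, hlast, holds_improvingTest, hs.lower, hs.upper, (hG a ha).1, (hG b hb).1]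
    exact himp
  · rw [h₃, run_moveAlong]
    obtain ⟨hnd, hlt⟩ := mem_simplePaths.1 h₁
    obtain ⟨hch, himp⟩ := h₂
    rw [holds_edgesTest hG p a hlt] at hch
    have hb : target a p < k := hlt _ (List.getLast_mem _)
    have ha : a < k := hlt a (by simp)
    rw [holds_improvingTest, hs.lower, hs.upper, (hG a ha).1, (hG _ hb).1] at himp
    obtain ⟨h₄, h₅, h₆⟩ := movePath_spec (k := k) p a (s.nat 6) hnd
      (fun c hc => hlt c (List.mem_cons_of_mem _ hc))
      (hch.imp_of_mem_imp fun x y hx hy h => hG.isWitness (hlt x hx) (hlt y hy) h) hA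
    refine ⟨h₄, h₅, fun ⟨g, hg, hbal⟩ => Nat.le_sub_one_of_lt ?_⟩
    refine violation_lt ((hbal a ha).1.trans (hbal a ha).2) ha hb ?_ himp h₆
    intro hab
    rw [← hab] at himp
    unfold Improving at himp
    omega

/-! ### The test of a configuration -/

/-- One round of improvement for the current color. -/
def improveRound (k : ℕ) : CountProg := .seq (gather k) (improve (simplePaths k))

/-- Clear the success flag if the bounds for the current color are violated. -/
def checkBounds (k : ℕ) : CountProg :=
  unroll (fun j => .ite (.and (.natLe (.read 2 (cell 8)) (.read 14 (.const j)))
    (.natLe (.read 14 (.const j)) (.read 3 (cell 8)))) .skip (.setNat 7 (.const 0) (.const 0))) k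

/-- Balance the clusters for the current color. -/
def balanceColor (k : ℕ) : CountProg :=
  .seq (.count 9 0 (.seq (improveRound k) (improveRound k))) (.seq (gather k) (checkBounds k))

theorem writesNat_improveRound {a : ℕ} (h : (improveRound k).WritesNat a) :
    a = 6 ∨ a = 10 ∨ a = 14 ∨ 20 ≤ a ∧ a % 3 = 2 :=
  h.elim (fun h => Or.inr (writesNat_gather h)) fun h => Or.inl (writesNat_improve h)

theorem writesReal_improveRound {a : ℕ} : ¬ (improveRound k).WritesReal a :=
  not_or.2 ⟨writesReal_gather, writesReal_improve⟩

theorem writesNat_checkBounds {a : ℕ} (h : (checkBounds k).WritesNat a) : a = 7 := by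
  simp only [checkBounds, WritesNat, writesNat_unroll, false_or] at h
  exact h.choose_spec.2

theorem writesReal_checkBounds {a : ℕ} : ¬ (checkBounds k).WritesReal a := by
  simp [checkBounds, WritesReal, writesReal_unroll]

theorem writesNat_balanceColor {a : ℕ} (h : (balanceColor k).WritesNat a) :
    a = 6 ∨ a = 7 ∨ a = 9 ∨ a = 10 ∨ a = 14 ∨ 20 ≤ a ∧ a % 3 = 2 := by
  simp only [balanceColor, WritesNat] at h
  rcases h with (h | h | h) | h | h
  · omega
  · have := writesNat_improveRound h
    omega
  · have := writesNat_improveRound h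
    omega
  · have := writesNat_gather h
    omega
  · have := writesNat_checkBounds h
    omega

theorem writesReal_balanceColor {a : ℕ} : ¬ (balanceColor k).WritesReal a := by
  simp [balanceColor, WritesReal, writesReal_gather, writesReal_improveRound,
    writesReal_checkBounds]

theorem run_gather_gathered (hs : HasData N col L U R s) :
    Gathered k (N 0) col R ((gather k).run s) ∧ HasData N col L U R ((gather k).run s) ∧
      ((gather k).run s).nat 6 = s.nat 6 ∧ ((gather k).run s).nat 7 = s.nat 7 ∧
      ((gather k).run s).nat 8 = s.nat 8 := by
  have hf := frame_run (gather k) s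
  have hw : ∀ a < 10, ¬ (gather k).WritesNat a := fun a ha h => by
    have := writesNat_gather h
    omega
  have h6 := hf.nat 6 (hw 6 (by omega))
  have h8 := hf.nat 8 (hw 8 (by omega))
  refine ⟨?_, hs.frame hf (fun a ha => hw a (by omega)) fun a => writesReal_gather, h6,
    hf.nat 7 (hw 7 (by omega)), h8⟩
  have h := run_gather (k := k) hs
  rw [← h6, ← h8] at h
  exact h

theorem run_improveRound (hs : HasData N col L U R s)
    (hA : Admissible (N 0) k (Near R) (s.nat 6)) {q : ℕ} (hq : s.nat 8 0 = q) :
    Admissible (N 0) k (Near R) (((improveRound k).run s).nat 6) ∧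
    (∀ i, col i ≠ q → ((improveRound k).run s).nat 6 i = s.nat 6 i) ∧
    ((∃ g, Admissible (N 0) k (Near R) g ∧ Balanced (N 0) k col g (L q) (U q) q) →
      violation (N 0) k col (((improveRound k).run s).nat 6) (L q) (U q) q ≤
        violation (N 0) k col (s.nat 6) (L q) (U q) q - 1) := by
  obtain ⟨hG, hd, h6, -, h8⟩ := run_gather_gathered (k := k) hs
  have h := run_improve_simplePaths hd hG (h6 ▸ hA)
  rw [h8, h6, hq] at h
  exact h

theorem run_checkBounds (hs : HasData N col L U R s) (hG : Gathered k (N 0) col R s) {q : ℕ}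
    (hq : s.nat 8 0 = q) :
    (Balanced (N 0) k col (s.nat 6) (L q) (U q) q ∧
        ((checkBounds k).run s).nat 7 0 = s.nat 7 0) ∨
      (¬ Balanced (N 0) k col (s.nat 6) (L q) (U q) q ∧
        ((checkBounds k).run s).nat 7 0 = 0) := by
  have h := unroll_rule (s := s)
    (p := fun j => .ite (.and (.natLe (.read 2 (cell 8)) (.read 14 (.const j)))
      (.natLe (.read 14 (.const j)) (.read 3 (cell 8)))) .skip
      (.setNat 7 (.const 0) (.const 0))) (k := k)
    (fun J s' => ((∀ j < J, L q ≤ s.nat 14 j ∧ s.nat 14 j ≤ U q) ∧ s'.nat 7 0 = s.nat 7 0) ∨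
      ((∃ j < J, ¬ (L q ≤ s.nat 14 j ∧ s.nat 14 j ≤ U q)) ∧ s'.nat 7 0 = 0))
    (Or.inl ⟨fun _ h => absurd h (by omega), rfl⟩)
    (by
      intro J hJ s' hf hinv
      have hw : ∀ a, a ≠ 7 → s'.nat a = s.nat a := fun a ha =>
        hf.nat a fun h => ha (writesNat_checkBounds h)
      have htest : (Test.and (.natLe (.read 2 (cell 8)) (.read 14 (.const J)))
          (.natLe (.read 14 (.const J)) (.read 3 (cell 8)))).Holds s' ↔
          L q ≤ s.nat 14 J ∧ s.nat 14 J ≤ U q := by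
        simp [Test.Holds, NatExpr.eval, hw 2, hw 3, hw 8, hw 14, hs.lower, hs.upper, hq]
      rw [run]
      split_ifs with hc
      · rw [htest] at hc
        rw [run]
        rcases hinv with ⟨h₁, h₂⟩ | ⟨⟨j, hj, h₁⟩, h₂⟩
        · refine Or.inl ⟨fun j hj => ?_, h₂⟩
          rcases Nat.lt_succ_iff_lt_or_eq.1 hj with hj | rfl
          · exact h₁ j hj
          · exact hc
        · exact Or.inr ⟨⟨j, by omega, h₁⟩, h₂⟩
      · rw [htest] at hc
        exact Or.inr ⟨⟨J, by omega, hc⟩, by simp [run, NatExpr.eval]⟩)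
  have hB : Balanced (N 0) k col (s.nat 6) (L q) (U q) q ↔
      ∀ j < k, L q ≤ s.nat 14 j ∧ s.nat 14 j ≤ U q :=
    forall₂_congr fun j hj => by rw [(hG j hj).1, hq]
  rw [hB]
  refine h.imp_right fun h => ⟨fun h' => ?_, h.2⟩
  obtain ⟨⟨j, hj, h₁⟩, -⟩ := h
  exact h₁ (h' j hj)

/-- If the color can be balanced, the rounds bring the violation down to zero. A violation that
remains therefore proves infeasibility, so clearing the flag is justified. -/
theorem run_balanceColor (hs : HasData N col L U R s)
    (hA : Admissible (N 0) k (Near R) (s.nat 6)) {q : ℕ} (hq : s.nat 8 0 = q) :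
    Admissible (N 0) k (Near R) (((balanceColor k).run s).nat 6) ∧
    (∀ i, col i ≠ q → ((balanceColor k).run s).nat 6 i = s.nat 6 i) ∧
    ((Balanced (N 0) k col (((balanceColor k).run s).nat 6) (L q) (U q) q ∧
        ((balanceColor k).run s).nat 7 0 = s.nat 7 0) ∨
      (((balanceColor k).run s).nat 7 0 = 0 ∧
        ¬ ∃ g, Admissible (N 0) k (Near R) g ∧ Balanced (N 0) k col g (L q) (U q) q)) := by
  have hw : ∀ a, (CountProg.count 9 0 (.seq (improveRound k) (improveRound k))).WritesNat a →
      a = 6 ∨ a = 9 ∨ a = 10 ∨ a = 14 ∨ 20 ≤ a ∧ a % 3 = 2 := by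
    intro a h
    rcases h with h | h | h
    · omega
    · have := writesNat_improveRound h
      omega
    · have := writesNat_improveRound h
      omega
  have hwr : ∀ a, ¬ (CountProg.count 9 0 (.seq (improveRound k) (improveRound k))).WritesReal a :=
    fun a => not_or.2 ⟨writesReal_improveRound, writesReal_improveRound⟩
  obtain ⟨s₂, hf₂, ⟨hA₂, hcol₂, hviol₂⟩, hrun⟩ := count_rule (v := 9) (b := 0)
    (p := .seq (improveRound k) (improveRound k)) (s := s)
    (fun r s' => Admissible (N 0) k (Near R) (s'.nat 6) ∧
      (∀ i, col i ≠ q → s'.nat 6 i = s.nat 6 i) ∧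
      -- The violation starts at no more than `2 * N 0`; two rounds per pass therefore exhaust it
      -- after `N 0` passes.
      ((∃ g, Admissible (N 0) k (Near R) g ∧ Balanced (N 0) k col g (L q) (U q) q) →
        violation (N 0) k col (s'.nat 6) (L q) (U q) q ≤ 2 * N 0 - 2 * r))
    ⟨hA, fun _ _ => rfl, fun ⟨g, _, hbal⟩ => violation_le hbal⟩
    (by
      rintro r hr s' hf ⟨h₁, h₂, h₃⟩
      have hd : HasData N col L U R (s'.writeNat 9 0 r) := by
        refine (hs.frame hf (fun a ha h => ?_) hwr).writeNat (by omega) _ _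
        have := hw a h
        omega
      have h8 : (s'.writeNat 9 0 r).nat 8 0 = q := by
        rw [← hq, ← hf.nat 8 fun h => ?_]
        · simp
        · have := hw 8 h
          omega
      have h6 : (s'.writeNat 9 0 r).nat 6 = s'.nat 6 := by
        funext x
        simp
      have hfr := frame_run (improveRound k) (s'.writeNat 9 0 r)
      have hd' : HasData N col L U R ((improveRound k).run (s'.writeNat 9 0 r)) := by
        refine hd.frame hfr (fun a ha h => ?_) fun a => writesReal_improveRound
        have := writesNat_improveRound h
        omega
      have h8' : ((improveRound k).run (s'.writeNat 9 0 r)).nat 8 0 = q := by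
        rw [hfr.nat 8 fun h => ?_, h8]
        have := writesNat_improveRound h
        omega
      obtain ⟨a₁, a₂, a₃⟩ := run_improveRound hd (h6.symm ▸ h₁) h8
      obtain ⟨b₁, b₂, b₃⟩ := run_improveRound hd' a₁ h8'
      rw [h6] at a₂ a₃
      refine ⟨b₁, fun i hi => by rw [run, b₂ i hi, a₂ i hi, h₂ i hi], fun hg => ?_⟩
      have e₁ := a₃ hg
      have e₂ := b₃ hg
      have e₃ := h₃ hg
      rw [run]
      omega)
  rw [hs.size] at hviol₂ hrun
  rw [balanceColor, run, hrun, run]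
  have hd : HasData N col L U R (s₂.writeNat 9 0 (N 0)) := by
    refine (hs.frame hf₂ (fun a ha h => ?_) hwr).writeNat (by omega) _ _
    have := hw a h
    omega
  have hw₂ : ∀ a, a = 7 ∨ a = 8 → (s₂.writeNat 9 0 (N 0)).nat a = s.nat a := by
    intro a ha
    rw [← hf₂.nat a fun h => ?_]
    · funext x
      simp only [State.writeNat_nat]
      rw [if_neg (by omega)]
    · have := hw a h
      omega
  have h6 : (s₂.writeNat 9 0 (N 0)).nat 6 = s₂.nat 6 := by
    funext x
    simp
  obtain ⟨hG, hd₃, h6₃, h7₃, h8₃⟩ := run_gather_gathered (k := k) hd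
  have hcheck := run_checkBounds (q := q) hd₃ hG (by rw [h8₃, hw₂ 8 (by simp), hq])
  have h6₄ : ((checkBounds k).run ((gather k).run (s₂.writeNat 9 0 (N 0)))).nat 6 = s₂.nat 6 := by
    rw [(frame_run (checkBounds k) _).nat 6 fun h => ?_, h6₃, h6]
    have := writesNat_checkBounds h
    omega
  rw [h6₃, h6, h7₃, hw₂ 7 (by simp)] at hcheck
  rw [h6₄]
  refine ⟨hA₂, hcol₂, hcheck.imp_right fun h => ⟨h.2, fun hg => h.1 ?_⟩⟩
  rw [← violation_eq_zero]
  have := hviol₂ hg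
  omega

end FairClustering

/-! ### Invariants of the search and the test for all colors. -/

namespace FairClustering

open RealRAM CountProg

/-- The data of an instance, as arrays. -/
structure Data where
  size : ℕ → ℕ
  color : ℕ → ℕ
  lower : ℕ → ℕ
  upper : ℕ → ℕ
  point : ℕ → ℝ × ℝ

/-- The number of points. -/
abbrev Data.n (D : Data) : ℕ := D.size 0

/-- The number of colors. -/
abbrev Data.m (D : Data) : ℕ := D.size 1

/-- The memory contains the data of the instance. -/
structure Data.IsInput (D : Data) (s : State) : Prop where
  size : s.nat 0 = D.size
  color : s.nat 1 = D.color
  lower : s.nat 2 = D.lower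
  upper : s.nat 3 = D.upper
  point : pointAt s.real = D.point

/-- The assignment meets all bounds. -/
def Data.Fair (D : Data) (k : ℕ) (f : ℕ → ℕ) : Prop :=
  ∀ q < D.m, Balanced D.n k D.color f (D.lower q) (D.upper q) q

/-- There is a fair clustering with the given centers and the given bound for the radii. -/
def Data.Feasible (D : Data) (k : ℕ) (c : ℕ → ℝ × ℝ) (r : ℝ) : Prop :=
  ∃ g, Admissible D.n k (fun i j => sqDist (D.point i) (c j) ≤ r * r) g ∧ D.Fair k g

/-- A fair clustering is stored in the output cells. -/
def Data.IsStored (D : Data) (k : ℕ) (s : State) : Prop :=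
  0 ≤ s.real 4 0 ∧ D.Fair k (s.nat 5) ∧
    Admissible D.n k (fun i j =>
      sqDist (D.point i) (s.real 2 j, s.real 3 j) ≤ s.real 4 0 * s.real 4 0) (s.nat 5)

/-- The output cells are consistent. -/
def Data.Sound (D : Data) (k : ℕ) (s : State) : Prop :=
  s.nat 4 0 = 0 ∨ (s.nat 4 0 = 1 ∧ D.IsStored k s)

/-- A clustering with radius at most `r` is stored. -/
def Reached (r : ℝ) (s : State) : Prop := s.nat 4 0 = 1 ∧ s.real 4 0 ≤ r

/-- The output has been improved to all radii in `X`. -/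
structure Data.Searched (D : Data) (k : ℕ) (X : ℝ → Prop) (s s' : State) : Prop where
  sound : D.Sound k s'
  mono : ∀ r, Reached r s → Reached r s'
  reached : ∀ r, X r → Reached r s'

variable {D : Data} {k : ℕ} {s s' s'' : State}

theorem Data.IsInput.frame {p : CountProg} (h : D.IsInput s) (hf : Frame p s s')
    (hn : ∀ a < 4, ¬ p.WritesNat a) (hr : ∀ a < 2, ¬ p.WritesReal a) : D.IsInput s' where
  size := by rw [hf.nat 0 (hn 0 (by omega)), h.size]
  color := by rw [hf.nat 1 (hn 1 (by omega)), h.color]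
  lower := by rw [hf.nat 2 (hn 2 (by omega)), h.lower]
  upper := by rw [hf.nat 3 (hn 3 (by omega)), h.upper]
  point := by
    rw [← h.point]
    funext i
    rw [pointAt, pointAt, hf.real 0 (hr 0 (by omega)), hf.real 1 (hr 1 (by omega))]

theorem Data.IsInput.writeNat (h : D.IsInput s) {a : ℕ} (ha : 4 ≤ a) (i v : ℕ) :
    D.IsInput (s.writeNat a i v) :=
  h.frame (frame_run (.setNat a (.const i) (.const v)) s)
    (fun c hc => by simp only [WritesNat]; omega) (fun _ _ => id)

theorem Data.Sound.congr (h : D.Sound k s) (h4 : s'.nat 4 = s.nat 4) (h5 : s'.nat 5 = s.nat 5)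
    (h2 : s'.real 2 = s.real 2) (h3 : s'.real 3 = s.real 3) (hr : s'.real 4 = s.real 4) :
    D.Sound k s' := by
  unfold Data.Sound Data.IsStored
  rw [h4, h5, h2, h3, hr]
  exact h

theorem Data.Sound.writeNat (h : D.Sound k s) {a : ℕ} (h4 : a ≠ 4) (h5 : a ≠ 5) (i v : ℕ) :
    D.Sound k (s.writeNat a i v) := by
  refine h.congr ?_ ?_ rfl rfl rfl <;> funext x <;> simp [h4.symm, h5.symm]

theorem reached_congr {r : ℝ} (h4 : s'.nat 4 = s.nat 4) (hr : s'.real 4 = s.real 4) :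
    Reached r s' ↔ Reached r s := by
  unfold Reached
  rw [h4, hr]

theorem reached_writeNat {r : ℝ} {a : ℕ} (h4 : a ≠ 4) (i v : ℕ) :
    Reached r (s.writeNat a i v) ↔ Reached r s := by
  refine reached_congr ?_ rfl
  funext x
  simp [h4.symm]

theorem Data.Searched.trans {X Y : ℝ → Prop} (h : D.Searched k X s s')
    (h' : D.Searched k Y s' s'') : D.Searched k (fun r => X r ∨ Y r) s s'' where
  sound := h'.sound
  mono := fun r hr => h'.mono r (h.mono r hr)
  reached := fun r hr => hr.elim (fun hr => h'.mono r (h.reached r hr)) (h'.reached r)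

/-- Reached radii are never lost, so a loop reaches the union of what its rounds reach. -/
theorem searched_count {v : ℕ} {p : CountProg} {X : ℕ → ℝ → Prop} (hs : D.IsInput s)
    (hsound : D.Sound k s) (h4 : v ≠ 4) (h5 : v ≠ 5)
    (h : ∀ i < D.n, ∀ s', Frame (.count v 0 p) s s' → D.Sound k s' →
      D.Searched k (X i) (s'.writeNat v 0 i) (p.run (s'.writeNat v 0 i))) :
    D.Searched k (fun r => ∃ i < D.n, X i r) s ((CountProg.count v 0 p).run s) := by
  obtain ⟨s₂, -, hinv, hrun⟩ := count_rule (v := v) (b := 0) (p := p) (s := s)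
    (fun i s' => D.Searched k (fun r => ∃ x < i, X x r) s s')
    ⟨hsound, fun _ => id, fun r ⟨_, h, _⟩ => absurd h (by omega)⟩
    (by
      intro i hi s' hf hinv
      rw [hs.size] at hi
      have h' := h i hi s' hf hinv.sound
      refine ⟨h'.sound, fun r hr => h'.mono r ((reached_writeNat h4 _ _).2 (hinv.mono r hr)), ?_⟩
      rintro r ⟨x, hx, hX⟩
      rcases Nat.lt_succ_iff_lt_or_eq.1 hx with hx | rfl
      · exact h'.mono r ((reached_writeNat h4 _ _).2 (hinv.reached r ⟨x, hx, hX⟩))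
      · exact h'.reached r hX)
  rw [hrun]
  rw [hs.size] at hinv ⊢
  exact ⟨hinv.sound.writeNat h4 h5 _ _,
    fun r hr => (reached_writeNat h4 _ _).2 (hinv.mono r hr),
    fun r hr => (reached_writeNat h4 _ _).2 (hinv.reached r hr)⟩

/-! ### Testing one configuration -/

/-- Balance the clusters for all colors. -/
def balanceAll (k : ℕ) : CountProg := .count 8 1 (balanceColor k)

/-- Copy the current clustering to the output cells. -/
def store (k : ℕ) : CountProg :=
  .seq (.setNat 4 (.const 0) (.const 1)) (.seq (.setReal 4 (.const 0) (.read 5 (.const 0)))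
    (.seq (unroll (fun j => .seq (.setReal 2 (.const j) (.read (10 + 2 * j) (.const 0)))
        (.setReal 3 (.const j) (.read (11 + 2 * j) (.const 0)))) k)
      (.count 10 0 (.setNat 5 (cell 10) (.read 6 (cell 10))))))

/-- Look for a fair clustering with the current centers and radius, and store it if it is better
than the stored one. -/
def testCenters (k : ℕ) : CountProg :=
  .seq (firstAssignment k) (.seq (.ite (.natLe (.const 1) (cell 7)) (balanceAll k) .skip)
    (.ite (.and (.natLe (.const 1) (cell 7)) (.not (.and (.natLe (.const 1) (cell 4))
      (.realLe (.read 4 (.const 0)) (.read 5 (.const 0)))))) (store k) .skip))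

theorem writesNat_balanceAll {a : ℕ} (h : (balanceAll k).WritesNat a) :
    (6 ≤ a ∧ a ≤ 10) ∨ a = 14 ∨ 20 ≤ a ∧ a % 3 = 2 := by
  rcases h with h | h
  · omega
  · have := writesNat_balanceColor h
    omega

theorem writesReal_balanceAll {a : ℕ} : ¬ (balanceAll k).WritesReal a := writesReal_balanceColor

theorem writesNat_store {a : ℕ} (h : (store k).WritesNat a) : a = 4 ∨ a = 5 ∨ a = 10 := by
  simp only [store, WritesNat, writesNat_unroll, false_or, or_false, and_false, exists_false] at h
  omega

theorem writesReal_store {a : ℕ} (h : (store k).WritesReal a) : a = 2 ∨ a = 3 ∨ a = 4 := by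
  simp only [store, WritesReal, writesReal_unroll, false_or, or_false] at h
  rcases h with h | ⟨_, _, h⟩ <;> omega

theorem writesNat_testCenters {a : ℕ} (h : (testCenters k).WritesNat a) :
    (4 ≤ a ∧ a ≤ 10) ∨ a = 14 ∨ 20 ≤ a ∧ a % 3 = 2 := by
  rcases h with h | (h | h) | h | h
  · have := writesNat_firstAssignment h
    omega
  · have := writesNat_balanceAll h
    omega
  · exact h.elim
  · have := writesNat_store h
    omega
  · exact h.elim

theorem writesReal_testCenters {a : ℕ} (h : (testCenters k).WritesReal a) :
    a = 2 ∨ a = 3 ∨ a = 4 := by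
  rcases h with h | (h | h) | h | h
  · exact absurd h writesReal_firstAssignment
  · exact absurd h writesReal_balanceAll
  · exact h.elim
  · exact writesReal_store h
  · exact h.elim

section

variable {N col L U : ℕ → ℕ} {R : ℕ → ℕ → ℝ}

/-- Balancing one color moves no point of another color, so the colors finished earlier stay
balanced. One infeasible color rules out the whole configuration, and the cleared flag is never set
again. -/
theorem run_balanceAll (hs : HasData N col L U R s) (hA : Admissible (N 0) k (Near R) (s.nat 6))
    (hok : s.nat 7 0 = 1) :
    Admissible (N 0) k (Near R) (((balanceAll k).run s).nat 6) ∧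
    ((((balanceAll k).run s).nat 7 0 = 1 ∧
        ∀ q < N 1, Balanced (N 0) k col (((balanceAll k).run s).nat 6) (L q) (U q) q) ∨
      (((balanceAll k).run s).nat 7 0 = 0 ∧ ¬ ∃ g, Admissible (N 0) k (Near R) g ∧
        ∀ q < N 1, Balanced (N 0) k col g (L q) (U q) q)) := by
  obtain ⟨s₂, -, ⟨hA₂, hinv⟩, hrun⟩ := count_rule (v := 8) (b := 1) (p := balanceColor k) (s := s)
    (fun x s' => Admissible (N 0) k (Near R) (s'.nat 6) ∧
      ((s'.nat 7 0 = 1 ∧ ∀ q < x, Balanced (N 0) k col (s'.nat 6) (L q) (U q) q) ∨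
      (s'.nat 7 0 = 0 ∧ ¬ ∃ g, Admissible (N 0) k (Near R) g ∧
        ∀ q < N 1, Balanced (N 0) k col g (L q) (U q) q)))
    ⟨hA, Or.inl ⟨hok, fun _ h => absurd h (by omega)⟩⟩
    (by
      rintro x hx s' hf ⟨h₁, h₂⟩
      rw [hs.size] at hx
      have hd : HasData N col L U R (s'.writeNat 8 0 x) := by
        refine (hs.frame hf (fun a ha h => ?_) fun a => writesReal_balanceAll).writeNat
          (by omega) _ _
        have := writesNat_balanceAll h
        omega
      have h6 : (s'.writeNat 8 0 x).nat 6 = s'.nat 6 := by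
        funext i
        simp
      obtain ⟨h₃, h₄, h₅⟩ := run_balanceColor (k := k) (q := x) hd (h6.symm ▸ h₁) (by simp)
      rw [h6] at h₄
      refine ⟨h₃, ?_⟩
      rcases h₅ with ⟨h₅, h₆⟩ | ⟨h₅, h₆⟩
      · rw [h₆, show (s'.writeNat 8 0 x).nat 7 0 = s'.nat 7 0 by simp]
        refine h₂.imp_left fun h => ⟨h.1, fun q hq => ?_⟩
        rcases Nat.lt_succ_iff_lt_or_eq.1 hq with hq | rfl
        · intro j hj
          rw [count_congr (g := s'.nat 6) fun i _ hi => h₄ i (by omega)]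
          exact h.2 q hq j hj
        · exact h₅
      · exact Or.inr ⟨h₅, fun ⟨g, hg, hbal⟩ => h₆ ⟨g, hg, hbal x hx⟩⟩)
  rw [balanceAll, hrun]
  rw [hs.size] at hinv ⊢
  have h6 : (s₂.writeNat 8 0 (N 1)).nat 6 = s₂.nat 6 := by
    funext i
    simp
  rw [h6, show (s₂.writeNat 8 0 (N 1)).nat 7 0 = s₂.nat 7 0 by simp]
  exact ⟨hA₂, hinv⟩

theorem run_store (hN : s.nat 0 = N) :
    ((store k).run s).nat 4 0 = 1 ∧ ((store k).run s).real 4 0 = s.real 5 0 ∧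
    (∀ i < N 0, ((store k).run s).nat 5 i = s.nat 6 i) ∧
    ∀ j < k, (((store k).run s).real 2 j, ((store k).run s).real 3 j) = centerAt s.real j := by
  set s₁ := (s.writeNat 4 0 1).writeReal 4 0 (s.real 5 0) with hs₁
  set p : ℕ → CountProg := fun j => .seq (.setReal 2 (.const j) (.read (10 + 2 * j) (.const 0)))
        (.setReal 3 (.const j) (.read (11 + 2 * j) (.const 0))) with hp
  have hcopy := unroll_rule (s := s₁) (p := p) (k := k)
    (fun J s' => ∀ j < J, (s'.real 2 j, s'.real 3 j) = centerAt s.real j)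
    (fun _ h => absurd h (by omega))
    (by
      intro J hJ s' hf hinv j hj
      have hw : ∀ a, 10 ≤ a → s'.real a 0 = s.real a 0 := by
        intro a ha
        rw [hf.real a]
        · simp only [hs₁, State.writeReal_real, State.writeNat_real]
          rw [if_neg (by omega)]
        · simp only [hp, writesReal_unroll, WritesReal]
          rintro ⟨_, _, h⟩
          omega
      have h₁ := hw (10 + 2 * J) (by omega)
      have h₂ := hw (11 + 2 * J) (by omega)
      simp only [hp, run, RealExpr.eval, NatExpr.eval, State.writeReal_real]
      by_cases hjJ : j = J
      · subst hjJ
        simp only [and_true, if_true]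
        simp only [Nat.reduceEqDiff, if_false]
        rw [if_neg (by omega), h₁, h₂, centerAt]
      · simpa [hjJ] using hinv j (by omega))
  have hf := frame_run (unroll p k) s₁
  have hn : ((unroll p k).run s₁).nat = s₁.nat := by
    funext a
    refine hf.nat a ?_
    simp [hp, writesNat_unroll, WritesNat]
  have h4 : ((unroll p k).run s₁).real 4 = s₁.real 4 :=
    hf.real 4 (by simp [hp, writesReal_unroll, WritesReal])
  obtain ⟨s₂, hf₂, hinv, hrun⟩ := count_rule (v := 10) (b := 0)
    (p := .setNat 5 (cell 10) (.read 6 (cell 10))) (s := (unroll p k).run s₁)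
    (fun i s' => ∀ x < i, s'.nat 5 x = s.nat 6 x)
    (fun _ h => absurd h (by omega))
    (by
      intro i hi s' hf' hinv x hx
      have h6 : s'.nat 6 = s.nat 6 := by
        rw [hf'.nat 6 (by simp [WritesNat]), hn]
        funext x
        simp [hs₁]
      simp only [run, NatExpr.eval, State.writeNat_nat]
      by_cases hxi : x = i
      · subst hxi
        simp [h6]
      · simpa [hxi] using hinv x (by omega))
  have hsize : ((unroll p k).run s₁).nat 0 0 = N 0 := by
    rw [hn, ← hN]
    simp [hs₁]
  rw [hsize] at hinv hrun
  have hstore : (store k).run s = s₂.writeNat 10 0 (N 0) := by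
    rw [← hrun]
    rfl
  have hr₂ : s₂.real = ((unroll p k).run s₁).real := by
    funext a
    exact hf₂.real a (by simp [WritesReal])
  rw [hstore]
  refine ⟨?_, ?_, fun i hi => ?_, fun j hj => ?_⟩
  · simp only [State.writeNat_nat, Nat.reduceEqDiff, false_and, if_false,
      hf₂.nat 4 (by simp [WritesNat]), hn]
    simp [hs₁]
  · simp only [State.writeNat_real, hr₂, h4]
    simp [hs₁]
  · simpa using hinv i hi
  · simpa [hr₂] using hcopy j hj

end

theorem Data.IsInput.hasData (hs : D.IsInput s) :
    HasData D.size D.color D.lower D.upper s.real s :=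
  ⟨hs.size, hs.color, hs.lower, hs.upper, rfl⟩

/-- The output changes only when a verified clustering has a smaller radius than the stored one, or
none is stored. Either way a feasible current radius ends up reached. -/
theorem run_testCenters (hs : D.IsInput s) (hsound : D.Sound k s) (hr : 0 ≤ s.real 5 0) :
    D.Searched k (fun r => r = s.real 5 0 ∧ D.Feasible k (centerAt s.real) r) s
      ((testCenters k).run s) := by
  have hd := hs.hasData
  have hnear : (fun i j => sqDist (D.point i) (centerAt s.real j) ≤ s.real 5 0 * s.real 5 0) =
      Near s.real := by
    funext i j
    rw [Near, hs.point]
  obtain ⟨s₂, hs₂, hrun, hd₂, hok⟩ : ∃ s₂, (testCenters k).run s =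
      (CountProg.ite (.and (.natLe (.const 1) (cell 7)) (.not (.and (.natLe (.const 1) (cell 4))
      (.realLe (.read 4 (.const 0)) (.read 5 (.const 0)))))) (store k) .skip).run s₂ ∧
      (s₂.nat 4 = s.nat 4 ∧ s₂.nat 5 = s.nat 5) ∧
      HasData D.size D.color D.lower D.upper s.real s₂ ∧
      ((s₂.nat 7 0 = 1 ∧ Admissible D.n k (Near s.real) (s₂.nat 6) ∧ D.Fair k (s₂.nat 6)) ∨
        (s₂.nat 7 0 = 0 ∧ ¬ D.Feasible k (centerAt s.real) (s.real 5 0))) := by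
    have hf₁ := frame_run (firstAssignment k) s
    have hd₁ : HasData D.size D.color D.lower D.upper s.real ((firstAssignment k).run s) := by
      refine hd.frame hf₁ (fun a ha h => ?_) fun a => writesReal_firstAssignment
      have := writesNat_firstAssignment h
      omega
    have hout₁ : ∀ a, a = 4 ∨ a = 5 → ((firstAssignment k).run s).nat a = s.nat a := by
      refine fun a ha => hf₁.nat a fun h => ?_
      have := writesNat_firstAssignment h
      omega
    rw [testCenters, run, run]
    refine ⟨_, rfl, ?_⟩
    rcases run_firstAssignment (k := k) hd with ⟨h₁, h₂⟩ | ⟨h₁, h₂⟩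
    · rw [run, if_neg (by simp [Test.Holds, NatExpr.eval, h₁]), run]
      refine ⟨⟨hout₁ 4 (by simp), hout₁ 5 (by simp)⟩, hd₁, Or.inr ⟨h₁, ?_⟩⟩
      rintro ⟨g, hg, -⟩
      exact h₂ ⟨g, hnear ▸ hg⟩
    · rw [run, if_pos (by simp [Test.Holds, NatExpr.eval, h₁])]
      have hf₂ := frame_run (balanceAll k) ((firstAssignment k).run s)
      have hout₂ : ∀ a, a = 4 ∨ a = 5 →
          ((balanceAll k).run ((firstAssignment k).run s)).nat a = s.nat a := by
        intro a ha
        rw [hf₂.nat a fun h => ?_, hout₁ a ha]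
        have := writesNat_balanceAll h
        omega
      refine ⟨⟨hout₂ 4 (by simp), hout₂ 5 (by simp)⟩, hd₁.frame hf₂ (fun a ha h => ?_)
        fun a => writesReal_balanceAll, ?_⟩
      · have := writesNat_balanceAll h
        omega
      · obtain ⟨h₃, h₄⟩ := run_balanceAll hd₁ h₂ h₁
        refine h₄.imp (fun h => ⟨h.1, h₃, h.2⟩) fun h => ⟨h.1, ?_⟩
        rintro ⟨g, hg, hfair⟩
        exact h.2 ⟨g, hnear ▸ hg, hfair⟩
  rw [hs₂]
  have hsound₂ : D.Sound k s₂ := hsound.congr hrun.1 hrun.2 (by rw [hd₂.real]) (by rw [hd₂.real])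
    (by rw [hd₂.real])
  have hreach₂ : ∀ r, Reached r s → Reached r s₂ := fun r =>
    (reached_congr hrun.1 (by rw [hd₂.real])).2
  rw [run]
  split_ifs with htest
  · obtain ⟨ht₁, ht₂⟩ := htest
    simp only [Test.Holds, NatExpr.eval, RealExpr.eval, not_and, not_le, hd₂.real] at ht₁ ht₂
    rcases hok with ⟨-, hA, hfair⟩ | ⟨h, -⟩
    · obtain ⟨h₁, h₂, h₃, h₄⟩ := run_store (k := k) hd₂.size
      rw [hd₂.real] at h₂ h₄
      refine ⟨Or.inr ⟨h₁, h₂ ▸ hr, fun q hq j hj => ?_, fun i hi => ?_⟩, fun r h => ?_, ?_⟩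
      · rw [count_congr (fun i hi _ => h₃ i hi) j]
        exact hfair q hq j hj
      · have := hA i hi
        rw [← hnear] at this
        rw [h₃ i hi, h₂]
        refine ⟨this.1, ?_⟩
        beta_reduce
        rw [h₄ _ this.1]
        exact this.2
      · have h := hreach₂ r h
        refine ⟨h₁, ?_⟩
        rw [h₂]
        have h' := ht₂ h.1.ge
        have h'' := h.2
        rw [hd₂.real] at h''
        linarith
      · rintro r ⟨rfl, -⟩
        exact ⟨h₁, h₂.le⟩
    · omega
  · rw [run]
    refine ⟨hsound₂, hreach₂, ?_⟩
    rintro r ⟨rfl, hfeas⟩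
    rcases hok with ⟨h7, -⟩ | ⟨-, h⟩
    · simp only [Test.Holds, NatExpr.eval, RealExpr.eval, h7, le_refl, true_and, not_not,
        hd₂.real] at htest
      rcases hsound₂ with h | h
      · omega
      · exact ⟨h.1, by rw [hd₂.real]; exact htest.2⟩
    · exact absurd hfeas h

end FairClustering

/-! ### Enumeration of the candidate centers as a program. -/

namespace FairClustering

open RealRAM CountProg

/-! ### Points computed by expressions -/

/-- The squared distance of two computed points. -/
def sqDistExpr (e f : RealExpr × RealExpr) : RealExpr :=
  .add (.mul (.sub e.1 f.1) (.sub e.1 f.1)) (.mul (.sub e.2 f.2) (.sub e.2 f.2))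

/-- The point whose index is in cell `0` of the array `a`. -/
def pointExpr (a : ℕ) : RealExpr × RealExpr := (.read 0 (cell a), .read 1 (cell a))

/-- The current center `j`. -/
def centerExpr (j : ℕ) : RealExpr × RealExpr :=
  (.read (10 + 2 * j) (.const 0), .read (11 + 2 * j) (.const 0))

/-- The number two. -/
def twoExpr : RealExpr := .add .one .one

/-- See `middle`. -/
def middleExpr (e f : RealExpr × RealExpr) : RealExpr × RealExpr :=
  (.div (.add e.1 f.1) twoExpr, .div (.add e.2 f.2) twoExpr)

/-- See `circumcenter`. -/
def circumcenterExpr (a b e : RealExpr × RealExpr) : RealExpr × RealExpr :=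
  let d : RealExpr := .mul twoExpr
    (.sub (.mul (.sub b.1 a.1) (.sub e.2 a.2)) (.mul (.sub b.2 a.2) (.sub e.1 a.1)))
  (.add a.1 (.div (.sub (.mul (.sub e.2 a.2) (sqDistExpr a b))
      (.mul (.sub b.2 a.2) (sqDistExpr a e))) d),
    .add a.2 (.div (.sub (.mul (.sub b.1 a.1) (sqDistExpr a e))
      (.mul (.sub e.1 a.1) (sqDistExpr a b))) d))

/-- See `leftmost`. -/
def leftmostExpr (r : RealExpr) (a : RealExpr × RealExpr) : RealExpr × RealExpr :=
  (.sub a.1 r, a.2)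

/-- See `crossing`. -/
def crossingExpr (r : RealExpr) (a b : RealExpr × RealExpr) : RealExpr × RealExpr :=
  let t : RealExpr := .sqrt (.div
    (.sub (.mul r r) (.div (sqDistExpr a b) (.mul twoExpr twoExpr))) (sqDistExpr a b))
  (.sub (.div (.add a.1 b.1) twoExpr) (.mul t (.sub b.2 a.2)),
    .add (.div (.add a.2 b.2) twoExpr) (.mul t (.sub b.1 a.1)))

/-- The value of a pair of expressions. -/
noncomputable def evalPoint (s : State) (e : RealExpr × RealExpr) : ℝ × ℝ :=
  (e.1.eval s, e.2.eval s)

variable {s s' : State}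

theorem eval_sqDistExpr (e f : RealExpr × RealExpr) :
    (sqDistExpr e f).eval s = sqDist (evalPoint s e) (evalPoint s f) := rfl

theorem evalPoint_pointExpr (a : ℕ) :
    evalPoint s (pointExpr a) = pointAt s.real (s.nat a 0) := rfl

theorem evalPoint_centerExpr (j : ℕ) : evalPoint s (centerExpr j) = centerAt s.real j := rfl

theorem eval_twoExpr : twoExpr.eval s = 2 := by
  simp only [twoExpr, RealExpr.eval]
  norm_num

theorem evalPoint_middleExpr (e f : RealExpr × RealExpr) :
    evalPoint s (middleExpr e f) = middle (evalPoint s e) (evalPoint s f) := by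
  simp only [evalPoint, middleExpr, RealExpr.eval, eval_twoExpr, middle]

theorem evalPoint_circumcenterExpr (a b e : RealExpr × RealExpr) :
    evalPoint s (circumcenterExpr a b e) =
      circumcenter (evalPoint s a) (evalPoint s b) (evalPoint s e) := by
  simp only [evalPoint, circumcenterExpr, RealExpr.eval, eval_twoExpr, circumcenter,
    eval_sqDistExpr]

theorem evalPoint_leftmostExpr (r : RealExpr) (a : RealExpr × RealExpr) :
    evalPoint s (leftmostExpr r a) = leftmost (r.eval s) (evalPoint s a) := rfl

theorem evalPoint_crossingExpr (r : RealExpr) (a b : RealExpr × RealExpr) :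
    evalPoint s (crossingExpr r a b) =
      crossing (r.eval s) (evalPoint s a) (evalPoint s b) := by
  simp only [evalPoint, crossingExpr, RealExpr.eval, eval_twoExpr, crossing, eval_sqDistExpr]
  norm_num

/-- Set the center `j`. -/
def setCenter (j : ℕ) (e : RealExpr × RealExpr) : CountProg :=
  .seq (.setReal (10 + 2 * j) (.const 0) e.1) (.setReal (11 + 2 * j) (.const 0) e.2)

theorem writesReal_setCenter {j a : ℕ} {e : RealExpr × RealExpr} :
    (setCenter j e).WritesReal a ↔ a = 10 + 2 * j ∨ a = 11 + 2 * j := Iff.rfl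

theorem run_setCenter_nat (j : ℕ) (e : RealExpr × RealExpr) :
    ((setCenter j e).run s).nat = s.nat := rfl

/-- Setting a center to a point that does not depend on the centers. -/
theorem centerAt_setCenter {j : ℕ} {e : RealExpr × RealExpr} {c : ℝ × ℝ}
    (he : ∀ s' : State, s'.nat = s.nat → (∀ a < 10, s'.real a = s.real a) → evalPoint s' e = c) :
    centerAt ((setCenter j e).run s).real j = c := by
  have h₁ := he s rfl fun _ _ => rfl
  -- The second coordinate is evaluated after the first has been overwritten, which is why the
  -- expression may depend only on real arrays below `10`.
  have h₂ := he (s.writeReal (10 + 2 * j) 0 (e.1.eval s)) rfl fun a ha => by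
    funext i
    simp only [State.writeReal_real]
    rw [if_neg (by omega)]
  simp only [centerAt, setCenter, run, NatExpr.eval, State.writeReal_real, and_true, if_true]
  rw [if_neg (by omega)]
  exact Prod.ext (show e.1.eval s = c.1 from congrArg Prod.fst h₁)
    (show e.2.eval _ = c.2 from congrArg Prod.snd h₂)

/-! ### Enumerating configurations -/

/-- Try all positions for the centers `0, …, j - 1`. -/
def searchCenters (k : ℕ) : ℕ → CountProg
  | 0 => testCenters k
  | j + 1 => .count (21 + 3 * j) 0 (.count (22 + 3 * j) 0 (.seq
      (.seq (setCenter j (leftmostExpr (.read 5 (.const 0)) (pointExpr (21 + 3 * j))))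
        (searchCenters k j))
      (.seq (setCenter j (crossingExpr (.read 5 (.const 0)) (pointExpr (21 + 3 * j))
        (pointExpr (22 + 3 * j)))) (searchCenters k j))))

/-- Try the given point as the center of the largest cluster. -/
def searchFrom (k : ℕ) (e : RealExpr × RealExpr) : CountProg :=
  .seq (setCenter (k - 1) e)
    (.seq (.setReal 5 (.const 0) (.sqrt (sqDistExpr (pointExpr 11) (centerExpr (k - 1)))))
      (searchCenters k (k - 1)))

/-- The search for an optimal fair clustering. -/
def search (k : ℕ) : CountProg :=
  .count 11 0 (.count 12 0 (.count 13 0 (.seq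
    (searchFrom k (middleExpr (pointExpr 11) (pointExpr 12)))
    (searchFrom k (circumcenterExpr (pointExpr 11) (pointExpr 12) (pointExpr 13))))))

variable {D : Data} {k : ℕ}

/-- Counters of levels from `j` on must survive the recursion: the bound excludes them from the
inner counters, and the residue modulo 3 from the tables of movable points. -/
theorem writesNat_searchCenters {j a : ℕ} (h : (searchCenters k j).WritesNat a) :
    4 ≤ a ∧ (a < 20 + 3 * j ∨ a % 3 = 2) ∧ a ≠ 11 ∧ a ≠ 12 ∧ a ≠ 13 := by
  induction j with
  | zero =>
    have := writesNat_testCenters h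
    omega
  | succ j ih =>
    simp only [searchCenters, WritesNat, setCenter, false_or] at h
    rcases h with h | h | h | h
    · omega
    · omega
    · have := ih h
      omega
    · have := ih h
      omega

theorem writesReal_searchCenters {j a : ℕ} (h : (searchCenters k j).WritesReal a) :
    a = 2 ∨ a = 3 ∨ a = 4 ∨ (10 ≤ a ∧ a < 10 + 2 * j) := by
  induction j with
  | zero =>
    have := writesReal_testCenters h
    omega
  | succ j ih =>
    simp only [searchCenters, WritesReal, writesReal_setCenter] at h
    rcases h with (h | h) | h | h
    · omega
    · have := ih h
      omega
    · omega
    · have := ih h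
      omega

/-- A position for a center that has to be tried for the radius `r`. -/
def Data.IsCorner (D : Data) (r : ℝ) (c : ℝ × ℝ) : Prop :=
  ∃ a < D.n, ∃ b < D.n, c = leftmost r (D.point a) ∨ c = crossing r (D.point a) (D.point b)

/-- The centers `0, …, j - 1` can be put in positions to be tried so that there is a fair
clustering of radius `r`, where the other centers are given by `c`. -/
def Data.Extends (D : Data) (k j : ℕ) (c : ℕ → ℝ × ℝ) (r : ℝ) : Prop :=
  ∃ c', (∀ i < j, D.IsCorner r (c' i)) ∧ (∀ i, j ≤ i → c' i = c i) ∧ D.Feasible k c' r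

theorem Data.Searched.mono_set {X Y : ℝ → Prop} (h : D.Searched k X s s') (hXY : ∀ r, Y r → X r) :
    D.Searched k Y s s' :=
  ⟨h.sound, h.mono, fun r hr => h.reached r (hXY r hr)⟩

theorem Data.Searched.of_output {X : ℝ → Prop} {s₁ : State} (h : D.Searched k X s₁ s')
    (hn : s₁.nat = s.nat) (hr : s₁.real 4 = s.real 4) : D.Searched k X s s' :=
  ⟨h.sound, fun r h' => h.mono r ((reached_congr (by rw [hn]) hr).2 h'), h.reached⟩

theorem Data.IsInput.setCenter (hs : D.IsInput s) (j : ℕ) (e : RealExpr × RealExpr) :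
    D.IsInput ((setCenter j e).run s) :=
  hs.frame (frame_run _ s) (fun _ _ h => h.elim id id) fun a ha h => by
    rw [writesReal_setCenter] at h
    omega

theorem real_setCenter {j a : ℕ} {e : RealExpr × RealExpr} (h₁ : a ≠ 10 + 2 * j)
    (h₂ : a ≠ 11 + 2 * j) : ((setCenter j e).run s).real a = s.real a :=
  (frame_run (setCenter j e) s).real a fun h => by
    rw [writesReal_setCenter] at h
    omega

theorem centerAt_setCenter_of_ne {j i : ℕ} {e : RealExpr × RealExpr} (h : i ≠ j) :
    centerAt ((setCenter j e).run s).real i = centerAt s.real i := by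
  rw [centerAt, centerAt, real_setCenter (by omega) (by omega),
    real_setCenter (by omega) (by omega)]

theorem Data.Sound.setCenter (h : D.Sound k s) (j : ℕ) (e : RealExpr × RealExpr) :
    D.Sound k ((setCenter j e).run s) :=
  h.congr rfl rfl (real_setCenter (by omega) (by omega)) (real_setCenter (by omega) (by omega))
    (real_setCenter (by omega) (by omega))

/-- The recursion fixes the center `j` and leaves the lower ones to the inner call, so an extension
by `j + 1` corners splits into its corner at `j` and an extension by `j` corners. -/
theorem run_searchCenters (j : ℕ) : ∀ s : State, D.IsInput s → D.Sound k s → 0 ≤ s.real 5 0 →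
    D.Searched k (fun r => r = s.real 5 0 ∧ D.Extends k j (centerAt s.real) r) s
      ((searchCenters k j).run s) := by
  induction j with
  | zero =>
    intro s hs hsound hr
    refine (run_testCenters hs hsound hr).mono_set ?_
    rintro r ⟨h₁, c', -, h₂, h₃⟩
    obtain rfl : c' = centerAt s.real := funext fun i => h₂ i (Nat.zero_le _)
    exact ⟨h₁, h₃⟩
  | succ j ih =>
    intro s hs hsound hr
    have hw : ∀ a, (searchCenters k (j + 1)).WritesNat a →
        4 ≤ a ∧ (a < 20 + 3 * (j + 1) ∨ a % 3 = 2) ∧ a ≠ 11 ∧ a ≠ 12 ∧ a ≠ 13 :=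
      fun a => writesNat_searchCenters
    have hwr : ∀ a, (searchCenters k (j + 1)).WritesReal a →
        a = 2 ∨ a = 3 ∨ a = 4 ∨ (10 ≤ a ∧ a < 10 + 2 * (j + 1)) :=
      fun a => writesReal_searchCenters
    -- The result of one placement refers only to the centers above `j`, so leftovers of earlier
    -- inner searches in the lower ones are harmless.
    have hplace : ∀ (t : State) (e : RealExpr × RealExpr) (c : ℝ × ℝ), D.IsInput t →
        D.Sound k t → t.real 5 0 = s.real 5 0 →
        (∀ i, j < i → centerAt t.real i = centerAt s.real i) →
        (∀ t' : State, t'.nat = t.nat → (∀ a < 10, t'.real a = t.real a) → evalPoint t' e = c) →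
        D.Searched k (fun r => r = s.real 5 0 ∧
          D.Extends k j (Function.update (centerAt s.real) j c) r) t
          ((searchCenters k j).run ((setCenter j e).run t)) := by
      intro t e c ht htsound ht5 htc he
      have h5 : ((setCenter j e).run t).real 5 0 = s.real 5 0 := by
        rw [real_setCenter (by omega) (by omega), ht5]
      have h := ih _ (ht.setCenter j e) (htsound.setCenter j e) (h5 ▸ hr)
      rw [h5] at h
      refine (h.of_output (s := t) rfl (real_setCenter (by omega) (by omega))).mono_set ?_
      rintro r ⟨h₁, c', h₂, h₃, h₄⟩
      refine ⟨h₁, c', h₂, fun i hi => ?_, h₄⟩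
      rw [h₃ i hi]
      by_cases hij : i = j
      · subst hij
        rw [Function.update_self, centerAt_setCenter he]
      · rw [Function.update_of_ne hij, centerAt_setCenter_of_ne hij, htc i (by omega)]
    have hbody : ∀ t : State, D.IsInput t → D.Sound k t → t.real 5 0 = s.real 5 0 →
        (∀ i, j < i → centerAt t.real i = centerAt s.real i) →
        D.Searched k (fun r => (r = s.real 5 0 ∧ D.Extends k j (Function.update (centerAt s.real) j
            (leftmost (s.real 5 0) (D.point (t.nat (21 + 3 * j) 0)))) r) ∨
          (r = s.real 5 0 ∧ D.Extends k j (Function.update (centerAt s.real) j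
            (crossing (s.real 5 0) (D.point (t.nat (21 + 3 * j) 0))
              (D.point (t.nat (22 + 3 * j) 0)))) r)) t
          (CountProg.run (.seq
            (.seq (setCenter j (leftmostExpr (.read 5 (.const 0)) (pointExpr (21 + 3 * j))))
              (searchCenters k j))
            (.seq (setCenter j (crossingExpr (.read 5 (.const 0)) (pointExpr (21 + 3 * j))
              (pointExpr (22 + 3 * j)))) (searchCenters k j))) t) := by
      intro t ht htsound ht5 htc
      have hpt : ∀ (t' : State) (a : ℕ), t'.nat = t.nat → (∀ a < 10, t'.real a = t.real a) →
          evalPoint t' (pointExpr a) = D.point (t.nat a 0) := by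
        intro t' a h₁ h₂
        rw [evalPoint_pointExpr, h₁, ← ht.point, pointAt, pointAt, h₂ 0 (by omega),
          h₂ 1 (by omega)]
      have h₁ := hplace t (leftmostExpr (.read 5 (.const 0)) (pointExpr (21 + 3 * j))) _
        ht htsound ht5 htc (fun t' hn hr => by
          rw [evalPoint_leftmostExpr, hpt t' _ hn hr, RealExpr.eval, NatExpr.eval,
            hr 5 (by omega), ht5])
      rw [run, run, run]
      set t₁ := (searchCenters k j).run
        ((setCenter j (leftmostExpr (.read 5 (.const 0)) (pointExpr (21 + 3 * j)))).run t) with ht₁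
      have hn₁ : ∀ a, ¬ (searchCenters k j).WritesNat a → t₁.nat a = t.nat a := fun a ha => by
        rw [ht₁, (frame_run (searchCenters k j) _).nat a ha, run_setCenter_nat]
      have hr₁ : ∀ a, ¬ (searchCenters k j).WritesReal a → a ≠ 10 + 2 * j → a ≠ 11 + 2 * j →
          t₁.real a = t.real a := fun a ha h₁ h₂ => by
        rw [ht₁, (frame_run (searchCenters k j) _).real a ha, real_setCenter h₁ h₂]
      have hin₁ : D.IsInput t₁ := by
        refine (ht.setCenter j _).frame (frame_run (searchCenters k j) _) (fun a ha h => ?_)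
          fun a ha h => ?_
        · have := writesNat_searchCenters h
          omega
        · have := writesReal_searchCenters h
          omega
      have hr₁' : ∀ a, 5 ≤ a → a < 10 ∨ 12 + 2 * j ≤ a → t₁.real a = t.real a := by
        refine fun a ha ha' => hr₁ a (fun h => ?_) (by omega) (by omega)
        have := writesReal_searchCenters h
        omega
      have hn₁' : ∀ a, a = 21 + 3 * j ∨ a = 22 + 3 * j → t₁.nat a = t.nat a := by
        refine fun a ha => hn₁ a fun h => ?_
        have := writesNat_searchCenters h
        omega
      have hpt₁ : ∀ (t' : State) (a : ℕ), a = 21 + 3 * j ∨ a = 22 + 3 * j → t'.nat = t₁.nat →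
          (∀ a < 10, t'.real a = t₁.real a) →
          evalPoint t' (pointExpr a) = D.point (t.nat a 0) := by
        intro t' a ha h₁ h₂
        rw [evalPoint_pointExpr, h₁, hn₁' a ha, ← hin₁.point, pointAt, pointAt, h₂ 0 (by omega),
          h₂ 1 (by omega)]
      have h₂ := hplace t₁ (crossingExpr (.read 5 (.const 0)) (pointExpr (21 + 3 * j))
        (pointExpr (22 + 3 * j))) _ hin₁ h₁.sound (by rw [hr₁' 5 (by omega) (by omega), ht5])
        (fun i hi => by
          rw [← htc i hi, centerAt, centerAt, hr₁' _ (by omega) (by omega),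
            hr₁' _ (by omega) (by omega)])
        (fun t' hn hr => by
          rw [evalPoint_crossingExpr, hpt₁ t' _ (Or.inl rfl) hn hr,
            hpt₁ t' _ (Or.inr rfl) hn hr, RealExpr.eval, NatExpr.eval,
            hr 5 (by omega), hr₁' 5 (by omega) (by omega), ht5])
      exact h₁.trans h₂
    -- Throughout both loops the input, the radius and the centers above `j` are unchanged.
    have hinv : ∀ t, Frame (searchCenters k (j + 1)) s t → D.IsInput t ∧
        t.real 5 0 = s.real 5 0 ∧ ∀ i, j < i → centerAt t.real i = centerAt s.real i := by
      intro t hf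
      have hr : ∀ a, 5 ≤ a → a < 10 ∨ 12 + 2 * j ≤ a → t.real a = s.real a := by
        refine fun a ha ha' => hf.real a fun h => ?_
        have := hwr a h
        omega
      refine ⟨hs.frame hf (fun a ha h => ?_) (fun a ha h => ?_), ?_, fun i hi => ?_⟩
      · have := hw a h
        omega
      · have := hwr a h
        omega
      · rw [hr 5 (by omega) (by omega)]
      · rw [centerAt, centerAt, hr _ (by omega) (by omega), hr _ (by omega) (by omega)]
    have houter := searched_count (k := k) (v := 21 + 3 * j)
      (X := fun a r => ∃ b < D.n, (r = s.real 5 0 ∧ D.Extends k j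
          (Function.update (centerAt s.real) j (leftmost (s.real 5 0) (D.point a))) r) ∨
        (r = s.real 5 0 ∧ D.Extends k j (Function.update (centerAt s.real) j
          (crossing (s.real 5 0) (D.point a) (D.point b))) r))
      hs hsound (by omega) (by omega)
      (fun a ha t hf htsound => by
        have hts : D.Sound k (t.writeNat (21 + 3 * j) 0 a) :=
          htsound.writeNat (by omega) (by omega) _ _
        refine searched_count ((hinv t hf).1.writeNat (by omega) _ _) hts (by omega)
          (by omega) fun b hb t' hf' ht'sound => ?_
        have hf'' : Frame (searchCenters k (j + 1)) s t' := by
          refine ⟨fun c hc => ?_, fun c hc => ?_⟩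
          · rw [← hf.nat c hc, hf'.nat c fun h => hc (Or.inr h)]
            funext x
            simp only [State.writeNat_nat]
            rw [if_neg]
            rintro ⟨rfl, -⟩
            exact hc (Or.inl rfl)
          · rw [← hf.real c hc, hf'.real c hc, State.writeNat_real]
        obtain ⟨h₁, h₂, h₃⟩ := hinv t' hf''
        have h := hbody (t'.writeNat (22 + 3 * j) 0 b) (h₁.writeNat (by omega) _ _)
          (ht'sound.writeNat (by omega) (by omega) _ _) h₂ h₃
        have ha' : (t'.writeNat (22 + 3 * j) 0 b).nat (21 + 3 * j) 0 = a := by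
          rw [State.writeNat_nat, if_neg (by omega), hf'.nat (21 + 3 * j)]
          · simp
          · simp only [WritesNat, setCenter, false_or, not_or]
            refine ⟨by omega, fun h => ?_, fun h => ?_⟩ <;>
            · have := writesNat_searchCenters h
              omega
        rw [ha', show (t'.writeNat (22 + 3 * j) 0 b).nat (22 + 3 * j) 0 = b by simp] at h
        exact h)
    refine Data.Searched.mono_set houter ?_
    rintro r ⟨rfl, c', h₁, h₂, h₃⟩
    obtain ⟨a, ha, b, hb, hc⟩ := h₁ j (by omega)
    have hext : D.Extends k j (Function.update (centerAt s.real) j (c' j)) (s.real 5 0) := by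
      refine ⟨c', fun i hi => h₁ i (by omega), fun i hi => ?_, h₃⟩
      by_cases hij : i = j
      · rw [hij, Function.update_self]
      · rw [Function.update_of_ne hij, h₂ i (by omega)]
    refine ⟨a, ha, b, hb, ?_⟩
    rcases hc with hc | hc
    · exact Or.inl ⟨rfl, hc ▸ hext⟩
    · exact Or.inr ⟨rfl, hc ▸ hext⟩

theorem writesReal_searchFrom {a : ℕ} {e : RealExpr × RealExpr}
    (h : (searchFrom k e).WritesReal a) : 2 ≤ a := by
  simp only [searchFrom, WritesReal, writesReal_setCenter] at h
  rcases h with h | h | h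
  · omega
  · omega
  · have := writesReal_searchCenters h
    omega

theorem writesNat_searchFrom {a : ℕ} {e : RealExpr × RealExpr}
    (h : (searchFrom k e).WritesNat a) : 4 ≤ a ∧ a ≠ 11 ∧ a ≠ 12 ∧ a ≠ 13 := by
  simp only [searchFrom, WritesNat, setCenter, false_or] at h
  have := writesNat_searchCenters h
  omega

/-- The radius `r` belongs to a configuration in which `c` is the center of a largest cluster with
a point `a` on its boundary. -/
def Data.IsCandidate (D : Data) (k : ℕ) (a c : ℝ × ℝ) (r : ℝ) : Prop :=
  r = Real.sqrt (sqDist a c) ∧ D.Extends k (k - 1) (fun _ => c) r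

theorem Data.Feasible.congr {c c' : ℕ → ℝ × ℝ} {r : ℝ} (h : D.Feasible k c r)
    (hc : ∀ j < k, c' j = c j) : D.Feasible k c' r := by
  obtain ⟨g, hg, hfair⟩ := h
  refine ⟨g, fun i hi => ⟨(hg i hi).1, ?_⟩, hfair⟩
  beta_reduce
  rw [hc _ (hg i hi).1]
  exact (hg i hi).2

theorem run_searchFrom {e : RealExpr × RealExpr} {c : ℝ × ℝ} (hs : D.IsInput s)
    (hsound : D.Sound k s)
    (he : ∀ s' : State, s'.nat = s.nat → (∀ a < 10, s'.real a = s.real a) → evalPoint s' e = c) :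
    D.Searched k (D.IsCandidate k (D.point (s.nat 11 0)) c) s ((searchFrom k e).run s) := by
  rw [searchFrom, run, run]
  set s₁ := (setCenter (k - 1) e).run s with hs₁
  have hc : centerAt s₁.real (k - 1) = c := centerAt_setCenter he
  set s₂ := (CountProg.setReal 5 (.const 0)
    (.sqrt (sqDistExpr (pointExpr 11) (centerExpr (k - 1))))).run s₁ with hs₂
  have hin₁ : D.IsInput s₁ := hs.setCenter _ _
  have hin₂ : D.IsInput s₂ := hin₁.frame (frame_run _ _) (fun _ _ => id) fun a ha => by
    simp only [WritesReal]
    omega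
  have hr₂ : ∀ a, a ≠ 5 → s₂.real a = s₁.real a := fun a ha => by
    funext i
    simp [hs₂, run, ha]
  have hsound₂ : D.Sound k s₂ := (hsound.setCenter (k - 1) e).congr rfl rfl (hr₂ 2 (by omega))
    (hr₂ 3 (by omega)) (hr₂ 4 (by omega))
  have hc₂ : centerAt s₂.real (k - 1) = c := by
    rw [centerAt, hr₂ _ (by omega), hr₂ _ (by omega)]
    exact hc
  have h5 : s₂.real 5 0 = Real.sqrt (sqDist (D.point (s.nat 11 0)) c) := by
    simp only [hs₂, run, NatExpr.eval, RealExpr.eval, State.writeReal_real, and_self, if_true,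
      eval_sqDistExpr, evalPoint_pointExpr, evalPoint_centerExpr, hc, hin₁.point]
    rfl
  have h := run_searchCenters (k := k) (k - 1) s₂ hin₂ hsound₂ (h5 ▸ Real.sqrt_nonneg _)
  refine (h.of_output (s := s) rfl ?_).mono_set ?_
  · rw [hr₂ 4 (by omega)]
    exact real_setCenter (by omega) (by omega)
  · rintro r ⟨h₁, c', h₂, h₃, h₄⟩
    -- Cells for centers of index `k` or more hold arbitrary values, so the witness copies them;
    -- feasibility involves only indices below `k`.
    refine ⟨h₁.trans h5.symm, fun i => if i < k - 1 then c' i else centerAt s₂.real i,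
      fun i hi => ?_, fun i hi => ?_, h₄.congr fun j hj => ?_⟩
    · beta_reduce
      rw [if_pos hi]
      exact h₂ i hi
    · beta_reduce
      rw [if_neg (by omega)]
    · split_ifs with hjk
      · rfl
      · obtain rfl : j = k - 1 := by omega
        rw [hc₂, h₃ _ le_rfl]

/-- The search reaches every candidate radius. -/
theorem run_search (hs : D.IsInput s) (hsound : D.Sound k s) :
    D.Searched k (fun r => ∃ a < D.n, ∃ b < D.n, ∃ e < D.n,
      D.IsCandidate k (D.point a) (middle (D.point a) (D.point b)) r ∨
      D.IsCandidate k (D.point a) (circumcenter (D.point a) (D.point b) (D.point e)) r) s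
      ((search k).run s) := by
  have hbody : ∀ t : State, D.IsInput t → D.Sound k t → D.Searched k (fun r =>
      D.IsCandidate k (D.point (t.nat 11 0))
        (middle (D.point (t.nat 11 0)) (D.point (t.nat 12 0))) r ∨
      D.IsCandidate k (D.point (t.nat 11 0)) (circumcenter (D.point (t.nat 11 0))
        (D.point (t.nat 12 0)) (D.point (t.nat 13 0))) r) t
      (CountProg.run (.seq (searchFrom k (middleExpr (pointExpr 11) (pointExpr 12)))
        (searchFrom k (circumcenterExpr (pointExpr 11) (pointExpr 12) (pointExpr 13)))) t) := by
    intro t ht htsound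
    have hpt : ∀ (t t' : State) (a : ℕ), D.IsInput t → t'.nat = t.nat →
        (∀ a < 10, t'.real a = t.real a) →
        evalPoint t' (pointExpr a) = D.point (t.nat a 0) := by
      intro t t' a ht h₁ h₂
      rw [evalPoint_pointExpr, h₁, ← ht.point, pointAt, pointAt, h₂ 0 (by omega),
        h₂ 1 (by omega)]
    have h₁ := run_searchFrom (e := middleExpr (pointExpr 11) (pointExpr 12)) ht htsound
      (fun t' hn hr => by
        rw [evalPoint_middleExpr, hpt t t' _ ht hn hr, hpt t t' _ ht hn hr])
    rw [run]
    set t₁ := (searchFrom k (middleExpr (pointExpr 11) (pointExpr 12))).run t with ht₁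
    have hf : Frame _ t t₁ := frame_run _ t
    have hin₁ : D.IsInput t₁ := ht.frame hf (fun a ha h => by
        have := writesNat_searchFrom h
        omega) (fun a ha h => by
        have := writesReal_searchFrom h
        omega)
    have hn₁ : ∀ a, a = 11 ∨ a = 12 ∨ a = 13 → t₁.nat a = t.nat a := fun a ha =>
      hf.nat a fun h => by
        have := writesNat_searchFrom h
        omega
    have h₂ := run_searchFrom
      (e := circumcenterExpr (pointExpr 11) (pointExpr 12) (pointExpr 13)) hin₁ h₁.sound
      (fun t' hn hr => by
        rw [evalPoint_circumcenterExpr, hpt t₁ t' _ hin₁ hn hr, hpt t₁ t' _ hin₁ hn hr,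
          hpt t₁ t' _ hin₁ hn hr])
    rw [hn₁ 11 (by simp), hn₁ 12 (by simp), hn₁ 13 (by simp)] at h₂
    exact h₁.trans h₂
  have hw : ∀ a, a ≠ 11 → a ≠ 12 → a ≠ 13 → a < 4 → ¬ (search k).WritesNat a := by
    intro a h₁ h₂ h₃ h₄ h
    rcases h with h | h | h | h | h
    · omega
    · omega
    · omega
    · have := writesNat_searchFrom h
      omega
    · have := writesNat_searchFrom h
      omega
  have hinput : ∀ t, Frame (search k) s t → D.IsInput t := by
    refine fun t hf => hs.frame hf (fun a ha => hw a (by omega) (by omega) (by omega) ha)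
      fun a ha h => ?_
    rcases h with h | h
    · have := writesReal_searchFrom h
      omega
    · have := writesReal_searchFrom h
      omega
  have hcell : ∀ a, a = 11 ∨ a = 12 ∨ a = 13 → ¬ (CountProg.seq
      (searchFrom k (middleExpr (pointExpr 11) (pointExpr 12)))
      (searchFrom k (circumcenterExpr (pointExpr 11) (pointExpr 12)
        (pointExpr 13)))).WritesNat a := by
    intro a ha h
    rcases h with h | h
    · have := writesNat_searchFrom h
      omega
    · have := writesNat_searchFrom h
      omega
  have hlift : ∀ {v i : ℕ} {p : CountProg} {t t' : State}, Frame (.count v 0 p) s t →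
      Frame p (t.writeNat v 0 i) t' → Frame (.count v 0 p) s t' := by
    intro v i p t t' hf hf'
    refine ⟨fun c hc => ?_, fun c hc => ?_⟩
    · rw [← hf.nat c hc, hf'.nat c fun h => hc (Or.inr h)]
      funext x
      rw [State.writeNat_nat, if_neg]
      rintro ⟨rfl, -⟩
      exact hc (Or.inl rfl)
    · rw [← hf.real c hc, hf'.real c hc, State.writeNat_real]
  refine searched_count hs hsound (by omega) (by omega) fun a ha t hf htsound => ?_
  have hin := hinput t hf
  refine searched_count (hin.writeNat (by omega) _ _) (htsound.writeNat (by omega) (by omega) _ _)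
    (by omega) (by omega) fun b hb t' hf' ht'sound => ?_
  have hin' := hinput t' (hlift hf hf')
  refine searched_count (hin'.writeNat (by omega) _ _)
    (ht'sound.writeNat (by omega) (by omega) _ _) (by omega) (by omega)
    fun e he t'' hf'' ht''sound => ?_
  have hin'' : D.IsInput t'' := by
    refine (hin'.writeNat (a := 12) (by omega) 0 b).frame hf'' (fun c hc h => ?_) fun c hc h => ?_
    · exact hw c (by omega) (by omega) (by omega) hc (Or.inr (Or.inr h))
    · rcases h with h | h
      · have := writesReal_searchFrom h
        omega
      · have := writesReal_searchFrom h
        omega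
  have h := hbody (t''.writeNat 13 0 e) (hin''.writeNat (by omega) _ _)
    (ht''sound.writeNat (by omega) (by omega) _ _)
  have e₃ : (t''.writeNat 13 0 e).nat 13 0 = e := by simp
  have e₂ : (t''.writeNat 13 0 e).nat 12 0 = b := by
    rw [State.writeNat_nat, if_neg (by omega), hf''.nat 12 (not_or.2 ⟨by omega, hcell 12 (by simp)⟩)]
    simp
  have e₁ : (t''.writeNat 13 0 e).nat 11 0 = a := by
    rw [State.writeNat_nat, if_neg (by omega), hf''.nat 11 (not_or.2 ⟨by omega, hcell 11 (by simp)⟩),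
      State.writeNat_nat, if_neg (by omega),
      hf'.nat 11 (not_or.2 ⟨by omega, not_or.2 ⟨by omega, hcell 11 (by simp)⟩⟩)]
    simp
  rw [e₁, e₂, e₃] at h
  exact h

end FairClustering

namespace FairClustering

open RealRAM CountProg

/-! ### Completeness of the enumeration -/

variable {D : Data} {k : ℕ}

/-- Every fair clustering can be replaced by one whose centers and radius are enumerated. -/
theorem exists_candidate (hk : 1 ≤ k) (hn : 1 ≤ D.n) {f : ℕ → ℕ} {c : ℕ → ℝ × ℝ} {ρ : ℝ}
    (hρ : 0 ≤ ρ) (hf : Admissible D.n k (fun i j => sqDist (D.point i) (c j) ≤ ρ * ρ) f)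
    (hfair : D.Fair k f) :
    ∃ r ≤ ρ, ∃ a < D.n, ∃ b < D.n, ∃ e < D.n,
      D.IsCandidate k (D.point a) (middle (D.point a) (D.point b)) r ∨
      D.IsCandidate k (D.point a) (circumcenter (D.point a) (D.point b) (D.point e)) r := by
  classical
  set P : ℕ → Finset ℕ := fun j => (Finset.range D.n).filter fun i => f i = j with hP
  have hmem : ∀ {i j}, i ∈ P j ↔ i < D.n ∧ f i = j := by
    intro i j
    simp [hP]
  have hex : ∀ j, ∃ (c : ℝ × ℝ) (a : ℕ), (P j).Nonempty → a ∈ P j ∧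
      (∀ i ∈ P j, sqDist (D.point i) c ≤ sqDist (D.point a) c) ∧
      (∀ c', ∃ i ∈ P j, sqDist (D.point a) c ≤ sqDist (D.point i) c') ∧
      ∃ b ∈ P j, ∃ e ∈ P j, c = middle (D.point a) (D.point b) ∨
        c = circumcenter (D.point a) (D.point b) (D.point e) := by
    intro j
    -- The centers are chosen for all `j`; for empty clusters the values are arbitrary and their
    -- properties are guarded by nonemptiness.
    by_cases h : (P j).Nonempty
    · obtain ⟨c, a, h⟩ := exists_smallest_circle h D.point
      exact ⟨c, a, fun _ => h⟩
    · exact ⟨0, 0, fun h' => absurd h' h⟩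
  choose C A hCA using hex
  obtain ⟨j₀, hj₀, hmax⟩ := ((Finset.range k).filter fun j => (P j).Nonempty).exists_max_image
    (fun j => sqDist (D.point (A j)) (C j))
    ⟨f 0, by
      simp only [Finset.mem_filter, Finset.mem_range]
      exact ⟨(hf 0 hn).1, 0, hmem.2 ⟨hn, rfl⟩⟩⟩
  simp only [Finset.mem_filter, Finset.mem_range] at hj₀ hmax
  obtain ⟨hj₀k, hne⟩ := hj₀
  obtain ⟨ha, -, hge, b, hb, e, he, hform⟩ := hCA j₀ hne
  set r := Real.sqrt (sqDist (D.point (A j₀)) (C j₀)) with hr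
  have hr0 : 0 ≤ r := Real.sqrt_nonneg _
  have hrr : r * r = sqDist (D.point (A j₀)) (C j₀) := Real.mul_self_sqrt (sqDist_nonneg _ _)
  -- The given center of the cluster `j₀` cannot do better than its smallest enclosing circle.
  have hrρ : r ≤ ρ := by
    obtain ⟨i, hi, hi'⟩ := hge (c j₀)
    obtain ⟨hin, hij⟩ := hmem.1 hi
    have := (hf i hin).2
    rw [hij] at this
    exact Real.sqrt_le_iff.2 ⟨hρ, by rw [pow_two]; exact hi'.trans this⟩
  have hcover : ∀ j < k, ∀ i ∈ P j, sqDist (D.point i) (C j) ≤ r * r := by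
    intro j hj i hi
    rw [hrr]
    exact ((hCA j ⟨i, hi⟩).2.1 i hi).trans (hmax j ⟨hj, i, hi⟩)
  have hcorner : ∀ j < k, ∃ c', D.IsCorner r c' ∧ ∀ i ∈ P j, sqDist (D.point i) c' ≤ r * r := by
    intro j hj
    by_cases h : (P j).Nonempty
    · obtain ⟨c', h₁, a, ha, b, hb, h₂⟩ := exists_corner h D.point hr0 ⟨C j, hcover j hj⟩
      exact ⟨c', ⟨a, (hmem.1 ha).1, b, (hmem.1 hb).1, h₂⟩, h₁⟩
    -- An empty cluster accepts any corner; the point `0` provides one.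
    · exact ⟨_, ⟨0, hn, 0, hn, Or.inl rfl⟩, fun i hi => absurd ⟨i, hi⟩ h⟩
  choose! E hE using hcorner
  -- The program treats the last cluster as the largest. Swapping labels preserves fairness, because
  -- the bounds do not depend on the cluster.
  set σ := Equiv.swap j₀ (k - 1) with hσ
  have hσk : ∀ j < k, σ j < k := by
    intro j hj
    rw [hσ, Equiv.swap_apply_def]
    split_ifs <;> omega
  have hcand : D.IsCandidate k (D.point (A j₀)) (C j₀) r := by
    refine ⟨hr, fun j => if j < k - 1 then E (σ j) else C j₀, fun j hj => ?_, fun j hj => ?_,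
      fun i => σ (f i), fun i hi => ⟨hσk _ (hf i hi).1, ?_⟩, fun q hq j hj => ?_⟩
    · beta_reduce
      rw [if_pos hj]
      exact (hE _ (hσk j (by omega))).1
    · beta_reduce
      rw [if_neg (by omega)]
    · beta_reduce
      have hσσ : σ (σ (f i)) = f i := Equiv.swap_apply_self _ _ _
      split_ifs with h
      · rw [hσσ]
        exact (hE _ (hf i hi).1).2 i (hmem.2 ⟨hi, rfl⟩)
      · have h₁ : σ (f i) = k - 1 := by
          have := hσk _ (hf i hi).1
          omega
        have h₂ : f i = j₀ := by
          rw [← hσσ, h₁]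
          exact Equiv.swap_apply_right _ _
        exact hcover j₀ hj₀k i (hmem.2 ⟨hi, h₂⟩)
    · have hcount : count D.n D.color (fun i => σ (f i)) q j = count D.n D.color f q (σ j) := by
        unfold count
        congr 1
        refine Finset.filter_congr fun i _ => and_congr_right fun _ => ?_
        rw [hσ]
        exact Equiv.swap_apply_eq_iff
      rw [hcount]
      exact hfair q hq (σ j) (hσk j hj)
  refine ⟨r, hrρ, A j₀, (hmem.1 ha).1, b, (hmem.1 hb).1, e, (hmem.1 he).1, ?_⟩
  rcases hform with h | h
  · rw [← h]
    exact Or.inl hcand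
  · rw [← h]
    exact Or.inr hcand

/-! ### Running time -/

theorem wellFormed_improve : ∀ Q : List (List ℕ), (improve Q).WellFormed ∧
    (improve Q).TwoBounds ∧ ∀ b, (improve Q).depth b = 0 := by
  have hmove : ∀ (p : List ℕ) (a : ℕ), (moveAlong a p).WellFormed ∧ (moveAlong a p).TwoBounds ∧
      ∀ b, (moveAlong a p).depth b = 0 := by
    intro p
    induction p with
    | nil => exact fun a => ⟨trivial, trivial, fun _ => rfl⟩
    | cons b p ih =>
      intro a
      obtain ⟨h₁, h₂, h₃⟩ := ih b
      exact ⟨⟨trivial, h₁⟩, ⟨trivial, h₂⟩, fun c => by simp [moveAlong, depth, h₃]⟩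
  intro Q
  induction Q with
  | nil => exact ⟨trivial, trivial, fun _ => rfl⟩
  | cons p Q ih =>
    cases p with
    | nil => exact ih
    | cons a p =>
      obtain ⟨h₁, h₂, h₃⟩ := hmove p a
      exact ⟨⟨h₁, ih.1⟩, ⟨h₂, ih.2.1⟩, fun c => by simp [improve, depth, h₃, ih.2.2]⟩

/-- Well-formed programs with at most `a` nested loops over the points and `b` nested loops over the
colors. -/
structure Bounded (a b : ℕ) (p : CountProg) : Prop where
  wellFormed : p.WellFormed
  twoBounds : p.TwoBounds
  points : p.depth 0 ≤ a
  colors : p.depth 1 ≤ b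

theorem Bounded.skip {a b : ℕ} : Bounded a b .skip :=
  ⟨trivial, trivial, Nat.zero_le _, Nat.zero_le _⟩

theorem Bounded.setNat {a b c : ℕ} {i e : NatExpr} : Bounded a b (.setNat c i e) :=
  ⟨trivial, trivial, Nat.zero_le _, Nat.zero_le _⟩

theorem Bounded.setReal {a b c : ℕ} {i : NatExpr} {e : RealExpr} :
    Bounded a b (.setReal c i e) :=
  ⟨trivial, trivial, Nat.zero_le _, Nat.zero_le _⟩

theorem Bounded.seq {a b : ℕ} {p q : CountProg} (hp : Bounded a b p) (hq : Bounded a b q) :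
    Bounded a b (.seq p q) :=
  ⟨⟨hp.1, hq.1⟩, ⟨hp.2, hq.2⟩, max_le hp.3 hq.3, max_le hp.4 hq.4⟩

theorem Bounded.ite {a b : ℕ} {t : Test} {p q : CountProg} (hp : Bounded a b p)
    (hq : Bounded a b q) : Bounded a b (.ite t p q) :=
  ⟨⟨hp.1, hq.1⟩, ⟨hp.2, hq.2⟩, max_le hp.3 hq.3, max_le hp.4 hq.4⟩

theorem Bounded.unroll {a b : ℕ} {p : ℕ → CountProg} (h : ∀ j < k, Bounded a b (p j)) :
    Bounded a b (unroll p k) :=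
  ⟨wellFormed_unroll fun j hj => (h j hj).1, twoBounds_unroll fun j hj => (h j hj).2,
    depth_unroll_le fun j hj => (h j hj).3, depth_unroll_le fun j hj => (h j hj).4⟩

theorem Bounded.countPoints {a b v : ℕ} {p : CountProg} (hp : Bounded a b p) (hv : v ≠ 0)
    (hpv : ¬ p.WritesNat v) (hp0 : ¬ p.WritesNat 0) : Bounded (a + 1) b (.count v 0 p) :=
  ⟨⟨hv, hpv, hp0, hp.1⟩, ⟨Or.inl rfl, hp.2⟩, by simpa [depth] using hp.3,
    by simpa [depth] using hp.4⟩

theorem Bounded.countColors {a b v : ℕ} {p : CountProg} (hp : Bounded a b p) (hv : v ≠ 0)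
    (hpv : ¬ p.WritesNat v) (hp0 : ¬ p.WritesNat 0) : Bounded a (b + 1) (.count v 1 p) :=
  ⟨⟨hv, hpv, hp0, hp.1⟩, ⟨Or.inr rfl, hp.2⟩, by simpa [depth] using hp.3,
    by simpa [depth] using hp.4⟩

theorem Bounded.mono {a b a' b' : ℕ} {p : CountProg} (hp : Bounded a b p) (ha : a ≤ a')
    (hb : b ≤ b') : Bounded a' b' p :=
  ⟨hp.1, hp.2, hp.3.trans ha, hp.4.trans hb⟩

theorem bounded_firstAssignment : Bounded 1 0 (firstAssignment k) := by
  refine .seq .setNat (Bounded.countPoints (a := 0)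
    (.seq .setNat (.seq (.unroll fun _ _ => .ite .setNat .skip) (.ite .setNat .skip)))
    (by omega) (fun h => ?_) fun h => ?_)
  · have := writesNat_assignPoint h
    omega
  · have := writesNat_assignPoint h
    omega

theorem bounded_gather : Bounded 1 0 (gather k) := by
  refine .seq (.unroll fun _ _ => .seq .setNat (.unroll fun _ _ => .setNat))
    (Bounded.countPoints (a := 0)
      (.ite (.seq .setNat (.unroll fun _ _ => .ite .setNat .skip)) .skip)
      (by omega) (fun h => ?_) fun h => ?_)
  · have := writesNat_gatherPoint h
    omega
  · have := writesNat_gatherPoint h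
    omega

theorem bounded_improveRound : Bounded 1 0 (improveRound k) := by
  obtain ⟨h₁, h₂, h₃⟩ := wellFormed_improve (simplePaths k)
  exact .seq bounded_gather ⟨h₁, h₂, by rw [h₃]; omega, by rw [h₃]⟩

theorem bounded_balanceAll : Bounded 2 1 (balanceAll k) := by
  refine Bounded.countColors (b := 0) (.seq (Bounded.countPoints (a := 1)
    (.seq bounded_improveRound bounded_improveRound) (by omega) (fun h => ?_) fun h => ?_)
    ((Bounded.seq bounded_gather (.unroll fun _ _ => .ite .skip .setNat)).mono
      (by omega) le_rfl)) (by omega) (fun h => ?_) fun h => ?_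
  · rcases h with h | h <;>
    · have := writesNat_improveRound h
      omega
  · rcases h with h | h <;>
    · have := writesNat_improveRound h
      omega
  · have := writesNat_balanceColor h
    omega
  · have := writesNat_balanceColor h
    omega

theorem bounded_store : Bounded 1 0 (store k) :=
  .seq .setNat (.seq .setReal (.seq (.unroll fun _ _ => .seq .setReal .setReal)
    (Bounded.countPoints (a := 0) .setNat (by omega) (by simp [WritesNat]) (by simp [WritesNat]))))

theorem bounded_testCenters : Bounded 2 1 (testCenters k) :=
  .seq (bounded_firstAssignment.mono (by omega) (by omega))
    (.seq (.ite bounded_balanceAll .skip) (.ite (bounded_store.mono (by omega) (by omega)) .skip))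

theorem bounded_setCenter {a b j : ℕ} {e : RealExpr × RealExpr} : Bounded a b (setCenter j e) :=
  .seq .setReal .setReal

/-- Each placed center costs two loops over the points, and the test at the bottom two more. -/
theorem bounded_searchCenters (j : ℕ) : Bounded (2 * j + 2) 1 (searchCenters k j) := by
  induction j with
  | zero => exact bounded_testCenters
  | succ j ih =>
    refine Bounded.countPoints (a := 2 * j + 3) (Bounded.countPoints (a := 2 * j + 2)
      (.seq (.seq bounded_setCenter ih) (.seq bounded_setCenter ih)) (by omega) (fun h => ?_)
      fun h => ?_) (by omega) (fun h => ?_) fun h => ?_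
    · simp only [WritesNat, setCenter, false_or, or_self] at h
      have := writesNat_searchCenters h
      omega
    · simp only [WritesNat, setCenter, false_or, or_self] at h
      have := writesNat_searchCenters h
      omega
    · simp only [WritesNat, setCenter, false_or, or_self] at h
      rcases h with h | h
      · omega
      · have := writesNat_searchCenters h
        omega
    · simp only [WritesNat, setCenter, false_or, or_self] at h
      rcases h with h | h
      · omega
      · have := writesNat_searchCenters h
        omega

theorem writesNat_search {a : ℕ} (h : (search k).WritesNat a) : 4 ≤ a := by
  rcases h with h | h | h | h | h
  · omega
  · omega
  · omega
  · have := writesNat_searchFrom h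
    omega
  · have := writesNat_searchFrom h
    omega

/-- With `j = k - 1` the inner search has depth `2 * k`, and the triple defining the largest cluster
adds three loops. -/
theorem bounded_search (hk : 1 ≤ k) : Bounded (2 * k + 3) 1 (search k) := by
  have hfrom : ∀ e, Bounded (2 * k) 1 (searchFrom k e) := fun e =>
    .seq bounded_setCenter (.seq .setReal ((bounded_searchCenters _).mono (by omega) le_rfl))
  have hw : ∀ a, a = 0 ∨ a = 11 ∨ a = 12 ∨ a = 13 → ∀ e, ¬ (searchFrom k e).WritesNat a := by
    intro a ha e h
    have := writesNat_searchFrom h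
    omega
  refine Bounded.countPoints (a := 2 * k + 2) (Bounded.countPoints (a := 2 * k + 1)
    (Bounded.countPoints (a := 2 * k) (.seq (hfrom _) (hfrom _)) ?_ ?_ ?_) ?_ ?_ ?_) ?_ ?_ ?_ <;>
    simp [WritesNat, hw]

/-! ### Translation between instances and arrays, and the final correctness proof. -/

/-- The memory contents of an instance. -/
theorem Instance.exists_data {n m : ℕ} (I : Instance n m) :
    ∃ D : Data, D.IsInput I.input ∧ D.n = n ∧ D.m = m ∧
      (∀ i : Fin n, D.color i = I.color i ∧ D.point i = (I.point i 0, I.point i 1)) ∧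
      ∀ q : Fin m, D.lower q = I.lower q ∧ D.upper q = I.upper q := by
  refine ⟨⟨I.input.nat 0, I.input.nat 1, I.input.nat 2, I.input.nat 3, pointAt I.input.real⟩,
    ⟨rfl, rfl, rfl, rfl, rfl⟩, rfl, rfl, fun i => ⟨?_, ?_⟩, fun q => ⟨?_, ?_⟩⟩ <;>
    simp [Instance.input, pointAt]

variable {n m : ℕ} {I : Instance n m}

theorem sqDist_eq_dist_mul_dist (x y : EuclideanSpace ℝ (Fin 2)) :
    sqDist (x 0, x 1) (y 0, y 1) = dist x y * dist x y := by
  rw [EuclideanSpace.dist_eq, Real.mul_self_sqrt (by positivity), Fin.sum_univ_two, Real.dist_eq,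
    Real.dist_eq, sq_abs, sq_abs, sqDist]
  ring

theorem Instance.maxRadius_le {c : Clustering n k} {r : ℝ} (hr : 0 ≤ r) :
    (I.maxRadius c : ℝ) ≤ r ↔ ∀ i, dist (I.point i) (c.center (c.assign i)) ≤ r := by
  lift r to NNReal using hr
  simp only [NNReal.coe_le_coe, Instance.maxRadius, Instance.radius, Finset.sup_le_iff,
    Finset.mem_univ, true_imp_iff, Clustering.cluster, Finset.mem_filter, true_and]
  have hcoe : ∀ x y : EuclideanSpace ℝ (Fin 2), nndist x y ≤ r ↔ dist x y ≤ r := fun x y => by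
    rw [← coe_nndist, NNReal.coe_le_coe]
  simp only [hcoe]
  exact ⟨fun h i => h _ i rfl, fun h j i hi => hi ▸ h i⟩

/-- The number of points of a color in a cluster, in terms of arrays. -/
theorem count_eq_card {f : ℕ → ℕ} {c : Clustering n k} (hn : D.n = n)
    (hcol : ∀ i : Fin n, D.color i = I.color i) (hf : ∀ i : Fin n, f i = c.assign i) (q : Fin m)
    (j : Fin k) : count D.n D.color f q j =
      ((c.cluster j).filter fun i => I.color i = q).card := by
  rw [count, hn]
  symm
  refine Finset.card_bij (fun i _ => (i : ℕ)) ?_ (fun i _ i' _ h => Fin.ext h) ?_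
  · intro i hi
    simp only [Clustering.cluster, Finset.mem_filter, Finset.mem_univ, true_and] at hi
    simp [hcol, hf, hi.1, hi.2]
  · intro i hi
    simp only [Finset.mem_filter, Finset.mem_range] at hi
    have h₁ := hcol ⟨i, hi.1⟩
    have h₂ := hf ⟨i, hi.1⟩
    simp only at h₁ h₂
    refine ⟨⟨i, hi.1⟩, ?_, rfl⟩
    simp only [Clustering.cluster, Finset.mem_filter, Finset.mem_univ, true_and]
    exact ⟨Fin.ext (by rw [← h₂, hi.2.2]), Fin.ext (by rw [← h₁, hi.2.1])⟩

theorem isFair_iff {f : ℕ → ℕ} {c : Clustering n k} (hn : D.n = n) (hm : D.m = m)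
    (hcol : ∀ i : Fin n, D.color i = I.color i)
    (hlu : ∀ q : Fin m, D.lower q = I.lower q ∧ D.upper q = I.upper q)
    (hf : ∀ i : Fin n, f i = c.assign i) : I.IsFair c ↔ D.Fair k f := by
  unfold Instance.IsFair Data.Fair Balanced
  rw [hm]
  constructor
  · intro h q hq j hj
    have h' := h ⟨j, hj⟩ ⟨q, hq⟩
    rw [← count_eq_card hn hcol hf, ← (hlu _).1, ← (hlu _).2] at h'
    exact h'
  · intro h j q
    rw [← count_eq_card hn hcol hf, ← (hlu _).1, ← (hlu _).2]
    exact h q q.2 j j.2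

/-- The memory after the search solves the problem. -/
theorem isSolvedBy_search (hk : 1 ≤ k) (hn : 1 ≤ n) (I : Instance n m) :
    I.IsSolvedBy k ((search k).run I.input) := by
  obtain ⟨D, hin, hDn, hDm, hpt, hlu⟩ := I.exists_data
  have hcol := fun i => (hpt i).1
  have hsearch := run_search (k := k) hin (Or.inl rfl)
  set s := (search k).run I.input with hs
  -- Completeness: the stored radius is at most the cost of every fair clustering.
  have hreach : ∀ d : Clustering n k, I.IsFair d → Reached (I.maxRadius d) s := by
    intro d hd
    set f : ℕ → ℕ := fun i => if h : i < n then d.assign ⟨i, h⟩ else 0 with hf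
    set c : ℕ → ℝ × ℝ := fun j => if h : j < k then (d.center ⟨j, h⟩ 0, d.center ⟨j, h⟩ 1) else 0
      with hc
    have hfd : ∀ i : Fin n, f i = d.assign i := fun i => by simp [hf]
    obtain ⟨r, hr, h⟩ := exists_candidate (D := D) (k := k) (f := f) (c := c)
      (ρ := I.maxRadius d) hk (hDn ▸ hn) (NNReal.coe_nonneg _)
      (by
        intro i hi
        rw [hDn] at hi
        have h₁ := hfd ⟨i, hi⟩
        simp only at h₁
        rw [h₁]
        refine ⟨Fin.is_lt _, ?_⟩
        have h₂ := (hpt ⟨i, hi⟩).2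
        simp only at h₂
        simp only [hc, Fin.is_lt, dif_pos, Fin.eta, h₂]
        rw [sqDist_eq_dist_mul_dist]
        have h₃ := (Instance.maxRadius_le (I := I) (c := d) (NNReal.coe_nonneg _)).1 le_rfl ⟨i, hi⟩
        exact mul_self_le_mul_self dist_nonneg h₃)
      ((isFair_iff hDn hDm hcol hlu hfd).1 hd)
    have h' := hsearch.reached r h
    exact ⟨h'.1, h'.2.trans hr⟩
  rcases hsearch.sound with h0 | ⟨h1, hr0, hfair, hadm⟩
  · refine Or.inr ⟨h0, fun ⟨d, hd⟩ => ?_⟩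
    have := (hreach d hd).1
    omega
  · refine Or.inl ⟨h1, ?_⟩
    have hlt : ∀ i : Fin n, s.nat 5 i < k := fun i => (hadm i (by rw [hDn]; exact i.2)).1
    set c : Clustering n k := ⟨fun j => !₂[s.real 2 j, s.real 3 j], fun i => ⟨s.nat 5 i, hlt i⟩⟩
      with hc
    have hcfair : I.IsFair c := (isFair_iff hDn hDm hcol hlu fun i => rfl).2 hfair
    -- Soundness gives the cost of the stored clustering only an upper bound; equality follows by
    -- applying `hreach` to that clustering itself.
    have hle : (I.maxRadius c : ℝ) ≤ s.real 4 0 := by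
      rw [Instance.maxRadius_le hr0]
      intro i
      have h := (hadm i (by rw [hDn]; exact i.2)).2
      beta_reduce at h
      rw [(hpt i).2] at h
      have h' := sqDist_eq_dist_mul_dist (I.point i) (c.center (c.assign i))
      simp only [hc, PiLp.toLp_apply, Matrix.cons_val_zero, Matrix.cons_val_one] at h'
      rw [h'] at h
      exact abs_le_of_sq_le_sq' (by nlinarith) hr0 |>.2
    refine ⟨c, ⟨hcfair, fun d hd => ?_⟩, ⟨fun i => rfl, fun j => ⟨rfl, rfl⟩⟩,
      le_antisymm (hreach c hcfair).2 hle⟩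
    exact_mod_cast hle.trans (hreach d hd).2

end FairClustering

theorem theorem2 (k : ℕ) (hk : 1 ≤ k) :
    ∃ (prog : RealRAM.Prog) (K : ℕ), ∀ (n m : ℕ), 1 ≤ n →
      ∀ I : FairClustering.Instance n m, ∃ (t : ℕ) (s : RealRAM.State),
        RealRAM.Exec prog I.input t s ∧
        t ≤ K * (m * n ^ (2 * k + 4)) ∧
        I.IsSolvedBy k s := by
  have hb := FairClustering.bounded_search hk
  obtain ⟨K, hK⟩ := RealRAM.CountProg.cost_le _ hb.twoBounds
  refine ⟨(FairClustering.search k).compile, K, fun n m hn I => ?_⟩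
  obtain ⟨t, ht, hexec⟩ := RealRAM.CountProg.exec_compile (FairClustering.search k) I.input
    hb.wellFormed (fun h => absurd (FairClustering.writesNat_search h) (by omega)) rfl
  refine ⟨t, _, hexec, ht.trans ((hK _ hn ?_).trans (Nat.mul_le_mul_left _ (Nat.mul_le_mul ?_ ?_))),
    FairClustering.isSolvedBy_search hk hn I⟩
  -- There is at least one point, and its color shows that there is at least one color.
  · exact Nat.succ_le_of_lt (Nat.zero_lt_of_lt (I.color ⟨0, hn⟩).2)
  · have hm : 0 < m := Nat.zero_lt_of_lt (I.color ⟨0, hn⟩).2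
    exact (Nat.pow_le_pow_right hm hb.colors).trans_eq (pow_one m)
  -- The loop depth is at most `2 * k + 3`, so the claimed exponent leaves one factor `n` to spare.
  · exact Nat.pow_le_pow_right hn (hb.points.trans (by omega))
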